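/- Let $K$ be a field of characteristic different from $2$. A superalgebra is a $\mathbb{Z}/2$-graded associative unital $K$-algebra $A=A_0\oplus A_1$ that is supercommutative, $ab=(-1)^{|a||b|}ba$ for homogeneous $a,b$; $\mathsf{SAlg}_K$ is the category of superalgebras. A $K$-functor is a set-valued functor on $\mathsf{SAlg}_K$; the affine superscheme $SSp\,A$ is the functor $\mathrm{Hom}_{\mathsf{SAlg}_K}(A,-)$. A subfunctor $Y\subseteq X$ is open if for every $SSp\,A\to X$ its preimage has the form $D(I)$, $D(I)(B)=\{x \mid x(I)B=B\}$, with $I$ a superideal of $A$; open subfunctors of $X$ form an open covering if they cover $X(L)$ for every field extension $L/K$. A superscheme is a $K$-functor that is a sheaf for the finite coverings $SSp\,R_{f_i}\to SSp\,R$ ($f_i\in R_0$, $\sum R_0f_i=R_0$) and has an open covering by affine superschemes; it is Noetherian if there is a finite such covering by $SSp\,A_i$ with all $A_i$ Noetherian. The sheafification of a $K$-functor is taken for the fppf topology, whose coverings are the finite families $SSp\,R_i\to SSp\,R$ with each $R_i$ a finitely presented $R$-superalgebra and $\prod_i R_i$ faithfully flat over $R$. An algebraic supergroup is a group-valued functor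 $G$ on $\mathsf{SAlg}_K$ represented by a finitely generated superalgebra; a closed supersubgroup $H$ of $G$ is a closed subfunctor whose values are subgroups. If $G$ acts on a $K$-functor $X$ from the right, freely on $X(R)$ for every $R$, then $X\tilde{/}G$ is the sheafification of the naive quotient $R\mapsto X(R)/G(R)$, and $X\to X\tilde{/}G$ is the quotient morphism; in particular $G\tilde{/}H$ is defined through right multiplication of $H$ on $G$. A morphism $f:X\to Y$ of $K$-functors is affine if $X\times_Y SSp\,R$ is affine for all $SSp\,R\to Y$. A morphism of superschemes is flat if $A$ is flat over $B$ for all open affine $SSp\,A\subseteq X$, $SSp\,B\subseteq Y$ with $f(SSp\,A)\subseteq SSp\,B$, and faithfully flat if moreover it is surjective on the points of the geometric realizations, where the set of points of $X$ is the direct limit, over all pairs $(R,x)$ with $x\in X(R)$, of the sets of prime superideals of $R$. (a) Let an algebraic supergroup $G$ act freely on an affine superscheme $X$. If $X\tilde{/}G$ is a superscheme, then the quotient morphism $X\to X\tilde{/}G$ is affine and faithfully flat. (b) Consequently, let $H$ be a closed supersubgroup of an algebraic supergroup $G$. If $G\tilde{/}H$ is a superscheme, then $\pi:G\to G\tilde{/}H$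 is a Brundan quotient of $G$ by $H$, that is: $G\tilde{/}H$ is a Noetherian superscheme; $\pi$ is affine and faithfully flat; $\pi$ factors through the naive quotient of $G$ by $H$; and every morphism from $G$ to a superscheme that factors through the naive quotient factors uniquely through $\pi$. Moreover, for every Brundan quotient $\pi':G\to Y$ of $G$ by $H$ there is a unique isomorphism $e:G\tilde{/}H\to Y$ with $e\pi=\pi'$. -/

import Mathlib

universe u

open CategoryTheory

noncomputable section

/-- A supercommutative superalgebra over `K` (an object of `SAlg_K`): an associative unital
`K`-algebra with a `ℤ/2`-grading such that `a b = (-1)^{|a||b|} b a` for homogeneous `a`, `b`,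
i.e. even elements are central and odd elements anticommute. -/
structure SAlg (K : Type u) [Field K] where
  carrier : Type u
  [ring : Ring carrier]
  [algebra : Algebra K carrier]
  grading : ZMod 2 → Submodule K carrier
  [graded : GradedAlgebra grading]
  even_comm : ∀ a ∈ grading 0, ∀ b, a * b = b * a
  odd_anticomm : ∀ a ∈ grading 1, ∀ b ∈ grading 1, a * b = -(b * a)

namespace SAlg

attribute [instance] SAlg.ring SAlg.algebra SAlg.graded

instance {K : Type u} [Field K] : CoeSort (SAlg K) (Type u) := ⟨SAlg.carrier⟩

/-- Superalgebra morphisms: `K`-algebra maps preserving the grading. -/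
@[ext]
structure Hom {K : Type u} [Field K] (A B : SAlg K) where
  toAlgHom : A →ₐ[K] B
  map_mem : ∀ i, ∀ a ∈ A.grading i, toAlgHom a ∈ B.grading i

instance {K : Type u} [Field K] : Category.{u} (SAlg K) where
  Hom A B := Hom A B
  id A := ⟨AlgHom.id K A, fun _ _ h => h⟩
  comp f g := ⟨g.toAlgHom.comp f.toAlgHom, fun i a h => g.map_mem i _ (f.map_mem i a h)⟩

/-- The underlying ring homomorphism of a superalgebra morphism. -/
def Hom.ringHom {K : Type u} [Field K] {A B : SAlg K} (f : A ⟶ B) : A →+* B :=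
  (Hom.toAlgHom f).toRingHom

/-- A superideal: a `ℤ/2`-graded ideal. (By supercommutativity a graded left ideal is
two-sided.) -/
def IsSuperideal {K : Type u} [Field K] (A : SAlg K) (I : Ideal A) : Prop :=
  I.IsHomogeneous A.grading

/-- The (purely even) superalgebras that are field extensions of `K`. -/
def IsFieldExtension {K : Type u} [Field K] (A : SAlg K) : Prop :=
  IsField A ∧ A.grading 1 = ⊥

/-- `φ : R ⟶ S` is the localization of `R` at the even element `f`, i.e. `S = R_f`. -/
structure IsLocalizationAway {K : Type u} [Field K] {R S : SAlg K} (φ : R ⟶ S) (f : R) :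
    Prop where
  isUnit : IsUnit (Hom.ringHom φ f)
  surj : ∀ s : S, ∃ (n : ℕ) (r : R), Hom.ringHom φ f ^ n * s = Hom.ringHom φ r
  eq_zero : ∀ r : R, Hom.ringHom φ r = 0 → ∃ n : ℕ, f ^ n * r = 0

/-- `i : R ⟶ P` exhibits `P` as the free supercommutative `R`-superalgebra
`R[x₁,…,x_m | y₁,…,y_n]` on the even elements `x` and the odd elements `y`. -/
structure IsFreeOn {K : Type u} [Field K] {R P : SAlg K} (i : R ⟶ P) {m n : ℕ}
    (x : Fin m → P) (y : Fin n → P) : Prop where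
  even : ∀ k, x k ∈ P.grading 0
  odd : ∀ k, y k ∈ P.grading 1
  existsUnique_lift : ∀ (T : SAlg K) (ψ : R ⟶ T) (s : Fin m → T) (t : Fin n → T),
    (∀ k, s k ∈ T.grading 0) → (∀ k, t k ∈ T.grading 1) →
      ∃! h : P ⟶ T, i ≫ h = ψ ∧ (∀ k, Hom.ringHom h (x k) = s k) ∧
        ∀ k, Hom.ringHom h (y k) = t k

/-- `S` is a finitely presented `R`-superalgebra via `φ`: a quotient of a free supercommutative
`R`-superalgebra on finitely many even and odd generators by a finitely generated superideal. -/
def IsFinitelyPresented {K : Type u} [Field K] {R S : SAlg K} (φ : R ⟶ S) : Prop :=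
  ∃ (P : SAlg K) (i : R ⟶ P) (m n : ℕ) (x : Fin m → P) (y : Fin n → P) (q : P ⟶ S),
    IsFreeOn i x y ∧ i ≫ q = φ ∧ Function.Surjective (Hom.ringHom q) ∧
      (RingHom.ker (Hom.ringHom q)).FG

end SAlg

/-! ### Flatness over a not necessarily commutative ring -/

namespace NCFlat

open scoped TensorProduct

/-- The relations `(n a) ⊗ b = n ⊗ (φ(a) b)` defining `N ⊗_A B`, for a right `A`-module `N`
and the left `A`-module `B` given by `φ : A → B`. -/
def relations {A B : Type u} [Ring A] [Ring B] (φ : A →+* B) (N : Type u) [AddCommGroup N]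
    [Module Aᵐᵒᵖ N] : AddSubgroup (N ⊗[ℤ] B) :=
  AddSubgroup.closure
    {t | ∃ (n : N) (a : A) (b : B), t = (MulOpposite.op a • n) ⊗ₜ[ℤ] b - n ⊗ₜ[ℤ] (φ a * b)}

/-- The tensor product `N ⊗_A B`. -/
abbrev Tensor {A B : Type u} [Ring A] [Ring B] (φ : A →+* B) (N : Type u) [AddCommGroup N]
    [Module Aᵐᵒᵖ N] : Type u :=
  (N ⊗[ℤ] B) ⧸ relations φ N

/-- The map `f ⊗ id : N ⊗_ℤ B → N' ⊗_ℤ B`. -/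
def preMap {A : Type u} (B : Type u) [Ring A] [Ring B] {N N' : Type u}
    [AddCommGroup N] [Module Aᵐᵒᵖ N] [AddCommGroup N'] [Module Aᵐᵒᵖ N']
    (f : N →ₗ[Aᵐᵒᵖ] N') : N ⊗[ℤ] B →+ N' ⊗[ℤ] B :=
  (LinearMap.rTensor B f.toAddMonoidHom.toIntLinearMap).toAddMonoidHom

lemma relations_le {A B : Type u} [Ring A] [Ring B] (φ : A →+* B) {N N' : Type u}
    [AddCommGroup N] [Module Aᵐᵒᵖ N] [AddCommGroup N'] [Module Aᵐᵒᵖ N']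
    (f : N →ₗ[Aᵐᵒᵖ] N') : relations φ N ≤ (relations φ N').comap (preMap B f) := by
  refine (AddSubgroup.closure_le _).2 ?_
  rintro _ ⟨n, a, b, rfl⟩
  refine AddSubgroup.subset_closure ⟨f n, a, b, ?_⟩
  simp [preMap]

/-- The map `f ⊗ id : N ⊗_A B → N' ⊗_A B`. -/
def map {A B : Type u} [Ring A] [Ring B] (φ : A →+* B) {N N' : Type u}
    [AddCommGroup N] [Module Aᵐᵒᵖ N] [AddCommGroup N'] [Module Aᵐᵒᵖ N']
    (f : N →ₗ[Aᵐᵒᵖ] N') : Tensor φ N →+ Tensor φ N' :=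
  QuotientAddGroup.map _ _ (preMap B f) (relations_le φ f)

/-- `B` is flat as a left `A`-module via `φ`: the functor `- ⊗_A B` on right `A`-modules
preserves injections. -/
def Flat {A B : Type u} [Ring A] [Ring B] (φ : A →+* B) : Prop :=
  ∀ (N N' : Type u) [AddCommGroup N] [Module Aᵐᵒᵖ N] [AddCommGroup N'] [Module Aᵐᵒᵖ N']
    (f : N →ₗ[Aᵐᵒᵖ] N'), Function.Injective f → Function.Injective (map φ f)

/-- `B` is faithfully flat as a left `A`-module via `φ`. -/
def FaithfullyFlat {A B : Type u} [Ring A] [Ring B] (φ : A →+* B) : Prop :=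
  Flat φ ∧ ∀ (N : Type u) [AddCommGroup N] [Module Aᵐᵒᵖ N],
    Subsingleton (Tensor φ N) → Subsingleton N

end NCFlat

/-! ### `K`-functors, open and closed subfunctors -/

/-- A `K`-functor: a set-valued functor on superalgebras. -/
abbrev KFunctor (K : Type u) [Field K] := SAlg K ⥤ Type (u + 1)

namespace KFunctor

/-- The affine superscheme `SSp A : B ↦ Hom(A, B)`. -/
def SSp {K : Type u} [Field K] (A : SAlg K) : KFunctor K :=
  coyoneda.obj (Opposite.op A) ⋙ uliftFunctor.{u + 1, u}

/-- The morphism `SSp φ : SSp B ⟶ SSp A` induced by `φ : A ⟶ B`. -/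
def SSp.map {K : Type u} [Field K] {A B : SAlg K} (φ : A ⟶ B) : SSp B ⟶ SSp A :=
  Functor.whiskerRight (coyoneda.map φ.op) uliftFunctor.{u + 1, u}

/-- A point of `SSp A` with values in `B`, regarded as a superalgebra morphism. -/
def SSp.hom {K : Type u} [Field K] {A B : SAlg K} (x : (SSp A).obj B) : A ⟶ B :=
  ULift.down x

/-- `X` is an affine superscheme. -/
def IsAffine {K : Type u} [Field K] (X : KFunctor K) : Prop :=
  ∃ A : SAlg K, Nonempty (X ≅ SSp A)

/-- `Y ⊆ SSp A` is `D(I)`, where `D(I)(B) = {x | x(I)B = B}`. -/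
def IsD {K : Type u} [Field K] {A : SAlg K} (Y : Subfunctor (SSp A)) (I : Ideal A) : Prop :=
  ∀ (B : SAlg K) (x : (SSp A).obj B),
    x ∈ Y.obj B ↔ Ideal.map (SAlg.Hom.ringHom (SSp.hom x)) I = ⊤

/-- `Y ⊆ SSp A` is `V(I)`, where `V(I)(B) = {x | x(I) = 0}`. -/
def IsV {K : Type u} [Field K] {A : SAlg K} (Y : Subfunctor (SSp A)) (I : Ideal A) : Prop :=
  ∀ (B : SAlg K) (x : (SSp A).obj B),
    x ∈ Y.obj B ↔ ∀ a ∈ I, SAlg.Hom.ringHom (SSp.hom x) a = 0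

/-- Open subfunctors: the preimage under each `SSp A ⟶ X` is some `D(I)`. -/
def IsOpen {K : Type u} [Field K] {X : KFunctor K} (Y : Subfunctor X) : Prop :=
  ∀ (A : SAlg K) (f : SSp A ⟶ X), ∃ I : Ideal A, A.IsSuperideal I ∧ IsD (Y.preimage f) I

/-- Closed subfunctors: the preimage under each `SSp A ⟶ X` is some `V(I)`. -/
def IsClosed {K : Type u} [Field K] {X : KFunctor K} (Y : Subfunctor X) : Prop :=
  ∀ (A : SAlg K) (f : SSp A ⟶ X), ∃ I : Ideal A, A.IsSuperideal I ∧ IsV (Y.preimage f) I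

/-- Open coverings: collections of open subfunctors which cover all points with values in
field extensions of `K`. -/
def IsOpenCovering {K : Type u} [Field K] {X : KFunctor K} (𝒰 : Set (Subfunctor X)) : Prop :=
  (∀ Y ∈ 𝒰, IsOpen Y) ∧
    ∀ L : SAlg K, L.IsFieldExtension → ∀ x : X.obj L, ∃ Y ∈ 𝒰, x ∈ Y.obj L

/-! ### Topologies on the category of affine superschemes, and sheaves -/

/-- A `K`-functor as a presheaf on the category `(SAlg K)ᵒᵖ` of affine superschemes. -/
abbrev presheaf {K : Type u} [Field K] (X : KFunctor K) :
    ((SAlg K)ᵒᵖ)ᵒᵖ ⥤ Type (u + 1) :=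
  unopUnop (SAlg K) ⋙ X

/-- The coverings of `T_loc`: finite families `SSp R_{f_i} → SSp R` with `f_i ∈ R_0`
and `∑ R_0 f_i = R_0`. -/
def locCoverings (K : Type u) [Field K] : Precoverage (SAlg K)ᵒᵖ where
  coverings R := {P | ∃ (n : ℕ) (f : Fin n → R.unop) (S : Fin n → SAlg K)
    (φ : ∀ i, R.unop ⟶ S i),
    (∀ i, f i ∈ R.unop.grading 0) ∧
    (∃ c : Fin n → R.unop, (∀ i, c i ∈ R.unop.grading 0) ∧ ∑ i, c i * f i = 1) ∧
    (∀ i, SAlg.IsLocalizationAway (φ i) (f i)) ∧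
    P = Presieve.ofArrows (fun i => Opposite.op (S i)) (fun i => (φ i).op)}

/-- The coverings of `T_fppf`: finite families `SSp R_i → SSp R` with each `R_i` a finitely
presented `R`-superalgebra and `∏ R_i` a faithfully flat `R`-module. -/
def fppfCoverings (K : Type u) [Field K] : Precoverage (SAlg K)ᵒᵖ where
  coverings R := {P | ∃ (n : ℕ) (S : Fin n → SAlg K) (φ : ∀ i, R.unop ⟶ S i),
    (∀ i, SAlg.IsFinitelyPresented (φ i)) ∧
    NCFlat.FaithfullyFlat (RingHom.pi fun i => SAlg.Hom.ringHom (φ i)) ∧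
    P = Presieve.ofArrows (fun i => Opposite.op (S i)) (fun i => (φ i).op)}

/-- The Grothendieck topology `T_loc`. -/
def locTopology (K : Type u) [Field K] : GrothendieckTopology (SAlg K)ᵒᵖ :=
  (locCoverings K).toGrothendieck

/-- The Grothendieck topology `T_fppf`. -/
def fppfTopology (K : Type u) [Field K] : GrothendieckTopology (SAlg K)ᵒᵖ :=
  (fppfCoverings K).toGrothendieck

/-- Local functors: sheaves for `T_loc`. -/
def IsLocal {K : Type u} [Field K] (X : KFunctor K) : Prop :=
  Presieve.IsSheaf (locTopology K) X.presheaf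

/-- The sheafification of a `K`-functor for the fppf topology. -/
def sheafification {K : Type u} [Field K] (X : KFunctor K) : KFunctor K :=
  opOp (SAlg K) ⋙ sheafify (fppfTopology K) X.presheaf

/-- The canonical morphism from a `K`-functor to its sheafification. -/
def toSheafification {K : Type u} [Field K] (X : KFunctor K) : X ⟶ X.sheafification :=
  Functor.whiskerLeft (opOp (SAlg K)) (toSheafify (fppfTopology K) X.presheaf)

/-- Superschemes: local functors with an open covering by affine superschemes. -/
def IsSuperscheme {K : Type u} [Field K] (X : KFunctor K) : Prop :=
  X.IsLocal ∧ ∃ 𝒰 : Set (Subfunctor X), IsOpenCovering 𝒰 ∧ ∀ Y ∈ 𝒰, IsAffine Y.toFunctor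

/-- Noetherian superschemes: there is a finite open covering by affine superschemes with
Noetherian coordinate superalgebras. -/
def IsNoetherianSuperscheme {K : Type u} [Field K] (X : KFunctor K) : Prop :=
  X.IsLocal ∧ ∃ 𝒰 : Set (Subfunctor X), 𝒰.Finite ∧ IsOpenCovering 𝒰 ∧
    ∀ Y ∈ 𝒰, ∃ A : SAlg K, IsNoetherianRing A ∧ Nonempty (Y.toFunctor ≅ SSp A)

/-! ### Affine and faithfully flat morphisms -/

/-- Affine morphisms: `X ×_Y SSp R` is affine for all `R` and all `SSp R ⟶ Y`. -/
def IsAffineMorphism {K : Type u} [Field K] {X Y : KFunctor K} (f : X ⟶ Y) : Prop :=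
  ∀ (R : SAlg K) (g : SSp R ⟶ Y), IsAffine (Limits.pullback f g)

/-- `j` identifies `X` with an open subfunctor of `Y`. -/
def IsOpenImmersion {K : Type u} [Field K] {X Y : KFunctor K} (j : X ⟶ Y) : Prop :=
  (∀ R : SAlg K, Function.Injective (j.app R)) ∧ IsOpen (Subfunctor.range j)

/-- Flat morphisms: whenever `f` maps an open affine `SSp A ⊆ X` into an open affine
`SSp B ⊆ Y` (so that it restricts to `SSp φ` with `φ : B ⟶ A`), `A` is flat over `B`. -/
def IsFlat {K : Type u} [Field K] {X Y : KFunctor K} (f : X ⟶ Y) : Prop :=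
  ∀ (A B : SAlg K) (i : SSp A ⟶ X) (j : SSp B ⟶ Y) (φ : B ⟶ A),
    IsOpenImmersion i → IsOpenImmersion j → SSp.map φ ≫ j = i ≫ f →
      NCFlat.Flat (SAlg.Hom.ringHom φ)

/-- The set of points of `SSpec A`: the prime superideals. In a superalgebra these are exactly
the ideals `p` such that `A/p` is an integral domain; they have the form `p₀ ⊕ A₁` with
`p₀` prime in `A₀`. -/
def SSpec {K : Type u} [Field K] (A : SAlg K) : Type u :=
  {p : Ideal A // p.IsPrime}

/-- The map `SSpec B → SSpec A`, `q ↦ φ⁻¹(q)`. -/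
def SSpec.comap {K : Type u} [Field K] {A B : SAlg K} (φ : A ⟶ B) (q : SSpec B) : SSpec A :=
  ⟨Ideal.comap (SAlg.Hom.ringHom φ) q.1, by
    refine ⟨fun h => q.2.ne_top ?_, fun {x y} h => ?_⟩
    · rw [Ideal.eq_top_iff_one] at h ⊢
      simpa using h
    · simp only [Ideal.mem_comap, map_mul] at h ⊢
      exact q.2.mem_or_mem h⟩

/-- The elements of the disjoint union of all `SSpec R`, over all pairs `(R, x)`
with `x ∈ X(R)`. -/
structure PrePoint {K : Type u} [Field K] (X : KFunctor K) where
  R : SAlg K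
  x : X.obj R
  p : SSpec R

/-- The relation generating the identifications in the direct limit of the `SSpec R`. -/
inductive PrePoint.Rel {K : Type u} [Field K] (X : KFunctor K) :
    PrePoint X → PrePoint X → Prop
  | glue {R S : SAlg K} (φ : R ⟶ S) (x : X.obj R) (q : SSpec S) :
      PrePoint.Rel X ⟨S, X.map φ x, q⟩ ⟨R, x, SSpec.comap φ q⟩

/-- The underlying set `|X|^e` of the geometric realization
`|X| = lim_{(R, x ∈ X(R))} SSpec R` of a `K`-functor (the underlying set of a direct limit
of geometric superspaces is the direct limit of the underlying sets). -/
def Points {K : Type u} [Field K] (X : KFunctor K) : Type (u + 1) :=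
  Quot (PrePoint.Rel X)

/-- The map `|f|^e : |X|^e → |Y|^e` induced by a morphism `f : X ⟶ Y`. -/
def Points.map {K : Type u} [Field K] {X Y : KFunctor K} (f : X ⟶ Y) : Points X → Points Y :=
  Quot.lift (fun t => Quot.mk _ ⟨t.R, f.app t.R t.x, t.p⟩) (by
    rintro _ _ ⟨φ, x, q⟩
    have h : f.app _ (X.map φ x) = Y.map φ (f.app _ x) := NatTrans.naturality_apply f φ x
    simp only [h]
    exact Quot.sound (PrePoint.Rel.glue φ (f.app _ x) q))

/-- Faithfully flat morphisms: flat, and surjective on the points of geometric realizations. -/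
def IsFaithfullyFlat {K : Type u} [Field K] {X Y : KFunctor K} (f : X ⟶ Y) : Prop :=
  IsFlat f ∧ Function.Surjective (Points.map f)

end KFunctor

/-! ### Supergroups, actions and quotients -/

/-- A supergroup: a group-valued functor on superalgebras. -/
abbrev Supergroup (K : Type u) [Field K] := SAlg K ⥤ GrpCat.{u + 1}

/-- The underlying `K`-functor of a supergroup. -/
abbrev Supergroup.toKFunctor {K : Type u} [Field K] (G : Supergroup K) : KFunctor K :=
  G ⋙ forget GrpCat.{u + 1}

/-- Algebraic supergroups: those represented by a finitely generated superalgebra. -/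
def Supergroup.IsAlgebraic {K : Type u} [Field K] (G : Supergroup K) : Prop :=
  ∃ A : SAlg K, Algebra.FiniteType K A ∧ Nonempty (G.toKFunctor ≅ KFunctor.SSp A)

/-- A right action of a supergroup on a `K`-functor. -/
structure RightAction {K : Type u} [Field K] (X : KFunctor K) (G : Supergroup K) where
  act : ∀ R : SAlg K, X.obj R → G.obj R → X.obj R
  act_one : ∀ (R : SAlg K) (x : X.obj R), act R x 1 = x
  act_mul : ∀ (R : SAlg K) (x : X.obj R) (g h : G.obj R), act R x (g * h) = act R (act R x g) h
  naturality : ∀ {R S : SAlg K} (φ : R ⟶ S) (x : X.obj R) (g : G.obj R),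
    X.map φ (act R x g) = act S (X.map φ x) (G.map φ g)

namespace RightAction

/-- The action is free: each `G(R)` acts freely on `X(R)`. -/
def IsFree {K : Type u} [Field K] {X : KFunctor K} {G : Supergroup K}
    (ρ : RightAction X G) : Prop :=
  ∀ (R : SAlg K) (x : X.obj R) (g : G.obj R), ρ.act R x g = x → g = 1

/-- The relation of lying in the same orbit of `G(R)` on `X(R)`. -/
def orbit {K : Type u} [Field K] {X : KFunctor K} {G : Supergroup K}
    (ρ : RightAction X G) (R : SAlg K) : Setoid (X.obj R) where
  r x y := ∃ g : G.obj R, ρ.act R x g = y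
  iseqv :=
    { refl := fun x => ⟨1, ρ.act_one R x⟩
      symm := by
        rintro x _ ⟨g, rfl⟩
        exact ⟨g⁻¹, by rw [← ρ.act_mul, mul_inv_cancel, ρ.act_one]⟩
      trans := by
        rintro x _ _ ⟨g, rfl⟩ ⟨h, rfl⟩
        exact ⟨g * h, ρ.act_mul R x g h⟩ }

/-- The naive quotient `R ↦ X(R)/G(R)`. -/
def naiveQuotient {K : Type u} [Field K] {X : KFunctor K} {G : Supergroup K}
    (ρ : RightAction X G) : KFunctor K where
  obj R := Quotient (ρ.orbit R)
  map {R S} φ := ↾(Quotient.map (X.map φ) (by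
    rintro x _ ⟨g, rfl⟩
    exact ⟨G.map φ g, (ρ.naturality φ x g).symm⟩))
  map_id R := by
    ext x
    induction x using Quotient.inductionOn
    simp
  map_comp φ ψ := by
    ext x
    induction x using Quotient.inductionOn
    simp

/-- The projection from `X` to the naive quotient. -/
def naiveMap {K : Type u} [Field K] {X : KFunctor K} {G : Supergroup K}
    (ρ : RightAction X G) : X ⟶ ρ.naiveQuotient where
  app R := ↾(fun x => Quotient.mk (ρ.orbit R) x)
  naturality _ _ _ := rfl

/-- The quotient `K`-sheaf: the fppf sheafification of the naive quotient. -/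
def quotient {K : Type u} [Field K] {X : KFunctor K} {G : Supergroup K}
    (ρ : RightAction X G) : KFunctor K :=
  ρ.naiveQuotient.sheafification

/-- The quotient morphism from `X` to the quotient `K`-sheaf. -/
def quotientMap {K : Type u} [Field K] {X : KFunctor K} {G : Supergroup K}
    (ρ : RightAction X G) : X ⟶ ρ.quotient :=
  ρ.naiveMap ≫ ρ.naiveQuotient.toSheafification

end RightAction

/-- A closed supersubgroup of `G`: a closed subfunctor all of whose values are subgroups. -/
structure ClosedSupersubgroup {K : Type u} [Field K] (G : Supergroup K) where
  toSubgroup : ∀ R : SAlg K, Subgroup (G.obj R)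
  map_mem : ∀ {R S : SAlg K} (φ : R ⟶ S), ∀ g ∈ toSubgroup R, G.map φ g ∈ toSubgroup S
  isClosed : KFunctor.IsClosed (X := G.toKFunctor)
    { obj := fun R => {g | g ∈ toSubgroup R}
      map := fun φ g hg => map_mem φ g hg }

namespace ClosedSupersubgroup

/-- A closed supersubgroup as a supergroup. -/
def toSupergroup {K : Type u} [Field K] {G : Supergroup K} (H : ClosedSupersubgroup G) :
    Supergroup K where
  obj R := GrpCat.of (H.toSubgroup R)
  map {R S} φ := GrpCat.ofHom
    (((G.map φ).hom.comp (H.toSubgroup R).subtype).codRestrict (H.toSubgroup S)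
      fun h => H.map_mem φ h.1 h.2)
  map_id R := by
    ext x
    exact congrArg (fun f => f.hom x.1) (G.map_id R)
  map_comp {R S T} φ ψ := by
    ext x
    exact congrArg (fun f => f.hom x.1) (G.map_comp φ ψ)

/-- The action of `H` on `G` by right multiplication. -/
def rightMul {K : Type u} [Field K] {G : Supergroup K} (H : ClosedSupersubgroup G) :
    RightAction G.toKFunctor H.toSupergroup where
  act R x h := HMul.hMul (α := G.obj R) x (Subtype.val (p := (· ∈ H.toSubgroup R)) h)
  act_one R x := mul_one (M := G.obj R) x
  act_mul R x _ _ := (mul_assoc (G := G.obj R) x _ _).symm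
  naturality φ x _ := map_mul (G.map φ).hom x _

/-- The morphism `f` factors through the naive quotient `G ⟶ (G/H)_(n)`. -/
def FactorsThroughNaive {K : Type u} [Field K] {G : Supergroup K} (H : ClosedSupersubgroup G)
    {Y : KFunctor K} (f : G.toKFunctor ⟶ Y) : Prop :=
  ∃ q : H.rightMul.naiveQuotient ⟶ Y, H.rightMul.naiveMap ≫ q = f

/-- `π : G ⟶ Y` is a Brundan quotient of `G` by `H`. -/
structure IsBrundanQuotient {K : Type u} [Field K] {G : Supergroup K}
    (H : ClosedSupersubgroup G) {Y : KFunctor K} (π : G.toKFunctor ⟶ Y) : Prop where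
  isNoetherianSuperscheme : Y.IsNoetherianSuperscheme
  isAffineMorphism : KFunctor.IsAffineMorphism π
  isFaithfullyFlat : KFunctor.IsFaithfullyFlat π
  factors : H.FactorsThroughNaive π
  universal : ∀ (Z : KFunctor K) (f : G.toKFunctor ⟶ Z), Z.IsSuperscheme →
    H.FactorsThroughNaive f → ∃! g : Y ⟶ Z, π ≫ g = f

end ClosedSupersubgroup

end

/-! Let Y be the quotient of the affine X by the free action of the affine group G. The quotient
morphism π is a torsor: points of X(R) with the same image differ by a unique element of G(R), and
each y in Y(R) lifts to X after a faithfully flat extension R → R' (`isTorsor_quotientMap`). A lift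
trivializes the fibre: over R' it is represented by E = R' ⊗ K[G]. The fibre then descends to R:
with d₁, d₂ the two pullbacks E → E ⊗_R R', it is represented by their equalizer C, and C ⊗_R R' = E
(`isPushout_equalizer`, `exists_fiber`). Since C → E and R → E are faithfully flat, so is R → C.
This is `HasFibers`, from which the rest is deduced.

Affineness of π is the representability itself. Surjectivity on points follows since primes lift
along R → C. For flatness, if an open affine SSp A of X maps to an open affine SSp B of Y, then B →
A factors as B → C → A, where the first arrow is faithfully flat and the second is dual to an open
immersion, hence flat (`flat_of_isOpenImmersion`).

Two facts about a superscheme Z enter: Z(R) → Z(R') is injective for faithfully flat R → R', and Z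
is an fppf sheaf. The first identifies the image of the descended point in the fibre argument; the
second gives the universal property of the quotient among superschemes. Both come from descent
(`IsSuperscheme.ffDescent`): affine functors satisfy it because R is the equalizer of R' and R' ⊗_R
R', and an affine open covering descends because saturated open sets of Spec R'₀ come from Spec R₀,
by going down for flat morphisms (`exists_isOpen_preimage`).

For the Noetherian property, a finitely generated superalgebra is Noetherian; over an open affine
SSp B of Y the fibre SSp C is open in G, so C is Noetherian, and this descends along B → C. Finitely
many opens suffice because the spectrum of K[G] is quasi-compact and every field-valued point of Y
lifts to G after a nonzero extension.

Flatness is over noncommutative rings, so it is handled through right modules and an explicit tensor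
product. As 2 is invertible, a ℤ/2-grading is the same as an involution (the parity), and
supercommutativity becomes one identity in the parity; equalizers, quotients, products, coproducts
and localizations are all built from involutions. -/

set_option linter.unusedSectionVars false

noncomputable section

/-! ### Tensor products, flatness and faithful flatness over noncommutative rings -/

namespace NCFlat

open scoped TensorProduct
open MulOpposite

variable {A B C : Type u} [Ring A] [Ring B] [Ring C]
variable {N N' : Type u} [AddCommGroup N] [Module Aᵐᵒᵖ N] [AddCommGroup N'] [Module Aᵐᵒᵖ N']

/-- The pure tensor `n ⊗ b` in `N ⊗_A B`. -/
def tmul (φ : A →+* B) (n : N) (b : B) : Tensor φ N := QuotientAddGroup.mk (n ⊗ₜ[ℤ] b)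

section

variable (φ : A →+* B)

lemma smul_tmul (a : A) (n : N) (b : B) : tmul φ (op a • n) b = tmul φ n (φ a * b) :=
  (QuotientAddGroup.eq_iff_sub_mem).2 (AddSubgroup.subset_closure ⟨n, a, b, rfl⟩)

lemma add_tmul (n m : N) (b : B) : tmul φ (n + m) b = tmul φ n b + tmul φ m b :=
  congrArg _ (TensorProduct.add_tmul n m b)

lemma tmul_add (n : N) (b c : B) : tmul φ n (b + c) = tmul φ n b + tmul φ n c :=
  congrArg _ (TensorProduct.tmul_add n b c)

/-- The biadditive map `(n, b) ↦ n ⊗ b`. -/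
def tmulHom : N →+ B →+ Tensor φ N where
  toFun n :=
    { toFun := tmul φ n
      map_zero' := congrArg _ (TensorProduct.tmul_zero B n)
      map_add' := tmul_add φ n }
  map_zero' := by ext b; exact congrArg _ (TensorProduct.zero_tmul N b)
  map_add' n m := by ext b; exact add_tmul φ n m b

@[simp] lemma tmulHom_apply (n : N) (b : B) : tmulHom φ n b = tmul φ n b := rfl

@[simp] lemma zero_tmul (b : B) : tmul φ (0 : N) b = 0 := by
  rw [← tmulHom_apply, map_zero]; rfl

@[simp] lemma tmul_zero (n : N) : tmul φ n 0 = 0 := map_zero (tmulHom φ n)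

lemma sub_tmul (n m : N) (b : B) : tmul φ (n - m) b = tmul φ n b - tmul φ m b := by
  rw [← tmulHom_apply, map_sub]; rfl

lemma tmul_sum {ι : Type*} (s : Finset ι) (n : N) (b : ι → B) :
    tmul φ n (∑ i ∈ s, b i) = ∑ i ∈ s, tmul φ n (b i) := map_sum (tmulHom φ n) b s

variable {φ}

@[elab_as_elim]
lemma tensor_induction {p : Tensor φ N → Prop} (t : Tensor φ N) (zero : p 0)
    (tmul : ∀ n b, p (tmul φ n b)) (add : ∀ x y, p x → p y → p (x + y)) : p t := by
  induction t using QuotientAddGroup.induction_on with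
  | H z =>
    induction z using TensorProduct.induction_on with
    | zero => exact zero
    | tmul n b => exact tmul n b
    | add x y hx hy => exact add _ _ hx hy

lemma hom_ext {M : Type*} [AddCommGroup M] {f g : Tensor φ N →+ M}
    (h : ∀ n b, f (tmul φ n b) = g (tmul φ n b)) : f = g := by
  ext t
  exact tensor_induction (p := fun t => f t = g t) t (by simp) h
    (fun x y hx hy => by simp only [map_add, hx, hy])

variable (φ)

/-- Additive maps out of `N ⊗_A B` from balanced biadditive maps. -/
def lift {M : Type*} [AddCommGroup M] (f : N →+ B →+ M)
    (h : ∀ n a b, f (op a • n) b = f n (φ a * b)) : Tensor φ N →+ M :=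
  QuotientAddGroup.lift _ (TensorProduct.liftAddHom f (fun r n b => by
    rw [map_zsmul, map_zsmul]; rfl))
    ((AddSubgroup.closure_le _).2 (by
      rintro _ ⟨n, a, b, rfl⟩
      simp [AddMonoidHom.mem_ker, h]))

@[simp] lemma lift_tmul {M : Type*} [AddCommGroup M] (f : N →+ B →+ M)
    (h : ∀ n a b, f (op a • n) b = f n (φ a * b)) (n : N) (b : B) :
    lift φ f h (tmul φ n b) = f n b := rfl

@[simp] lemma map_tmul (f : N →ₗ[Aᵐᵒᵖ] N') (n : N) (b : B) :
    map φ f (tmul φ n b) = tmul φ (f n) b := rfl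

lemma map_id : map φ (LinearMap.id : N →ₗ[Aᵐᵒᵖ] N) = AddMonoidHom.id _ :=
  hom_ext fun _ _ => rfl

lemma map_comp {N'' : Type u} [AddCommGroup N''] [Module Aᵐᵒᵖ N''] (g : N' →ₗ[Aᵐᵒᵖ] N'')
    (f : N →ₗ[Aᵐᵒᵖ] N') : map φ (g ∘ₗ f) = (map φ g).comp (map φ f) :=
  hom_ext fun _ _ => rfl

lemma map_sub_hom (f g : N →ₗ[Aᵐᵒᵖ] N') : map φ (f - g) = map φ f - map φ g :=
  hom_ext fun n b => sub_tmul φ (f n) (g n) b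

/-- Functoriality of `N ⊗_A B` in the left module `B`. -/
def lmap {φ : A →+* B} {ψ : A →+* C} (g : B →+ C) (hg : ∀ a b, g (φ a * b) = ψ a * g b) :
    Tensor φ N →+ Tensor ψ N :=
  lift φ ((AddMonoidHom.compHom' g).comp (tmulHom ψ)) (fun n a b => by
    change tmul ψ (op a • n) (g b) = tmul ψ n (g (φ a * b))
    rw [smul_tmul, hg])

@[simp] lemma lmap_tmul {φ : A →+* B} {ψ : A →+* C} (g : B →+ C)
    (hg : ∀ a b, g (φ a * b) = ψ a * g b) (n : N) (b : B) :
    lmap g hg (tmul φ n b) = tmul ψ n (g b) := rfl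

lemma lmap_map {φ : A →+* B} {ψ : A →+* C} (g : B →+ C) (hg : ∀ a b, g (φ a * b) = ψ a * g b)
    (f : N →ₗ[Aᵐᵒᵖ] N') (t : Tensor φ N) : lmap g hg (map φ f t) = map ψ f (lmap g hg t) := by
  refine tensor_induction t (by simp) (fun n b => by simp) (fun x y hx hy => ?_)
  simp only [map_add, hx, hy]

/-- Right multiplication by `c` on `N ⊗_A B`. -/
def mulRight (c : B) : Tensor φ N →+ Tensor φ N :=
  lmap (AddMonoidHom.mulRight c) (fun a b => by simp [mul_assoc])

@[simp] lemma mulRight_tmul (c : B) (n : N) (b : B) :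
    mulRight φ c (tmul φ n b) = tmul φ n (b * c) := rfl

/-- The right `B`-module structure on `N ⊗_A B`. -/
instance : Module Bᵐᵒᵖ (Tensor φ N) where
  smul c t := mulRight φ c.unop t
  one_smul t := by
    change mulRight φ 1 t = t
    refine tensor_induction t (by simp) (fun n b => by simp) (fun x y hx hy => ?_)
    rw [map_add, hx, hy]
  mul_smul c d t := by
    change mulRight φ (d.unop * c.unop) t = mulRight φ c.unop (mulRight φ d.unop t)
    refine tensor_induction t (by simp) (fun n b => by simp [mul_assoc]) (fun x y hx hy => ?_)
    simp only [map_add, hx, hy]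
  smul_zero c := map_zero (mulRight φ c.unop)
  smul_add c := map_add (mulRight φ c.unop)
  add_smul c d t := by
    change mulRight φ (c.unop + d.unop) t = mulRight φ c.unop t + mulRight φ d.unop t
    refine tensor_induction t (by simp) (fun n b => by simp [mul_add, tmul_add])
      (fun x y hx hy => ?_)
    simp only [map_add, hx, hy]
    abel
  zero_smul t := by
    change mulRight φ 0 t = 0
    refine tensor_induction t (by simp) (fun n b => by simp) (fun x y hx hy => ?_)
    rw [map_add, hx, hy, add_zero]

@[simp] lemma op_smul_tmul (c : B) (n : N) (b : B) :
    op c • tmul φ n b = tmul φ n (b * c) := rfl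

/-- `map φ f` as a homomorphism of right `B`-modules. -/
def mapₗ (f : N →ₗ[Aᵐᵒᵖ] N') : Tensor φ N →ₗ[Bᵐᵒᵖ] Tensor φ N' where
  __ := map φ f
  map_smul' c t := by
    change map φ f (c • t) = c • map φ f t
    refine tensor_induction t (by simp) (fun n b => rfl) (fun x y hx hy => ?_)
    simp only [map_add, smul_add, hx, hy]

@[simp] lemma mapₗ_apply (f : N →ₗ[Aᵐᵒᵖ] N') (t : Tensor φ N) : mapₗ φ f t = map φ f t := rfl

/-- The right `A`-module obtained from a right `B`-module by restriction along `φ`. -/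
def Res (_ : A →+* B) (N : Type u) : Type u := N

instance (N : Type u) [h : AddCommGroup N] : AddCommGroup (Res φ N) := h

instance (N : Type u) [AddCommGroup N] [Module Bᵐᵒᵖ N] : Module Aᵐᵒᵖ (Res φ N) :=
  Module.compHom N (RingHom.op φ)

/-- Restriction of a homomorphism of right modules. -/
def Res.map {N N' : Type u} [AddCommGroup N] [Module Bᵐᵒᵖ N] [AddCommGroup N'] [Module Bᵐᵒᵖ N']
    (f : N →ₗ[Bᵐᵒᵖ] N') : Res φ N →ₗ[Aᵐᵒᵖ] Res φ N' where
  toFun := f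
  map_add' := f.map_add
  map_smul' a n := f.map_smul (op (φ a.unop)) n

/-- The unit `N → N ⊗_A B`. -/
def unit (N : Type u) [AddCommGroup N] [Module Aᵐᵒᵖ N] : N →ₗ[Aᵐᵒᵖ] Res φ (Tensor φ N) where
  toFun n := tmul φ n 1
  map_add' n m := add_tmul φ n m 1
  map_smul' a n := by
    obtain ⟨a, rfl⟩ := op_surjective a
    change tmul φ (op a • n) 1 = tmul φ n (1 * φ a)
    rw [smul_tmul, mul_one, one_mul]

/-- If the unit kills everything, then the tensor product vanishes. -/
lemma tmul_eq_zero_of_unit {n : N} (h : tmul φ n 1 = 0) (b : B) : tmul φ n b = 0 := by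
  rw [← one_mul b, ← op_smul_tmul, h, smul_zero]

/-- If N₀ is the kernel of the unit, then N₀ ⊗ B → N ⊗ B is zero, and it is injective by flatness;
so N₀ ⊗ B = 0 and N₀ = 0. -/
lemma FaithfullyFlat.unit_injective {φ : A →+* B} (h : FaithfullyFlat φ) (N : Type u)
    [AddCommGroup N] [Module Aᵐᵒᵖ N] : Function.Injective (unit φ N) := by
  rw [← LinearMap.ker_eq_bot, ← Submodule.subsingleton_iff_eq_bot]
  set N₀ := LinearMap.ker (unit φ N)
  refine h.2 N₀ ⟨fun s t => ?_⟩
  have key : ∀ t, map φ N₀.subtype t = 0 := fun t => by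
    refine tensor_induction t (by simp) (fun n b => ?_) (fun x y hx hy => by simp [hx, hy])
    exact tmul_eq_zero_of_unit φ n.2 b
  exact h.1 N₀ N N₀.subtype (Submodule.subtype_injective _) ((key s).trans (key t).symm)

end

/-- The map `N ⊗_A C → (N ⊗_A B) ⊗_B C`. -/
def toIterated (φ : A →+* B) (ψ : B →+* C) (N : Type u) [AddCommGroup N] [Module Aᵐᵒᵖ N] :
    Tensor (ψ.comp φ) N →+ Tensor ψ (Tensor φ N) :=
  lift _ ((tmulHom ψ).comp (unit φ N).toAddMonoidHom) (fun n a c => by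
    change tmul ψ (tmul φ (op a • n) 1) c = tmul ψ (tmul φ n 1) (ψ (φ a) * c)
    rw [← smul_tmul ψ, op_smul_tmul, smul_tmul, one_mul, mul_one])

@[simp] lemma toIterated_tmul (φ : A →+* B) (ψ : B →+* C) (n : N) (c : C) :
    toIterated φ ψ N (tmul _ n c) = tmul ψ (tmul φ n 1) c := rfl

/-- The triadditive map `(n, b, c) ↦ n ⊗ ψ(b) c`. -/
def iteratedHom (φ : A →+* B) (ψ : B →+* C) (N : Type u) [AddCommGroup N] [Module Aᵐᵒᵖ N] :
    N →+ B →+ C →+ Tensor (ψ.comp φ) N :=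
  (AddMonoidHom.compHom' ((AddMonoidHom.mul (R := C)).comp ψ.toAddMonoidHom)).comp
    (AddMonoidHom.compHom.comp (tmulHom (ψ.comp φ)))

lemma iteratedHom_apply (φ : A →+* B) (ψ : B →+* C) (n : N) (b : B) (c : C) :
    iteratedHom φ ψ N n b c = tmul (ψ.comp φ) n (ψ b * c) := rfl

/-- The biadditive map underlying `fromIterated`. -/
def iteratedHom' (φ : A →+* B) (ψ : B →+* C) (N : Type u) [AddCommGroup N] [Module Aᵐᵒᵖ N] :
    Tensor φ N →+ C →+ Tensor (ψ.comp φ) N :=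
  lift φ (iteratedHom φ ψ N) (fun n a b => by
    ext c
    rw [iteratedHom_apply, iteratedHom_apply, smul_tmul, map_mul, mul_assoc]
    rfl)

/-- The map `(N ⊗_A B) ⊗_B C → N ⊗_A C`. -/
def fromIterated (φ : A →+* B) (ψ : B →+* C) (N : Type u) [AddCommGroup N] [Module Aᵐᵒᵖ N] :
    Tensor ψ (Tensor φ N) →+ Tensor (ψ.comp φ) N :=
  lift ψ (iteratedHom' φ ψ N) (fun t b c => by
    refine tensor_induction t ?_ (fun n b' => ?_) (fun x y hx hy => ?_)
    · rw [smul_zero, map_zero]; rfl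
    · change tmul (ψ.comp φ) n (ψ (b' * b) * c) = tmul (ψ.comp φ) n (ψ b' * (ψ b * c))
      rw [map_mul, mul_assoc]
    · rw [smul_add, map_add, map_add, AddMonoidHom.add_apply, AddMonoidHom.add_apply, hx, hy])

@[simp] lemma fromIterated_tmul (φ : A →+* B) (ψ : B →+* C) (n : N) (b : B) (c : C) :
    fromIterated φ ψ N (tmul ψ (tmul φ n b) c) = tmul _ n (ψ b * c) := rfl

lemma toIterated_bijective (φ : A →+* B) (ψ : B →+* C) (N : Type u) [AddCommGroup N]
    [Module Aᵐᵒᵖ N] : Function.Bijective (toIterated φ ψ N) := by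
  refine Function.bijective_iff_has_inverse.2 ⟨fromIterated φ ψ N, fun x => ?_, fun x => ?_⟩
  · refine tensor_induction x (by simp) (fun n b => by simp) (fun x y hx hy => ?_)
    simp only [map_add, hx, hy]
  · refine tensor_induction x (by simp) (fun t c => ?_) (fun x y hx hy => ?_)
    · refine tensor_induction t (by simp) (fun n b => ?_) (fun x y hx hy => ?_)
      · rw [fromIterated_tmul, toIterated_tmul, ← smul_tmul, op_smul_tmul, one_mul]
      · rw [add_tmul, map_add, map_add, hx, hy]
    · simp only [map_add, hx, hy]

lemma toIterated_map (φ : A →+* B) (ψ : B →+* C) (f : N →ₗ[Aᵐᵒᵖ] N') (t : Tensor (ψ.comp φ) N) :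
    toIterated φ ψ N' (map _ f t) = map ψ (mapₗ φ f) (toIterated φ ψ N t) := by
  refine tensor_induction t (by simp) (fun n b => by simp) (fun x y hx hy => ?_)
  simp only [map_add, hx, hy]

/-- Transitivity N ⊗_A C = (N ⊗_A B) ⊗_B C, natural in N. Composition and descent of (faithful)
flatness are read off from it. -/
lemma map_injective_comp_iff (φ : A →+* B) (ψ : B →+* C) (f : N →ₗ[Aᵐᵒᵖ] N') :
    Function.Injective (map (ψ.comp φ) f) ↔ Function.Injective (map ψ (mapₗ φ f)) := by
  have hc : toIterated φ ψ N' ∘ map (ψ.comp φ) f = map ψ (mapₗ φ f) ∘ toIterated φ ψ N :=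
    funext fun t => toIterated_map φ ψ f t
  rw [← (toIterated_bijective φ ψ N').injective.of_comp_iff, hc,
    Function.Injective.of_comp_iff' _ (toIterated_bijective φ ψ N)]

lemma subsingleton_comp_iff (φ : A →+* B) (ψ : B →+* C) (N : Type u) [AddCommGroup N]
    [Module Aᵐᵒᵖ N] :
    Subsingleton (Tensor (ψ.comp φ) N) ↔ Subsingleton (Tensor ψ (Tensor φ N)) :=
  (Equiv.ofBijective _ (toIterated_bijective φ ψ N)).subsingleton_congr

lemma Flat.comp {φ : A →+* B} {ψ : B →+* C} (hφ : Flat φ) (hψ : Flat ψ) : Flat (ψ.comp φ) :=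
  fun N N' _ _ _ _ f hf => (map_injective_comp_iff φ ψ f).2 (hψ _ _ _ (hφ N N' f hf))

lemma FaithfullyFlat.comp {φ : A →+* B} {ψ : B →+* C} (hφ : FaithfullyFlat φ)
    (hψ : FaithfullyFlat ψ) : FaithfullyFlat (ψ.comp φ) :=
  ⟨hφ.1.comp hψ.1, fun N _ _ h => hφ.2 N (hψ.2 _ ((subsingleton_comp_iff φ ψ N).1 h))⟩

/-- Flatness descends along a faithfully flat morphism of the target. -/
lemma Flat.of_comp {φ : A →+* B} {ψ : B →+* C} (hψ : FaithfullyFlat ψ) (h : Flat (ψ.comp φ)) :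
    Flat φ := by
  intro N N' _ _ _ _ f hf
  have h₁ := (map_injective_comp_iff φ ψ f).1 (h N N' f hf)
  intro s t hst
  refine hψ.unit_injective (Tensor φ N) (h₁ ?_)
  change tmul ψ (map φ f s) 1 = tmul ψ (map φ f t) 1
  rw [hst]

lemma FaithfullyFlat.of_comp {φ : A →+* B} {ψ : B →+* C} (hψ : FaithfullyFlat ψ)
    (h : FaithfullyFlat (ψ.comp φ)) : FaithfullyFlat φ := by
  refine ⟨Flat.of_comp hψ h.1, fun N _ _ hN => h.2 N ((subsingleton_comp_iff φ ψ N).2 ?_)⟩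
  refine ⟨fun s t => ?_⟩
  have key : ∀ t : Tensor ψ (Tensor φ N), t = 0 := fun t =>
    tensor_induction t rfl (fun n b => by rw [Subsingleton.elim n 0, zero_tmul])
      (fun x y hx hy => by rw [hx, hy, add_zero])
  rw [key s, key t]

/-- A retraction of an injection survives any additive functor; this is meant for base rings that
are fields. -/
lemma flat_of_split {φ : A →+* B} (h : ∀ (N N' : Type u) [AddCommGroup N] [Module Aᵐᵒᵖ N]
    [AddCommGroup N'] [Module Aᵐᵒᵖ N'] (f : N →ₗ[Aᵐᵒᵖ] N'), Function.Injective f →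
      ∃ g : N' →ₗ[Aᵐᵒᵖ] N, g ∘ₗ f = LinearMap.id) : Flat φ := by
  intro N N' _ _ _ _ f hf
  obtain ⟨g, hg⟩ := h N N' f hf
  refine Function.LeftInverse.injective (g := map φ g) fun t => ?_
  rw [← AddMonoidHom.comp_apply, ← map_comp, hg, map_id, AddMonoidHom.id_apply]

/-- Right exactness. -/
lemma exists_of_map_mk_eq_zero (φ : A →+* B) (f : N →ₗ[Aᵐᵒᵖ] N')
    (t : Tensor φ N') (ht : map φ (LinearMap.range f).mkQ t = 0) : ∃ s, map φ f s = t := by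
  set M := (map φ f).range
  -- The map sending the class of n, tensored with b, to n ⊗ b modulo the image M of N ⊗ B. It is
  -- well defined because changing n by f x changes the value by f x ⊗ b; as g undoes the
  -- projection, an element killed by the projection lies in M.
  let g : Tensor φ (N' ⧸ LinearMap.range f) →+ Tensor φ N' ⧸ M :=
    lift φ
      { toFun := fun q =>
          { toFun := fun b => Quotient.liftOn' q (fun n => (QuotientAddGroup.mk (tmul φ n b) : _ ⧸ M))
              (by
                intro n m hnm
                obtain ⟨x, hx⟩ := (Submodule.quotientRel_def _).1 hnm
                refine QuotientAddGroup.eq_iff_sub_mem.2 ⟨tmul φ x b, ?_⟩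
                rw [map_tmul, hx, sub_tmul])
            map_zero' := by
              induction q using Submodule.Quotient.induction_on with
              | H n => exact congrArg _ (tmul_zero φ n)
            map_add' := fun b c => by
              induction q using Submodule.Quotient.induction_on with
              | H n => exact congrArg _ (tmul_add φ n b c) }
        map_zero' := by
          ext b
          exact congrArg _ (zero_tmul φ b)
        map_add' := fun p q => by
          ext b
          induction p using Submodule.Quotient.induction_on with
          | H n =>
            induction q using Submodule.Quotient.induction_on with
            | H m => exact congrArg _ (add_tmul φ n m b) }
      (fun q a b => by
        induction q using Submodule.Quotient.induction_on with
        | H n => exact congrArg _ (smul_tmul φ a n b))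
  have hg : ∀ t : Tensor φ N', g (map φ (LinearMap.range f).mkQ t) = QuotientAddGroup.mk t := by
    intro t
    refine tensor_induction t (by simp) (fun n b => rfl) (fun x y hx hy => ?_)
    rw [map_add, map_add, hx, hy]
    rfl
  have := hg t
  rw [ht, map_zero] at this
  exact (QuotientAddGroup.eq_zero_iff t).1 this.symm

/-- Flatness preserves kernels. -/
lemma Flat.exists_of_map_eq_zero {φ : A →+* B} (hφ : Flat φ) (f : N →ₗ[Aᵐᵒᵖ] N')
    (t : Tensor φ N) (ht : map φ f t = 0) : ∃ s, map φ (LinearMap.ker f).subtype s = t := by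
  have hinj := hφ (N ⧸ LinearMap.ker f) N' ((LinearMap.ker f).liftQ f le_rfl)
    (LinearMap.ker_eq_bot.1 (Submodule.ker_liftQ_eq_bot _ _ _ le_rfl))
  -- As N / ker f embeds in N', flatness shows that t already dies in (N / ker f) ⊗ B; right
  -- exactness for ker f → N then finishes.
  have h₁ : map φ (LinearMap.ker f).mkQ t = 0 := by
    apply hinj
    rw [← AddMonoidHom.comp_apply, ← map_comp, Submodule.liftQ_mkQ, ht, map_zero]
  have key := exists_of_map_mk_eq_zero φ (LinearMap.ker f).subtype t
  rw [Submodule.range_subtype] at key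
  exact key h₁

/-- The Amitsur complex of a faithfully flat morphism is exact in degree zero. -/
lemma FaithfullyFlat.exists_eq_unit {φ : A →+* B} (hφ : FaithfullyFlat φ) (b : B)
    (hb : tmul φ (N := Res φ B) b 1 = tmul φ (N := Res φ B) (1 : B) b) : ∃ a, φ a = b := by
  let f : A →ₗ[Aᵐᵒᵖ] Res φ B :=
    { toFun := φ
      map_add' := φ.map_add
      map_smul' := fun a x => φ.map_mul x a.unop }
  -- In B / φ(A) the class of 1 is zero, so `hb` makes the class of b, tensored with 1, vanish;
  -- injectivity of the unit of B / φ(A) then puts b into φ(A).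
  have h₁ : unit φ _ ((LinearMap.range f).mkQ b) = 0 := by
    have := congrArg (map φ (LinearMap.range f).mkQ) hb
    have h0 : (LinearMap.range f).mkQ (1 : B) = 0 :=
      (Submodule.Quotient.mk_eq_zero _).2 ⟨1, φ.map_one⟩
    refine ((map_tmul φ _ _ _).symm.trans this).trans ((map_tmul φ _ _ _).trans ?_)
    exact (congrArg (fun n => tmul φ n b) h0).trans (zero_tmul φ b)
  have h₂ := hφ.unit_injective _ (h₁.trans (map_zero _).symm)
  exact (Submodule.Quotient.mk_eq_zero _).1 h₂

/-- If φ(a) = 0, then a ⊗ 1 = 1 ⊗ φ(a) = 0 in A ⊗_A B, and the unit of A is injective. -/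
lemma FaithfullyFlat.injective {φ : A →+* B} (hφ : FaithfullyFlat φ) :
    Function.Injective φ := by
  rw [injective_iff_map_eq_zero]
  intro a ha
  have : unit φ A a = 0 := by
    have h := smul_tmul φ a (1 : A) (1 : B)
    rw [ha, zero_mul, tmul_zero, op_smul_eq_mul, one_mul] at h
    exact h
  exact hφ.unit_injective A (this.trans (map_zero _).symm)

end NCFlat

/-! ### Superalgebras as algebras with a parity involution -/

namespace SAlg

variable {K : Type u} [Field K]

section Basic

variable {A B C : SAlg K}

@[simp] lemma ringHom_comp_apply (f : A ⟶ B) (g : B ⟶ C) (a : A) :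
    Hom.ringHom (f ≫ g) a = Hom.ringHom g (Hom.ringHom f a) := rfl

lemma hom_ext {f g : A ⟶ B} (h : ∀ a, Hom.ringHom f a = Hom.ringHom g a) : f = g :=
  Hom.ext (AlgHom.ext h)

@[simp] lemma ringHom_algebraMap (f : A ⟶ B) (k : K) :
    Hom.ringHom f (algebraMap K A k) = algebraMap K B k := (Hom.toAlgHom f).commutes k

/-- The projection to the component of degree `i`. -/
def proj (A : SAlg K) (i : ZMod 2) : A →ₗ[K] A := GradedAlgebra.proj A.grading i

lemma proj_mem (A : SAlg K) (i : ZMod 2) (a : A) : A.proj i a ∈ A.grading i :=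
  SetLike.coe_mem (DirectSum.decompose A.grading a i)

lemma proj_of_mem {i : ZMod 2} {a : A} (h : a ∈ A.grading i) : A.proj i a = a :=
  DirectSum.decompose_of_mem_same _ h

lemma proj_of_mem_ne {i j : ZMod 2} {a : A} (h : a ∈ A.grading i) (hij : i ≠ j) :
    A.proj j a = 0 :=
  DirectSum.decompose_of_mem_ne _ h hij

lemma proj_add_proj (a : A) : A.proj 0 a + A.proj 1 a = a := by
  have h := congrArg (DirectSum.decompose A.grading).symm
    (DirectSum.sum_univ_of (DirectSum.decompose A.grading a))
  rw [Equiv.symm_apply_apply, DirectSum.decompose_symm_sum] at h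
  simp only [DirectSum.decompose_symm_of] at h
  exact (Fin.sum_univ_two
    (fun i : Fin 2 => ((DirectSum.decompose A.grading a i : A)))).symm.trans h

lemma zmod_two_cases (i : ZMod 2) : i = 0 ∨ i = 1 := by
  revert i; decide

lemma one_mem_even (A : SAlg K) : (1 : A) ∈ A.grading 0 := SetLike.GradedOne.one_mem

lemma mul_mem_graded {i j : ZMod 2} {a b : A} (ha : a ∈ A.grading i) (hb : b ∈ A.grading j) :
    a * b ∈ A.grading (i + j) := SetLike.GradedMul.mul_mem ha hb

/-- The parity involution of a superalgebra. -/
def parity (A : SAlg K) : A →ₐ[K] A :=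
  AlgHom.ofLinearMap (A.proj 0 - A.proj 1)
    (by
      rw [LinearMap.sub_apply, proj_of_mem A.one_mem_even,
        proj_of_mem_ne A.one_mem_even (by decide), sub_zero])
    (by
      intro a b
      have key : ∀ x y : A, A.proj 0 (x * y) - A.proj 1 (x * y) =
          (A.proj 0 x - A.proj 1 x) * (A.proj 0 y - A.proj 1 y) := by
        intro x y
        have h00 := mul_mem_graded (A.proj_mem 0 x) (A.proj_mem 0 y)
        have h01 := mul_mem_graded (A.proj_mem 0 x) (A.proj_mem 1 y)
        have h10 := mul_mem_graded (A.proj_mem 1 x) (A.proj_mem 0 y)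
        have h11 := mul_mem_graded (A.proj_mem 1 x) (A.proj_mem 1 y)
        rw [show (0 + 0 : ZMod 2) = 0 by decide] at h00
        rw [show (0 + 1 : ZMod 2) = 1 by decide] at h01
        rw [show (1 + 0 : ZMod 2) = 1 by decide] at h10
        rw [show (1 + 1 : ZMod 2) = 0 by decide] at h11
        conv_lhs => rw [← proj_add_proj x, ← proj_add_proj y]
        simp only [add_mul, mul_add, map_add, proj_of_mem h00, proj_of_mem h01, proj_of_mem h10,
          proj_of_mem h11, proj_of_mem_ne h00 (show (0 : ZMod 2) ≠ 1 by decide),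
          proj_of_mem_ne h01 (show (1 : ZMod 2) ≠ 0 by decide),
          proj_of_mem_ne h10 (show (1 : ZMod 2) ≠ 0 by decide),
          proj_of_mem_ne h11 (show (0 : ZMod 2) ≠ 1 by decide), sub_mul, mul_sub]
        abel
      exact key a b)

lemma parity_apply (a : A) : A.parity a = A.proj 0 a - A.proj 1 a := rfl

lemma parity_even {a : A} (h : a ∈ A.grading 0) : A.parity a = a := by
  rw [parity_apply, proj_of_mem h, proj_of_mem_ne h (by decide), sub_zero]

lemma parity_odd {a : A} (h : a ∈ A.grading 1) : A.parity a = -a := by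
  rw [parity_apply, proj_of_mem h, proj_of_mem_ne h (by decide), zero_sub]

@[simp] lemma parity_parity (a : A) : A.parity (A.parity a) = a := by
  rw [parity_apply a, map_sub, parity_even (A.proj_mem 0 a), parity_odd (A.proj_mem 1 a),
    sub_neg_eq_add, proj_add_proj]

lemma ringHom_mem (f : A ⟶ B) {i : ZMod 2} {a : A} (h : a ∈ A.grading i) :
    Hom.ringHom f a ∈ B.grading i := f.map_mem i a h

lemma ringHom_proj (f : A ⟶ B) (i : ZMod 2) (a : A) :
    Hom.ringHom f (A.proj i a) = B.proj i (Hom.ringHom f a) := by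
  conv_rhs => rw [← proj_add_proj a]
  rw [map_add, map_add]
  have h0 := ringHom_mem f (A.proj_mem 0 a)
  have h1 := ringHom_mem f (A.proj_mem 1 a)
  rcases zmod_two_cases i with rfl | rfl
  · rw [proj_of_mem h0, proj_of_mem_ne h1 (by decide), add_zero]
  · rw [proj_of_mem h1, proj_of_mem_ne h0 (by decide), zero_add]

@[simp] lemma ringHom_parity (f : A ⟶ B) (a : A) :
    Hom.ringHom f (A.parity a) = B.parity (Hom.ringHom f a) := by
  rw [parity_apply, parity_apply, map_sub, ringHom_proj, ringHom_proj]

/-- Twice the sign (-1)^{ij} equals 1 + (-1)^i + (-1)^j - (-1)^{i+j}. So the sign rule for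
homogeneous elements becomes an identity in the parity, valid for all elements and preserved by the
usual constructions. -/
lemma supercomm (a b : A) :
    2 * (a * b) = b * a + A.parity b * a + b * A.parity a - A.parity b * A.parity a := by
  have e0 := A.even_comm _ (A.proj_mem 0 a)
  have e1 := A.even_comm _ (A.proj_mem 0 b) (A.proj 1 a)
  have e2 := A.odd_anticomm _ (A.proj_mem 1 a) _ (A.proj_mem 1 b)
  have ha := proj_add_proj a
  have hb := proj_add_proj b
  rw [parity_apply a, parity_apply b]
  generalize A.proj 0 a = a0, A.proj 1 a = a1, A.proj 0 b = b0, A.proj 1 b = b1 at *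
  subst ha hb
  simp only [add_mul, mul_add, sub_mul, mul_sub, two_mul, e0, e1, e2]
  abel

lemma odd_mul_self [NeZero (2 : K)] {a : A} (h : a ∈ A.grading 1) : a * a = 0 := by
  have h₁ := A.odd_anticomm a h a h
  have h₂ : (2 : K) • (a * a) = 0 := by
    rw [two_smul]
    nth_rw 1 [h₁]
    exact neg_add_cancel _
  exact (smul_eq_zero.1 h₂).resolve_left (NeZero.ne _)

variable [NeZero (2 : K)]

lemma two_cancel {M : Type*} [AddCommGroup M] [Module K M] {a b : M} (h : a + a = b + b) :
    a = b := by
  rw [← two_smul K a, ← two_smul K b] at h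
  exact smul_right_injective M (NeZero.ne (2 : K)) h

/-- With 2 invertible, the grading is recovered as the eigenspaces of the parity. Hence maps
commuting with parities preserve gradings. -/
lemma mem_even_iff {a : A} : a ∈ A.grading 0 ↔ A.parity a = a := by
  refine ⟨parity_even, fun h => ?_⟩
  rw [parity_apply] at h
  have h1 : A.proj 1 a = 0 := by
    refine two_cancel (K := K) ?_
    nth_rw 3 [← proj_add_proj a] at h
    rw [add_zero]
    have := sub_eq_iff_eq_add.1 h
    rw [add_assoc] at this
    exact (left_eq_add.1 this)
  rw [← proj_add_proj a, h1, add_zero]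
  exact A.proj_mem 0 a

lemma mem_odd_iff {a : A} : a ∈ A.grading 1 ↔ A.parity a = -a := by
  refine ⟨parity_odd, fun h => ?_⟩
  rw [parity_apply] at h
  have h1 : A.proj 0 a = 0 := by
    refine two_cancel (K := K) ?_
    nth_rw 3 [← proj_add_proj a] at h
    rw [add_zero, neg_add, sub_eq_add_neg] at *
    have := add_right_cancel h
    nth_rw 1 [this]
    simp
  rw [← proj_add_proj a, h1, zero_add]
  exact A.proj_mem 1 a

/-- Algebra maps that commute with the parity are superalgebra morphisms. -/
def homMk (f : A →ₐ[K] B) (h : ∀ a, f (A.parity a) = B.parity (f a)) : A ⟶ B where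
  toAlgHom := f
  map_mem i a ha := by
    rcases zmod_two_cases i with rfl | rfl
    · rw [mem_even_iff] at ha ⊢
      rw [← h, ha]
    · rw [mem_odd_iff] at ha ⊢
      rw [← h, ha, map_neg]

end Basic

variable [NeZero (2 : K)]

section Involution

variable (A : Type u) [Ring A] [Algebra K A] (s : A →ₐ[K] A)

/-- The `ℤ/2`-grading by eigenspaces of an involution. -/
def eigengrading (i : ZMod 2) : Submodule K A :=
  if i = 0 then LinearMap.eqLocus s.toLinearMap LinearMap.id
  else LinearMap.eqLocus s.toLinearMap (-LinearMap.id)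

variable {A} in
lemma mem_eigengrading_zero {a : A} : a ∈ eigengrading A s 0 ↔ s a = a := Iff.rfl

variable {A} in
lemma mem_eigengrading_one {a : A} : a ∈ eigengrading A s 1 ↔ s a = -a := Iff.rfl

lemma isCompl_eigengrading (hs : ∀ a, s (s a) = a) :
    IsCompl (eigengrading A s 0) (eigengrading A s 1) := by
  constructor
  · rw [Submodule.disjoint_def]
    intro a h₀ h₁
    rw [mem_eigengrading_zero] at h₀
    rw [mem_eigengrading_one, h₀] at h₁
    refine two_cancel (K := K) ?_
    nth_rw 1 [h₁]
    simp
  · rw [codisjoint_iff, Submodule.eq_top_iff']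
    intro a
    rw [Submodule.mem_sup]
    refine ⟨(2 : K)⁻¹ • (a + s a), ?_, (2 : K)⁻¹ • (a - s a), ?_, ?_⟩
    · rw [mem_eigengrading_zero, map_smul, map_add, hs, add_comm]
    · rw [mem_eigengrading_one, map_smul, map_sub, hs, ← smul_neg, neg_sub]
    · rw [← smul_add, add_add_sub_cancel, ← two_smul K a, smul_smul,
        inv_mul_cancel₀ (NeZero.ne _), one_smul]

/-- A superalgebra from an algebra with an involution. -/
def ofInvolution (hs : ∀ a, s (s a) = a)
    (hc : ∀ a b, 2 * (a * b) = b * a + s b * a + b * s a - s b * s a) : SAlg K :=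
  letI dec : DirectSum.Decomposition (eigengrading A s) :=
    ((DirectSum.isInternal_submodule_iff_isCompl (eigengrading A s) (i := 0) (j := 1) (by decide)
      (by ext i; simpa using zmod_two_cases i)).2
        (isCompl_eigengrading A s hs)).chooseDecomposition
  { carrier := A
    grading := eigengrading A s
    graded :=
      { __ := dec
        one_mem := map_one s
        mul_mem := by
          intro i j a b ha hb
          rcases zmod_two_cases i with rfl | rfl <;> rcases zmod_two_cases j with rfl | rfl
          · exact (mem_eigengrading_zero s).2 (by
              rw [map_mul, (mem_eigengrading_zero s).1 ha, (mem_eigengrading_zero s).1 hb])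
          · exact (mem_eigengrading_one s).2 (by
              rw [map_mul, (mem_eigengrading_zero s).1 ha, (mem_eigengrading_one s).1 hb, mul_neg])
          · exact (mem_eigengrading_one s).2 (by
              rw [map_mul, (mem_eigengrading_one s).1 ha, (mem_eigengrading_zero s).1 hb, neg_mul])
          · exact (mem_eigengrading_zero s).2 (by
              rw [map_mul, (mem_eigengrading_one s).1 ha, (mem_eigengrading_one s).1 hb,
                neg_mul_neg]) }
    -- The identity `hc` encodes the sign rule: it reads 2ab = 2ba when s fixes a, and 2ab = -2ba
    -- when s negates both a and b.
    even_comm := by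
      intro a ha b
      have h := hc a b
      rw [show s a = a from ha] at h
      refine two_cancel (K := K) ?_
      rw [← two_mul, h]
      abel
    odd_anticomm := by
      intro a ha b hb
      have h := hc a b
      rw [show s a = -a from ha, show s b = -b from hb] at h
      refine two_cancel (K := K) ?_
      rw [← two_mul, h]
      simp only [neg_mul, mul_neg, neg_neg]
      abel }

variable {A s}

lemma parity_ofInvolution (hs : ∀ a, s (s a) = a)
    (hc : ∀ a b, 2 * (a * b) = b * a + s b * a + b * s a - s b * s a) (a : A) :
    (ofInvolution A s hs hc).parity a = s a := by
  let A' := ofInvolution A s hs hc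
  have h0 : s (A'.proj 0 a) = A'.proj 0 a := A'.proj_mem 0 a
  have h1 : s (A'.proj 1 a) = -A'.proj 1 a := A'.proj_mem 1 a
  have h := congrArg s (proj_add_proj (A := A') a)
  have h' := map_add s (A'.proj 0 a) (A'.proj 1 a)
  have h2 : s (A'.proj 0 a) + s (A'.proj 1 a) = A'.proj 0 a + -A'.proj 1 a :=
    congrArg₂ (fun x y : A => x + y) h0 h1
  exact (parity_apply (A := A') a).trans
    ((sub_eq_add_neg _ _).trans (h2.symm.trans (h'.symm.trans h)))

end Involution

/-! ### The even part -/

/-- The even part of a superalgebra. -/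
def even (A : SAlg K) : Subalgebra K A where
  carrier := A.grading 0
  mul_mem' ha hb := by
    have := mul_mem_graded ha hb
    rwa [show (0 + 0 : ZMod 2) = 0 by decide] at this
  add_mem' ha hb := add_mem ha hb
  algebraMap_mem' k := by
    rw [Algebra.algebraMap_eq_smul_one]
    exact Submodule.smul_mem _ _ A.one_mem_even

instance (A : SAlg K) : CommRing A.even where
  mul_comm a b := Subtype.ext (A.even_comm a a.2 b)

instance (A : SAlg K) : Algebra A.even A where
  algebraMap := A.even.val.toRingHom
  commutes' a b := A.even_comm a a.2 b
  smul_def' _ _ := rfl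

lemma even_smul_def {A : SAlg K} (a : A.even) (b : A) : a • b = (a : A) * b := rfl

/-- The map induced on even parts. -/
def Hom.even {A B : SAlg K} (f : A ⟶ B) : A.even →ₐ[K] B.even :=
  ((Hom.toAlgHom f).comp A.even.val).codRestrict _ (fun a => ringHom_mem f a.2)

/-- The even component of an element. -/
def evenProj (A : SAlg K) (a : A) : A.even := ⟨A.proj 0 a, A.proj_mem 0 a⟩

/-! ### Purely even superalgebras -/

/-- A commutative algebra as a purely even superalgebra. -/
def ofComm (D : Type u) [CommRing D] [Algebra K D] : SAlg K :=
  ofInvolution D (AlgHom.id K D) (fun _ => rfl) (fun a b => by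
    simp only [AlgHom.id_apply]; ring)

lemma parity_ofComm (D : Type u) [CommRing D] [Algebra K D] (d : D) :
    (ofComm (K := K) D).parity d = d := parity_ofInvolution _ _ d

lemma ofComm_odd (D : Type u) [CommRing D] [Algebra K D] :
    (ofComm (K := K) D).grading 1 = ⊥ := by
  rw [eq_bot_iff]
  intro a ha
  have h : a = -a := (parity_ofComm D a).symm.trans (mem_odd_iff.1 ha)
  refine (Submodule.mem_bot K).2 (two_cancel (K := K) ?_)
  nth_rw 1 [h]
  rw [neg_add_cancel, add_zero]

lemma isFieldExtension_ofComm (D : Type u) [Field D] [Algebra K D] :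
    (ofComm (K := K) D).IsFieldExtension :=
  ⟨Field.toIsField D, ofComm_odd D⟩

/-- Morphisms to reduced purely even superalgebras. -/
def toComm {A : SAlg K} {D : Type u} [CommRing D] [IsReduced D] [Algebra K D]
    (f : A.even →ₐ[K] D) : A ⟶ ofComm (K := K) D :=
  homMk (B := ofComm D)
    (AlgHom.ofLinearMap (A := A) (B := D)
      { toFun := fun a => f (A.evenProj a)
        map_add' := fun a b => by
          rw [← map_add]; congr 1; exact Subtype.ext (map_add _ a b)
        map_smul' := fun k a => by
          rw [RingHom.id_apply, ← map_smul]; congr 1; exact Subtype.ext (map_smul _ k a) }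
      (by
        change f (A.evenProj 1) = 1
        rw [show A.evenProj 1 = 1 from Subtype.ext (proj_of_mem A.one_mem_even), map_one])
      (by
        intro a b
        change f (A.evenProj (a * b)) = f (A.evenProj a) * f (A.evenProj b)
        have h00 := mul_mem_graded (A.proj_mem 0 a) (A.proj_mem 0 b)
        have h01 := mul_mem_graded (A.proj_mem 0 a) (A.proj_mem 1 b)
        have h10 := mul_mem_graded (A.proj_mem 1 a) (A.proj_mem 0 b)
        have h11 := mul_mem_graded (A.proj_mem 1 a) (A.proj_mem 1 b)
        rw [show (0 + 0 : ZMod 2) = 0 by decide] at h00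
        rw [show (0 + 1 : ZMod 2) = 1 by decide] at h01
        rw [show (1 + 0 : ZMod 2) = 1 by decide] at h10
        rw [show (1 + 1 : ZMod 2) = 0 by decide] at h11
        have e : A.evenProj (a * b) =
            A.evenProj a * A.evenProj b + ⟨A.proj 1 a * A.proj 1 b, h11⟩ := by
          refine Subtype.ext ?_
          change A.proj 0 (a * b) = A.proj 0 a * A.proj 0 b + A.proj 1 a * A.proj 1 b
          conv_lhs => rw [← proj_add_proj a, ← proj_add_proj b]
          simp only [add_mul, mul_add, map_add, proj_of_mem h00, proj_of_mem h11,
            proj_of_mem_ne h01 (show (1 : ZMod 2) ≠ 0 by decide),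
            proj_of_mem_ne h10 (show (1 : ZMod 2) ≠ 0 by decide), zero_add, add_zero]
        rw [e, map_add, map_mul, add_eq_left]
        -- The even component of ab has the extra term a₁b₁, a product of odd elements. Its square
        -- is zero, so it dies in the reduced ring D; this is why projecting to the even part is
        -- multiplicative after applying f.
        refine (IsNilpotent.eq_zero (⟨2, ?_⟩ : IsNilpotent _))
        rw [← map_pow, show (⟨A.proj 1 a * A.proj 1 b, h11⟩ : A.even) ^ 2 = 0 from ?_, map_zero]
        refine Subtype.ext ?_
        change (A.proj 1 a * A.proj 1 b) ^ 2 = 0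
        rw [pow_two, mul_assoc, ← mul_assoc (A.proj 1 b),
          A.odd_anticomm _ (A.proj_mem 1 b) _ (A.proj_mem 1 a), neg_mul, mul_assoc,
          odd_mul_self (A.proj_mem 1 b), mul_zero, neg_zero, mul_zero]))
    (by
      intro a
      refine Eq.trans ?_ (parity_ofComm D (f (A.evenProj a))).symm
      change f (A.evenProj _) = f (A.evenProj a)
      congr 1
      refine Subtype.ext ?_
      change A.proj 0 (A.parity a) = A.proj 0 a
      rw [parity_apply, map_sub, proj_of_mem (A.proj_mem 0 a),
        proj_of_mem_ne (A.proj_mem 1 a) (by decide), sub_zero])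

lemma toComm_apply {A : SAlg K} {D : Type u} [CommRing D] [IsReduced D] [Algebra K D]
    (f : A.even →ₐ[K] D) (a : A) : Hom.ringHom (toComm f) a = f (A.evenProj a) := rfl

lemma evenProj_coe {A : SAlg K} (a : A.even) : A.evenProj a = a := Subtype.ext (proj_of_mem a.2)

lemma toComm_coe {A : SAlg K} {D : Type u} [CommRing D] [IsReduced D] [Algebra K D]
    (f : A.even →ₐ[K] D) (a : A.even) : Hom.ringHom (toComm f) (a : A) = f a := by
  rw [toComm_apply, evenProj_coe]

/-! ### Equalizers -/

section Equalizer

variable {A B : SAlg K} (f g : A ⟶ B)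

/-- The equalizer of two morphisms of superalgebras. -/
def equalizer : SAlg K :=
  ofInvolution (AlgHom.equalizer (Hom.toAlgHom f) (Hom.toAlgHom g))
    ((A.parity.comp (Subalgebra.val _)).codRestrict _ (fun a => by
      have h : Hom.ringHom f a = Hom.ringHom g a := a.2
      change Hom.ringHom f (A.parity a) = Hom.ringHom g (A.parity a)
      rw [ringHom_parity, ringHom_parity, h]))
    (fun a => Subtype.ext (parity_parity _))
    (fun a b => Subtype.ext (supercomm _ _))

/-- The inclusion of the equalizer. -/
def equalizerι : equalizer f g ⟶ A :=
  homMk (A := equalizer f g) (Subalgebra.val _) (fun a => by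
    exact congrArg Subtype.val (parity_ofInvolution _ _ a))

lemma equalizerι_injective : Function.Injective (Hom.ringHom (equalizerι f g)) :=
  Subtype.val_injective

lemma equalizer_condition (c : equalizer f g) :
    Hom.ringHom f (Hom.ringHom (equalizerι f g) c) = Hom.ringHom g (Hom.ringHom (equalizerι f g) c) :=
  c.2

lemma exists_equalizer_of_eq {a : A} (h : Hom.ringHom f a = Hom.ringHom g a) :
    ∃ c, Hom.ringHom (equalizerι f g) c = a := ⟨⟨a, h⟩, rfl⟩

end Equalizer

/-- Factor a morphism through an injective one. -/
lemma exists_factor {A B C : SAlg K} (i : B ⟶ C) (hi : Function.Injective (Hom.ringHom i))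
    (f : A ⟶ C) (h : ∀ a, ∃ b, Hom.ringHom i b = Hom.ringHom f a) : ∃ g : A ⟶ B, g ≫ i = f := by
  choose g hg using h
  refine ⟨homMk (A := A) (B := B)
    { toFun := g
      map_one' := hi (by rw [hg, map_one, map_one])
      map_zero' := hi (by rw [hg, map_zero, map_zero])
      map_add' := fun a b => hi (by rw [hg, map_add, map_add, hg, hg])
      map_mul' := fun a b => hi (by rw [hg, map_mul, map_mul, hg, hg])
      commutes' := fun k => hi (by rw [hg, ringHom_algebraMap, ringHom_algebraMap]) }
    (fun a => hi ?_), hom_ext fun a => hg a⟩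
  change Hom.ringHom i (g _) = Hom.ringHom i (B.parity (g a))
  rw [hg, ringHom_parity, ringHom_parity, hg]

/-! ### Quotients -/

section Quotient

variable (A : SAlg K) (I : Ideal A) (hI : ∀ a ∈ I, A.parity a ∈ I)

include hI in
-- By `supercomm`, 2ab is a combination of left multiples of a and of its parity, and 2 is
-- invertible.
lemma isTwoSided_of_parity : I.IsTwoSided := by
  refine ⟨fun {a} b ha => ?_⟩
  have h := supercomm a b
  have h2 : 2 * (a * b) ∈ I := by
    rw [h]
    exact sub_mem (add_mem (add_mem (I.mul_mem_left _ ha) (I.mul_mem_left _ ha))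
      (I.mul_mem_left _ (hI a ha))) (I.mul_mem_left _ (hI a ha))
  have : a * b = algebraMap K A (2 : K)⁻¹ * (2 * (a * b)) := by
    rw [← mul_assoc, show (2 : A) = algebraMap K A 2 by rw [map_ofNat], ← map_mul,
      inv_mul_cancel₀ (NeZero.ne _), map_one, one_mul]
  rw [this]
  exact I.mul_mem_left _ h2

/-- The quotient of a superalgebra by a parity-stable ideal. -/
def quot : SAlg K :=
  haveI := isTwoSided_of_parity A I hI
  ofInvolution (A ⧸ I)
    (Ideal.Quotient.liftₐ I ((Ideal.Quotient.mkₐ K I).comp A.parity) (fun a ha =>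
      Ideal.Quotient.eq_zero_iff_mem.2 (hI a ha)))
    (by
      intro a
      obtain ⟨a, rfl⟩ := Ideal.Quotient.mk_surjective a
      exact congrArg (Ideal.Quotient.mk I) (parity_parity a))
    (by
      intro a b
      obtain ⟨a, rfl⟩ := Ideal.Quotient.mk_surjective a
      obtain ⟨b, rfl⟩ := Ideal.Quotient.mk_surjective b
      exact congrArg (Ideal.Quotient.mk I) (supercomm a b))

lemma parity_quot (a : A) : (quot A I hI).parity (Submodule.Quotient.mk a : A ⧸ I) =
    (Submodule.Quotient.mk (A.parity a) : A ⧸ I) := by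
  haveI := isTwoSided_of_parity A I hI
  exact parity_ofInvolution (A := A ⧸ I) (s := Ideal.Quotient.liftₐ I
    ((Ideal.Quotient.mkₐ K I).comp A.parity) (fun a ha =>
      Ideal.Quotient.eq_zero_iff_mem.2 (hI a ha))) _ _ (Submodule.Quotient.mk a)

/-- The projection to the quotient. -/
def quotMk : A ⟶ quot A I hI :=
  haveI := isTwoSided_of_parity A I hI
  homMk (B := quot A I hI) (Ideal.Quotient.mkₐ K I) (fun a => by
    exact (parity_quot A I hI a).symm)

lemma quotMk_surjective : Function.Surjective (Hom.ringHom (quotMk A I hI)) :=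
  haveI := isTwoSided_of_parity A I hI
  Ideal.Quotient.mk_surjective

lemma quotMk_eq_zero {a : A} : Hom.ringHom (quotMk A I hI) a = 0 ↔ a ∈ I :=
  haveI := isTwoSided_of_parity A I hI
  Ideal.Quotient.eq_zero_iff_mem

end Quotient

/-- Factor a morphism through a surjective one. -/
lemma exists_factor_surjective {A B C : SAlg K} (q : A ⟶ B)
    (hq : Function.Surjective (Hom.ringHom q)) (f : A ⟶ C)
    (h : ∀ a, Hom.ringHom q a = 0 → Hom.ringHom f a = 0) : ∃ g : B ⟶ C, q ≫ g = f := by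
  choose s hs using hq
  have key : ∀ a b, Hom.ringHom q a = Hom.ringHom q b → Hom.ringHom f a = Hom.ringHom f b := by
    intro a b hab
    rw [← sub_eq_zero, ← map_sub] at hab ⊢
    exact h _ hab
  refine ⟨homMk (A := B) (B := C)
    { toFun := fun b => Hom.ringHom f (s b)
      map_one' := by rw [← map_one (Hom.ringHom f)]; exact key _ _ (by rw [hs, map_one])
      map_zero' := by rw [← map_zero (Hom.ringHom f)]; exact key _ _ (by rw [hs, map_zero])
      map_add' := fun a b => by rw [← map_add]; exact key _ _ (by rw [map_add, hs, hs, hs])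
      map_mul' := fun a b => by rw [← map_mul]; exact key _ _ (by rw [map_mul, hs, hs, hs])
      commutes' := fun k => by
        rw [← ringHom_algebraMap f]; exact key _ _ (by rw [hs, ringHom_algebraMap]) }
    (fun b => ?_), hom_ext fun a => key _ _ (hs _)⟩
  change Hom.ringHom f (s _) = C.parity (Hom.ringHom f (s b))
  rw [← ringHom_parity]
  exact key _ _ (by rw [hs, ringHom_parity, hs])

lemma epi_of_surjective {A B C : SAlg K} {q : A ⟶ B}
    (hq : Function.Surjective (Hom.ringHom q)) {f g : B ⟶ C} (h : q ≫ f = q ≫ g) : f = g :=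
  hom_ext fun b => by
    obtain ⟨a, rfl⟩ := hq b
    exact congrArg (fun k => Hom.ringHom k a) h

/-! ### Finite products -/

section Pi

variable {ι : Type} (S : ι → SAlg K)

/-- The product of a family of superalgebras. -/
def pi : SAlg K :=
  ofInvolution (∀ i, S i)
    (AlgHom.ofLinearMap
      (LinearMap.pi fun i => (S i).parity.toLinearMap.comp (LinearMap.proj i))
      (funext fun i => map_one (S i).parity) (fun _ _ => funext fun i => map_mul (S i).parity _ _))
    (fun _ => funext fun _ => parity_parity _)
    (fun _ _ => funext fun _ => supercomm _ _)

lemma parity_pi (a : ∀ i, S i) : (pi S).parity a = fun i => (S i).parity (a i) :=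
  parity_ofInvolution (A := ∀ i, S i) _ _ a

/-- The projections from the product. -/
def piProj (i : ι) : pi S ⟶ S i :=
  homMk (A := pi S) (Pi.evalAlgHom K (fun i => S i) i) (fun a => by
    exact congrFun (parity_pi S a) i)

/-- The morphism to a product given by its components. -/
def piLift {A : SAlg K} (f : ∀ i, A ⟶ S i) : A ⟶ pi S :=
  homMk (B := pi S) (AlgHom.ofLinearMap (A := A) (B := ∀ i, S i)
      (LinearMap.pi fun i => (Hom.toAlgHom (f i)).toLinearMap)
      (funext fun i => map_one (Hom.toAlgHom (f i)))
      (fun a b => funext fun i => map_mul (Hom.toAlgHom (f i)) a b)) (fun a => by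
    exact (funext fun i => ringHom_parity (f i) a).trans (parity_pi S _).symm)

@[simp] lemma piLift_proj {A : SAlg K} (f : ∀ i, A ⟶ S i) (i : ι) :
    piLift S f ≫ piProj S i = f i := rfl

end Pi

end SAlg

/-! ### Base change of flatness along a tensor product square -/

namespace NCFlat

open MulOpposite

section BaseChange

variable {R S R' P : Type u} [Ring R] [Ring S] [Ring R'] [Ring P]
variable (φ : R →+* S) (ψ : R →+* R') (u : S →+* P) (v : R' →+* P)
variable {N N' : Type u} [AddCommGroup N] [Module Sᵐᵒᵖ N] [AddCommGroup N'] [Module Sᵐᵒᵖ N']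

/-- The biadditive map `(n, b) ↦ n ⊗ b` for a restricted module. -/
def resTmulHom : N →+ R' →+ Tensor ψ (Res φ N) := tmulHom ψ (N := Res φ N)

/-- The pure tensor `n ⊗ b` in `N ⊗_R R'`, for a right `S`-module `N`. -/
def resTmul (n : N) (b : R') : Tensor ψ (Res φ N) := tmul ψ (N := Res φ N) n b

lemma mul_resTmul (s : S) (a : R) (b : R') :
    resTmul φ ψ (s * φ a) b = resTmul φ ψ s (ψ a * b) :=
  smul_tmul ψ (N := Res φ S) a s b

lemma zero_resTmul (b : R') : resTmul φ ψ (0 : N) b = 0 := zero_tmul ψ (N := Res φ N) b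

lemma add_resTmul (n m : N) (b : R') :
    resTmul φ ψ (n + m) b = resTmul φ ψ n b + resTmul φ ψ m b := add_tmul ψ (N := Res φ N) n m b

lemma map_resTmul (f : N →ₗ[Sᵐᵒᵖ] N') (n : N) (b : R') :
    map ψ (Res.map φ f) (resTmul φ ψ n b) = resTmul φ ψ (f n) b := rfl

variable {φ ψ} in
@[elab_as_elim]
lemma res_induction {p : Tensor ψ (Res φ N) → Prop} (t : Tensor ψ (Res φ N)) (zero : p 0)
    (tmul : ∀ (n : N) b, p (resTmul φ ψ n b)) (add : ∀ x y, p x → p y → p (x + y)) : p t :=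
  tensor_induction t zero tmul add

/-- Additive maps out of `N ⊗_R R'` for a restricted module. -/
def resLift {M : Type*} [AddCommGroup M] (f : N →+ R' →+ M)
    (h : ∀ n a b, f (op (φ a) • n) b = f n (ψ a * b)) : Tensor ψ (Res φ N) →+ M :=
  lift ψ (N := Res φ N) f h

/-- The map `S ⊗_R R' → P`, `s ⊗ r ↦ u(s) v(r)`. -/
def mulMap (h : u.comp φ = v.comp ψ) : Tensor ψ (Res φ S) →+ P :=
  resLift φ ψ (((AddMonoidHom.compHom' v.toAddMonoidHom).comp (AddMonoidHom.mul (R := P))).comp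
      u.toAddMonoidHom : S →+ R' →+ P)
    (fun n a b => by
      change u (n * φ a) * v b = u n * v (ψ a * b)
      rw [map_mul, map_mul, mul_assoc, show u (φ a) = v (ψ a) from RingHom.congr_fun h a])

variable {φ ψ u v}

@[simp] lemma mulMap_tmul (h : u.comp φ = v.comp ψ) (s : S) (r : R') :
    mulMap φ ψ u v h (resTmul φ ψ s r) = u s * v r := rfl

/-- The orbit map `s ↦ n s` of an element of a right module. -/
def orbitMap (n : N) : S →ₗ[Sᵐᵒᵖ] N where
  toFun s := op s • n
  map_add' s t := by rw [MulOpposite.op_add, add_smul]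
  map_smul' a s := by
    obtain ⟨a, rfl⟩ := op_surjective a
    rw [op_smul_eq_mul, op_mul, mul_smul]
    rfl

lemma orbitMap_apply (n : N) (s : S) : orbitMap n s = op s • n := rfl

variable (φ ψ u v) in
/-- The comparison map `N ⊗_R R' → N ⊗_S P`. -/
def baseChangeMap (h : u.comp φ = v.comp ψ) (N : Type u) [AddCommGroup N] [Module Sᵐᵒᵖ N] :
    Tensor ψ (Res φ N) →+ Tensor u N :=
  resLift φ ψ ((AddMonoidHom.compHom' v.toAddMonoidHom).comp (tmulHom u) : N →+ R' →+ Tensor u N)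
    (fun n a b => by
      change tmul u (op (φ a) • n) (v b) = tmul u n (v (ψ a * b))
      rw [smul_tmul, map_mul, show u (φ a) = v (ψ a) from RingHom.congr_fun h a])

@[simp] lemma baseChangeMap_tmul (h : u.comp φ = v.comp ψ) (n : N) (r : R') :
    baseChangeMap φ ψ u v h N (resTmul φ ψ n r) = tmul u n (v r) := rfl

lemma baseChangeMap_map (h : u.comp φ = v.comp ψ) (f : N →ₗ[Sᵐᵒᵖ] N') (t : Tensor ψ (Res φ N)) :
    baseChangeMap φ ψ u v h N' (map ψ (Res.map φ f) t) = map u f (baseChangeMap φ ψ u v h N t) := by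
  refine res_induction t (by simp) (fun n b => ?_) (fun x y hx hy => ?_)
  · rfl
  · simp only [map_add, hx, hy]

lemma mulMap_map_mulLeft (h : u.comp φ = v.comp ψ) (s : S) (t : Tensor ψ (Res φ S)) :
    mulMap φ ψ u v h (map ψ (Res.map φ (orbitMap s)) t) = u s * mulMap φ ψ u v h t := by
  refine res_induction t (by simp) (fun n b => ?_) (fun x y hx hy => ?_)
  · change u (s * n) * v b = u s * (u n * v b)
    rw [map_mul, mul_assoc]
  · simp only [map_add, hx, hy, mul_add]

/-- If P = S ⊗_R R', this is N ⊗_R R' = N ⊗_S (S ⊗_R R'). The inverse sends n ⊗ p to the image of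
the preimage of p under s ⊗ r ↦ ns ⊗ r. -/
lemma baseChangeMap_bijective (h : u.comp φ = v.comp ψ)
    (hb : Function.Bijective (mulMap φ ψ u v h)) (N : Type u) [AddCommGroup N] [Module Sᵐᵒᵖ N] :
    Function.Bijective (baseChangeMap φ ψ u v h N) := by
  let e : Tensor ψ (Res φ S) ≃+ P := AddEquiv.ofBijective _ hb
  have he : ∀ s r, e.symm (u s * v r) = resTmul φ ψ s r := fun s r =>
    e.symm_apply_eq.2 rfl
  let f : N →+ P →+ Tensor ψ (Res φ N) :=
    { toFun := fun n => (map ψ (Res.map φ (orbitMap n))).comp e.symm.toAddMonoidHom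
      map_zero' := by
        ext p
        change map ψ (Res.map φ (orbitMap (0 : N))) (e.symm p) = 0
        refine res_induction (e.symm p) (by simp) (fun s b => ?_) (fun x y hx hy => ?_)
        · rw [map_resTmul, orbitMap_apply, smul_zero, zero_resTmul]
        · rw [map_add, hx, hy, add_zero]
      map_add' := fun n m => by
        ext p
        change map ψ (Res.map φ (orbitMap (n + m))) (e.symm p) =
          map ψ (Res.map φ (orbitMap n)) (e.symm p) + map ψ (Res.map φ (orbitMap m)) (e.symm p)
        refine res_induction (e.symm p) (by simp) (fun s b => ?_) (fun x y hx hy => ?_)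
        · rw [map_resTmul, map_resTmul, map_resTmul, orbitMap_apply, smul_add, add_resTmul]
          rfl
        · rw [map_add, map_add, map_add, hx, hy]
          abel }
  have hf : ∀ n p, f n p = map ψ (Res.map φ (orbitMap n)) (e.symm p) := fun _ _ => rfl
  let g : Tensor u N →+ Tensor ψ (Res φ N) := lift u f (by
    intro n s p
    obtain ⟨t, rfl⟩ := e.surjective p
    have h₁ : e.symm (u s * e t) = map ψ (Res.map φ (orbitMap s)) t :=
      e.symm_apply_eq.2 (mulMap_map_mulLeft h s t).symm
    rw [hf, hf, h₁, e.symm_apply_apply]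
    refine res_induction t (by simp) (fun x b => ?_) (fun x y hx hy => ?_)
    · rw [map_resTmul, map_resTmul, map_resTmul, orbitMap_apply, orbitMap_apply, orbitMap_apply,
        op_smul_eq_mul, op_mul, mul_smul]
    · rw [map_add, map_add, map_add, hx, hy])
  refine Function.bijective_iff_has_inverse.2 ⟨g, fun t => ?_, fun t => ?_⟩
  · refine res_induction t (by simp) (fun n b => ?_) (fun x y hx hy => ?_)
    · change f n (v b) = _
      have h₁ := he 1 b
      rw [map_one, one_mul] at h₁
      rw [hf, h₁, map_resTmul, orbitMap_apply, op_one, one_smul]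
    · simp only [map_add, hx, hy]
  · refine tensor_induction t (by simp) (fun n p => ?_) (fun x y hx hy => ?_)
    · change baseChangeMap φ ψ u v h N (f n p) = _
      rw [hf]
      obtain ⟨t, rfl⟩ := e.surjective p
      rw [e.symm_apply_apply]
      refine res_induction t (by simp) (fun s b => ?_) (fun x y hx hy => ?_)
      · rw [map_resTmul, baseChangeMap_tmul, orbitMap_apply, smul_tmul]
        rfl
      · simp only [map_add, hx, hy, tmul_add]
    · simp only [map_add, hx, hy]

/-- The functor N ↦ N ⊗_S P is N ↦ N ⊗_R R' applied to the restriction of N to R, so exactness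
properties of R' over R pass to P over S. -/
lemma Flat.baseChange (h : u.comp φ = v.comp ψ) (hb : Function.Bijective (mulMap φ ψ u v h))
    (hψ : Flat ψ) : Flat u := by
  intro N N' _ _ _ _ f hf
  have hc : map u f ∘ baseChangeMap φ ψ u v h N =
      baseChangeMap φ ψ u v h N' ∘ map ψ (Res.map φ f) :=
    funext fun t => (baseChangeMap_map h f t).symm
  rw [← Function.Injective.of_comp_iff' _ (baseChangeMap_bijective h hb N), hc]
  exact (baseChangeMap_bijective h hb N').injective.comp (hψ _ _ (Res.map φ f) hf)

lemma FaithfullyFlat.baseChange (h : u.comp φ = v.comp ψ)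
    (hb : Function.Bijective (mulMap φ ψ u v h)) (hψ : FaithfullyFlat ψ) : FaithfullyFlat u :=
  ⟨hψ.1.baseChange h hb, fun N _ _ hN => hψ.2 (Res φ N)
    ((Equiv.ofBijective _ (baseChangeMap_bijective h hb N)).subsingleton_congr.2 hN)⟩

end BaseChange

lemma flat_of_field {k B : Type u} [Field k] [Ring B] (φ : k →+* B) : Flat φ :=
  flat_of_split fun _ _ _ _ _ _ f hf => LinearMap.exists_leftInverse_of_injective f
    (LinearMap.ker_eq_bot.2 hf)

end NCFlat

/-! ### Supercommutativity on generators, coproducts and pushouts of superalgebras -/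

namespace SAlg

variable {K : Type u} [Field K]

section Generators

variable {T : Type u} [Ring T] [Algebra K T] (s : T →ₐ[K] T)

/-- Supercommutativity may be checked on homogeneous generators. -/
lemma supercomm_of_generators {G : Set T} (hG : Algebra.adjoin K G = ⊤) (hs : ∀ a, s (s a) = a)
    (h : ∀ g ∈ G, (s g = g ∧ ∀ x ∈ G, g * x = x * g) ∨ (s g = -g ∧ ∀ x ∈ G, g * x = s x * g))
    (a b : T) : 2 * (a * b) = b * a + s b * a + b * s a - s b * s a := by
  -- Used with τ the identity for even g (commuting) and τ = s for odd g (commuting up to the sign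
  -- of x).
  have h₀ : ∀ (τ : T →ₐ[K] T) (g : T), (∀ x ∈ G, g * x = τ x * g) → ∀ x, g * x = τ x * g := by
    intro τ g hg x
    have hx : x ∈ Algebra.adjoin K G := hG ▸ Algebra.mem_top
    induction hx using Algebra.adjoin_induction with
    | mem x hx => exact hg x hx
    | algebraMap k => rw [AlgHom.commutes, Algebra.commutes]
    | add x y _ _ hx hy => rw [mul_add, map_add, add_mul, hx, hy]
    | mul x y _ _ hx hy => rw [← mul_assoc, hx, mul_assoc, hy, map_mul, mul_assoc]
  -- Sums of an s-fixed central a₀ and an s-negated a₁ that commutes with everything up to s form a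
  -- subalgebra containing the generators, hence are everything. For such sums the identity is a
  -- direct computation.
  have key : ∃ a₀ a₁, a = a₀ + a₁ ∧ (s a₀ = a₀ ∧ ∀ x, a₀ * x = x * a₀) ∧
      (s a₁ = -a₁ ∧ ∀ x, a₁ * x = s x * a₁) := by
    have ha : a ∈ Algebra.adjoin K G := hG ▸ Algebra.mem_top
    induction ha using Algebra.adjoin_induction with
    | mem g hg =>
      rcases h g hg with ⟨h1, h2⟩ | ⟨h1, h2⟩
      · exact ⟨g, 0, by simp, ⟨h1, h₀ (AlgHom.id K T) g h2⟩, by simp⟩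
      · exact ⟨0, g, by simp, by simp, ⟨h1, h₀ s g h2⟩⟩
    | algebraMap k =>
      exact ⟨algebraMap K T k, 0, by simp, ⟨s.commutes k, fun x => Algebra.commutes k x⟩, by simp⟩
    | add x y _ _ hx hy =>
      obtain ⟨a₀, a₁, rfl, ⟨e1, e2⟩, e3, e4⟩ := hx
      obtain ⟨b₀, b₁, rfl, ⟨f1, f2⟩, f3, f4⟩ := hy
      refine ⟨a₀ + b₀, a₁ + b₁, by abel, ⟨by rw [map_add, e1, f1], fun x => ?_⟩,
        by rw [map_add, e3, f3]; abel, fun x => ?_⟩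
      · rw [add_mul, mul_add, e2, f2]
      · rw [add_mul, mul_add, e4, f4]
    | mul x y _ _ hx hy =>
      obtain ⟨a₀, a₁, rfl, ⟨e1, e2⟩, e3, e4⟩ := hx
      obtain ⟨b₀, b₁, rfl, ⟨f1, f2⟩, f3, f4⟩ := hy
      refine ⟨a₀ * b₀ + a₁ * b₁, a₀ * b₁ + a₁ * b₀, by noncomm_ring,
        ⟨by rw [map_add, map_mul, map_mul, e1, f1, e3, f3, neg_mul_neg], fun x => ?_⟩,
        by rw [map_add, map_mul, map_mul, e1, f1, e3, f3]; noncomm_ring, fun x => ?_⟩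
      · rw [add_mul, mul_add, mul_assoc, f2, ← mul_assoc, e2, mul_assoc, mul_assoc a₁, f4,
          ← mul_assoc a₁, e4, hs, mul_assoc]
      · rw [add_mul, mul_add, mul_assoc, f4, ← mul_assoc, e2, mul_assoc, mul_assoc a₁, f2,
          ← mul_assoc a₁, e4, mul_assoc]
  obtain ⟨a₀, a₁, rfl, ⟨e1, e2⟩, e3, e4⟩ := key
  rw [map_add, e1, e3, add_mul, e2, e4]
  noncomm_ring

end Generators

variable [NeZero (2 : K)]

/-! ### Coproducts -/

section Coproduct

open scoped TensorProduct
open GradedTensorProduct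

variable (A B : SAlg K)

lemma uzpow_one_mul_one : (-1 : ℤˣ) ^ (1 * 1 : ZMod 2) = -1 := by decide

/-- The parity of the graded tensor product. -/
def coprodParity : (A.grading ᵍ⊗[K] B.grading) →ₐ[K] (A.grading ᵍ⊗[K] B.grading) :=
  GradedTensorProduct.lift A.grading B.grading
    ((includeLeft A.grading B.grading).comp A.parity)
    ((includeRight A.grading B.grading).comp B.parity)
    (by
      intro i j a b
      have h : ∀ (x : A) (y : B), x ∈ A.grading i → y ∈ B.grading j →
          includeLeft A.grading B.grading x * includeRight A.grading B.grading y =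
          (-1 : ℤˣ) ^ (j * i) • (includeRight A.grading B.grading y *
            includeLeft A.grading B.grading x) := by
        intro x y hx hy
        rw [includeLeft_apply, includeRight_apply, tmul_one_mul_one_tmul,
          tmul_coe_mul_coe_tmul (R := K) A.grading B.grading 1 ⟨y, hy⟩ ⟨x, hx⟩ 1, smul_smul,
          Int.units_mul_self, one_smul, one_mul, mul_one]
      refine h (A.parity a) (B.parity b) ?_ ?_
      · rcases zmod_two_cases i with rfl | rfl
        · rw [parity_even a.2]; exact a.2
        · rw [parity_odd a.2]; exact neg_mem a.2
      · rcases zmod_two_cases j with rfl | rfl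
        · rw [parity_even b.2]; exact b.2
        · rw [parity_odd b.2]; exact neg_mem b.2)

lemma coprodParity_tmul (a : A) (b : B) :
    coprodParity A B (a ᵍ⊗ₜ[K] b) = A.parity a ᵍ⊗ₜ[K] B.parity b := by
  refine (GradedTensorProduct.lift_tmul A.grading B.grading _ _ _ a b).trans ?_
  exact tmul_one_mul_one_tmul A.grading B.grading (A.parity a) (B.parity b)

@[elab_as_elim]
lemma gradedTensor_induction {p : (A.grading ᵍ⊗[K] B.grading) → Prop} (t : A.grading ᵍ⊗[K] B.grading)
    (zero : p 0) (tmul : ∀ (a : A) (b : B), p (a ᵍ⊗ₜ[K] b)) (add : ∀ x y, p x → p y → p (x + y)) :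
    p t :=
  TensorProduct.induction_on (motive := fun t => p (of K A.grading B.grading t))
    ((of K A.grading B.grading).symm t) zero tmul add

lemma coprodParity_coprodParity (t : A.grading ᵍ⊗[K] B.grading) :
    coprodParity A B (coprodParity A B t) = t := by
  refine gradedTensor_induction A B t (by simp) (fun a b => ?_) (fun x y hx hy => ?_)
  · rw [coprodParity_tmul, coprodParity_tmul, parity_parity, parity_parity]
  · rw [map_add, map_add, hx, hy]

/-- Homogeneous generators of the graded tensor product. -/
def coprodGenerators : Set (A.grading ᵍ⊗[K] B.grading) :=
  {t | ∃ i, ∃ a ∈ A.grading i, t = a ᵍ⊗ₜ[K] (1 : B)} ∪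
    {t | ∃ i, ∃ b ∈ B.grading i, t = (1 : A) ᵍ⊗ₜ[K] b}

lemma adjoin_coprodGenerators : Algebra.adjoin K (coprodGenerators A B) = ⊤ := by
  rw [eq_top_iff]
  rintro t -
  refine gradedTensor_induction A B t (zero_mem _) (fun a b => ?_) (fun x y hx hy => add_mem hx hy)
  have hl : includeLeft A.grading B.grading a ∈ Algebra.adjoin K (coprodGenerators A B) := by
    rw [← proj_add_proj a, map_add]
    exact add_mem (Algebra.subset_adjoin (Or.inl ⟨0, _, A.proj_mem 0 a, rfl⟩))
      (Algebra.subset_adjoin (Or.inl ⟨1, _, A.proj_mem 1 a, rfl⟩))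
  have hr : includeRight A.grading B.grading b ∈ Algebra.adjoin K (coprodGenerators A B) := by
    rw [← proj_add_proj b, map_add]
    exact add_mem (Algebra.subset_adjoin (Or.inr ⟨0, _, B.proj_mem 0 b, rfl⟩))
      (Algebra.subset_adjoin (Or.inr ⟨1, _, B.proj_mem 1 b, rfl⟩))
  have := mul_mem hl hr
  rwa [includeLeft_apply, includeRight_apply, tmul_one_mul_one_tmul] at this

lemma left_mul_left (a b : A) : (a ᵍ⊗ₜ[K] (1 : B) : A.grading ᵍ⊗[K] B.grading) * b ᵍ⊗ₜ[K] (1 : B) =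
    (a * b) ᵍ⊗ₜ[K] (1 : B) := (map_mul (includeLeft A.grading B.grading) a b).symm

lemma right_mul_right (a b : B) :
    ((1 : A) ᵍ⊗ₜ[K] a : A.grading ᵍ⊗[K] B.grading) * (1 : A) ᵍ⊗ₜ[K] b = (1 : A) ᵍ⊗ₜ[K] (a * b) :=
  (map_mul (includeRight A.grading B.grading) a b).symm

lemma right_mul_left {i j : ZMod 2} {a : A} {b : B} (ha : a ∈ A.grading i) (hb : b ∈ B.grading j) :
    ((1 : A) ᵍ⊗ₜ[K] b : A.grading ᵍ⊗[K] B.grading) * a ᵍ⊗ₜ[K] (1 : B) =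
      (-1 : ℤˣ) ^ (j * i) • (a ᵍ⊗ₜ[K] b) := by
  rw [tmul_coe_mul_coe_tmul (R := K) A.grading B.grading 1 ⟨b, hb⟩ ⟨a, ha⟩ 1, one_mul, mul_one]

lemma left_mul_right (a : A) (b : B) :
    (a ᵍ⊗ₜ[K] (1 : B) : A.grading ᵍ⊗[K] B.grading) * (1 : A) ᵍ⊗ₜ[K] b = a ᵍ⊗ₜ[K] b :=
  tmul_one_mul_one_tmul A.grading B.grading a b

lemma neg_tmul' (a : A) (b : B) : ((-a) ᵍ⊗ₜ[K] b : A.grading ᵍ⊗[K] B.grading) = -(a ᵍ⊗ₜ[K] b) := by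
  rw [GradedTensorProduct.tmul, TensorProduct.neg_tmul, map_neg]

lemma tmul_neg' (a : A) (b : B) : (a ᵍ⊗ₜ[K] (-b) : A.grading ᵍ⊗[K] B.grading) = -(a ᵍ⊗ₜ[K] b) := by
  rw [GradedTensorProduct.tmul, TensorProduct.tmul_neg, map_neg]

lemma coprod_supercomm (a b : A.grading ᵍ⊗[K] B.grading) :
    2 * (a * b) = b * a + coprodParity A B b * a + b * coprodParity A B a -
      coprodParity A B b * coprodParity A B a := by
  refine supercomm_of_generators _ (adjoin_coprodGenerators A B) (coprodParity_coprodParity A B)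
    ?_ a b
  rintro _ (⟨i, a, ha, rfl⟩ | ⟨i, b, hb, rfl⟩)
  · rcases zmod_two_cases i with rfl | rfl
    · refine Or.inl ⟨by rw [coprodParity_tmul, map_one, parity_even ha], ?_⟩
      rintro _ (⟨j, x, hx, rfl⟩ | ⟨j, y, hy, rfl⟩)
      · rw [left_mul_left, left_mul_left, A.even_comm a ha]
      · rw [left_mul_right, right_mul_left A B ha hy, mul_zero, uzpow_zero, one_smul]
    · refine Or.inr ⟨by rw [coprodParity_tmul, map_one, parity_odd ha, neg_tmul'], ?_⟩
      rintro _ (⟨j, x, hx, rfl⟩ | ⟨j, y, hy, rfl⟩)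
      · rw [left_mul_left, coprodParity_tmul, map_one]
        rcases zmod_two_cases j with rfl | rfl
        · rw [parity_even hx, left_mul_left, A.even_comm x hx]
        · rw [parity_odd hx, left_mul_left, neg_mul, A.odd_anticomm a ha x hx]
      · rw [left_mul_right, coprodParity_tmul, map_one]
        rcases zmod_two_cases j with rfl | rfl
        · rw [parity_even hy, right_mul_left A B ha hy, zero_mul, uzpow_zero, one_smul]
        · rw [parity_odd hy, tmul_neg', neg_mul, right_mul_left A B ha hy, uzpow_one_mul_one,
            Units.neg_smul, one_smul, neg_neg]
  · rcases zmod_two_cases i with rfl | rfl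
    · refine Or.inl ⟨by rw [coprodParity_tmul, map_one, parity_even hb], ?_⟩
      rintro _ (⟨j, x, hx, rfl⟩ | ⟨j, y, hy, rfl⟩)
      · rw [left_mul_right, right_mul_left A B hx hb, zero_mul, uzpow_zero, one_smul]
      · rw [right_mul_right, right_mul_right, B.even_comm b hb]
    · refine Or.inr ⟨by rw [coprodParity_tmul, map_one, parity_odd hb, tmul_neg'], ?_⟩
      rintro _ (⟨j, x, hx, rfl⟩ | ⟨j, y, hy, rfl⟩)
      · rw [coprodParity_tmul, map_one, left_mul_right]
        rcases zmod_two_cases j with rfl | rfl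
        · rw [parity_even hx, right_mul_left A B hx hb, mul_zero, uzpow_zero, one_smul]
        · rw [parity_odd hx, right_mul_left A B hx hb, uzpow_one_mul_one,
            Units.neg_smul, one_smul, neg_tmul']
      · rw [right_mul_right, coprodParity_tmul, map_one]
        rcases zmod_two_cases j with rfl | rfl
        · rw [parity_even hy, right_mul_right, B.even_comm y hy]
        · rw [parity_odd hy, right_mul_right, neg_mul, B.odd_anticomm b hb y hy]

/-- The coproduct of two superalgebras. -/
def coprod : SAlg K :=
  ofInvolution (A.grading ᵍ⊗[K] B.grading) (coprodParity A B) (coprodParity_coprodParity A B)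
    (coprod_supercomm A B)

lemma parity_coprod (t : A.grading ᵍ⊗[K] B.grading) :
    (coprod A B).parity t = coprodParity A B t := parity_ofInvolution _ _ t

/-- The left inclusion into the coproduct. -/
def coprodInl : A ⟶ coprod A B :=
  homMk (B := coprod A B) (includeLeft A.grading B.grading) (fun a => by
    refine Eq.trans ?_ (parity_coprod A B (a ᵍ⊗ₜ[K] 1)).symm
    rw [coprodParity_tmul, map_one]
    rfl)

/-- The right inclusion into the coproduct. -/
def coprodInr : B ⟶ coprod A B :=
  homMk (B := coprod A B) (includeRight A.grading B.grading) (fun b => by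
    refine Eq.trans ?_ (parity_coprod A B (1 ᵍ⊗ₜ[K] b)).symm
    rw [coprodParity_tmul, map_one]
    rfl)

lemma coprod_inl_mul_inr (a : A) (b : B) :
    Hom.ringHom (coprodInl A B) a * Hom.ringHom (coprodInr A B) b =
      (a ᵍ⊗ₜ[K] b : A.grading ᵍ⊗[K] B.grading) :=
  left_mul_right A B a b

variable {A B} in
@[elab_as_elim]
lemma coprod_induction {p : coprod A B → Prop} (t : coprod A B) (zero : p 0)
    (mul : ∀ a b, p (Hom.ringHom (coprodInl A B) a * Hom.ringHom (coprodInr A B) b))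
    (add : ∀ x y, p x → p y → p (x + y)) : p t :=
  gradedTensor_induction A B (p := p) t zero
    (fun a b => by rw [← coprod_inl_mul_inr]; exact mul a b) add

variable {A B} in
lemma exists_coprod_desc {Q : SAlg K} (f : A ⟶ Q) (g : B ⟶ Q) :
    ∃ h : coprod A B ⟶ Q, coprodInl A B ≫ h = f ∧ coprodInr A B ≫ h = g := by
  let l := GradedTensorProduct.lift A.grading B.grading (Hom.toAlgHom f) (Hom.toAlgHom g) (by
    intro i j a b
    change Hom.ringHom f a * Hom.ringHom g b = _ • (Hom.ringHom g b * Hom.ringHom f a)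
    have ha := ringHom_mem f a.2
    have hb := ringHom_mem g b.2
    rcases zmod_two_cases i with rfl | rfl
    · rw [mul_zero, uzpow_zero, one_smul, Q.even_comm _ ha]
    · rcases zmod_two_cases j with rfl | rfl
      · rw [zero_mul, uzpow_zero, one_smul, Q.even_comm _ hb]
      · rw [uzpow_one_mul_one, Units.neg_smul, one_smul, Q.odd_anticomm _ ha _ hb])
  have hl : ∀ (a : A) (b : B), l (a ᵍ⊗ₜ[K] b) = Hom.ringHom f a * Hom.ringHom g b := fun a b => rfl
  refine ⟨homMk (A := coprod A B) l (fun t => ?_), hom_ext fun a => ?_, hom_ext fun b => ?_⟩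
  · refine (congrArg l (parity_coprod A B t)).trans ?_
    refine gradedTensor_induction A B (p := fun t => l (coprodParity A B t) = Q.parity (l t)) t
      (by rw [map_zero, map_zero, map_zero]) (fun a b => ?_) (fun x y hx hy => ?_)
    · rw [coprodParity_tmul, hl, hl, map_mul, ringHom_parity, ringHom_parity]
    · rw [map_add, map_add, map_add, map_add, hx, hy]
  · exact (hl a 1).trans (by rw [map_one, mul_one])
  · exact (hl 1 b).trans (by rw [map_one, one_mul])

end Coproduct

/-! ### Pushouts -/

lemma ringHom_comp_eq {R S R' P : SAlg K} {φ : R ⟶ S} {ψ : R ⟶ R'} {u : S ⟶ P} {v : R' ⟶ P}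
    (h : φ ≫ u = ψ ≫ v) :
    (Hom.ringHom u).comp (Hom.ringHom φ) = (Hom.ringHom v).comp (Hom.ringHom ψ) :=
  congrArg Hom.ringHom h

/-- The pushout of superalgebras, together with its description as a tensor product. -/
structure IsPushout {R S R' P : SAlg K} (φ : R ⟶ S) (ψ : R ⟶ R') (u : S ⟶ P) (v : R' ⟶ P) :
    Prop where
  comm : φ ≫ u = ψ ≫ v
  bijective : Function.Bijective (NCFlat.mulMap (Hom.ringHom φ) (Hom.ringHom ψ) (Hom.ringHom u)
    (Hom.ringHom v) (ringHom_comp_eq comm))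
  exists_desc : ∀ {Q : SAlg K} (a : S ⟶ Q) (b : R' ⟶ Q), φ ≫ a = ψ ≫ b →
    ∃ h : P ⟶ Q, u ≫ h = a ∧ v ≫ h = b

section Pushout

variable {R S R' : SAlg K} (φ : R ⟶ S) (ψ : R ⟶ R')

lemma odd_mul_parity {A : SAlg K} {a : A} (ha : a ∈ A.grading 1) (b : A) :
    a * A.parity b = b * a := by
  have e0 := A.even_comm _ (A.proj_mem 0 b) a
  have e1 := A.odd_anticomm _ (A.proj_mem 1 b) a ha
  conv_rhs => rw [← proj_add_proj b]
  rw [parity_apply, mul_sub, add_mul, e0, e1, sub_eq_add_neg]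

/-- The relation `φ(r) ⊗ 1 - 1 ⊗ ψ(r)` in the coproduct. -/
def pushoutRel (r : R) : coprod S R' :=
  Hom.ringHom (coprodInl S R') (Hom.ringHom φ r) - Hom.ringHom (coprodInr S R') (Hom.ringHom ψ r)

/-- The ideal defining the pushout as a quotient of the coproduct. -/
def pushoutIdeal : Ideal (coprod S R') := Ideal.span (Set.range (pushoutRel φ ψ))

lemma parity_mem_pushoutIdeal (a : coprod S R') (ha : a ∈ pushoutIdeal φ ψ) :
    (coprod S R').parity a ∈ pushoutIdeal φ ψ := by
  induction ha using Submodule.span_induction with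
  | mem x hx =>
    obtain ⟨r, rfl⟩ := hx
    refine Ideal.subset_span ⟨R.parity r, ?_⟩
    rw [pushoutRel, pushoutRel, map_sub, ringHom_parity, ringHom_parity, ringHom_parity,
      ringHom_parity]
  | zero => rw [map_zero]; exact zero_mem _
  | add x y _ _ hx hy => rw [map_add]; exact add_mem hx hy
  | smul c x _ hx => rw [smul_eq_mul, map_mul]; exact Ideal.mul_mem_left _ _ hx

/-- The additive map from the coproduct to the tensor product over `R`. -/
def coprodToTensor : coprod S R' →+
    NCFlat.Tensor (Hom.ringHom ψ) (NCFlat.Res (Hom.ringHom φ) S) :=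
  (TensorProduct.liftAddHom (R := K)
    (NCFlat.resTmulHom (Hom.ringHom φ) (Hom.ringHom ψ) : S →+ R' →+ _)
    (fun k s r => by
      have h := NCFlat.mul_resTmul (Hom.ringHom φ) (Hom.ringHom ψ) s (algebraMap K R k) r
      rwa [ringHom_algebraMap, ringHom_algebraMap, ← Algebra.commutes, ← Algebra.smul_def,
        ← Algebra.smul_def] at h)).comp
  ((GradedTensorProduct.of K S.grading R'.grading).symm.toLinearMap.toAddMonoidHom)

lemma coprodToTensor_mul (s : S) (r : R') :
    coprodToTensor φ ψ (Hom.ringHom (coprodInl S R') s * Hom.ringHom (coprodInr S R') r) =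
      NCFlat.resTmul (Hom.ringHom φ) (Hom.ringHom ψ) s r := by
  rw [coprod_inl_mul_inr]
  rfl

lemma pushoutRel_add (x y : R) :
    pushoutRel φ ψ (x + y) = pushoutRel φ ψ x + pushoutRel φ ψ y := by
  simp only [pushoutRel, map_add]
  abel

/-- For homogeneous x, moving φ(x) leftwards past an element r of R' turns r into r or into its
parity, and moving ψ(x) past r inside R' does the same. The two terms thus become sφ(x) ⊗ r' and s ⊗
ψ(x)r', which agree over R. -/
lemma coprodToTensor_mul_rel (c : coprod S R') (x : R) :
    coprodToTensor φ ψ (c * pushoutRel φ ψ x) = 0 := by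
  have key : ∀ i (x : R), x ∈ R.grading i →
      coprodToTensor φ ψ (c * pushoutRel φ ψ x) = 0 := by
    intro i x hx
    have hl := ringHom_mem (coprodInl S R') (ringHom_mem φ hx)
    have hr := ringHom_mem ψ hx
    refine coprod_induction c (by rw [zero_mul, map_zero]) (fun s r => ?_)
      (fun a b ha hb => by rw [add_mul, map_add, ha, hb, add_zero])
    obtain ⟨r', h1, h2⟩ : ∃ r', Hom.ringHom (coprodInr S R') r *
        Hom.ringHom (coprodInl S R') (Hom.ringHom φ x) =
        Hom.ringHom (coprodInl S R') (Hom.ringHom φ x) * Hom.ringHom (coprodInr S R') r' ∧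
        r * Hom.ringHom ψ x = Hom.ringHom ψ x * r' := by
      rcases zmod_two_cases i with rfl | rfl
      · exact ⟨r, ((coprod S R').even_comm _ hl _).symm, (R'.even_comm _ hr _).symm⟩
      · exact ⟨R'.parity r, by rw [ringHom_parity, odd_mul_parity hl], (odd_mul_parity hr r).symm⟩
    rw [pushoutRel, mul_sub, mul_assoc, h1, ← mul_assoc, ← map_mul, mul_assoc, ← map_mul, h2,
      map_sub, coprodToTensor_mul, coprodToTensor_mul, NCFlat.mul_resTmul, sub_self]
  rw [← proj_add_proj x, pushoutRel_add, mul_add, map_add, key 0 _ (R.proj_mem 0 x),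
    key 1 _ (R.proj_mem 1 x), add_zero]

lemma coprodToTensor_eq_zero (a : coprod S R') (ha : a ∈ pushoutIdeal φ ψ) :
    coprodToTensor φ ψ a = 0 := by
  have key : ∀ c, coprodToTensor φ ψ (c * a) = 0 := by
    induction ha using Submodule.span_induction with
    | mem x hx =>
      obtain ⟨r, rfl⟩ := hx
      exact fun c => coprodToTensor_mul_rel φ ψ c r
    | zero => intro c; rw [mul_zero, map_zero]
    | add x y _ _ hx hy => intro c; rw [mul_add, map_add, hx, hy, add_zero]
    | smul d x _ hx => intro c; rw [smul_eq_mul, ← mul_assoc]; exact hx _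
  simpa using key 1

/-- The pushout is the graded tensor product over K modulo the relations φ(r) ⊗ 1 = 1 ⊗ ψ(r).
Besides the universal property one needs its underlying group to be S ⊗_R R', since flatness is
expressed through that tensor product. -/
theorem exists_isPushout : ∃ (P : SAlg K) (u : S ⟶ P) (v : R' ⟶ P), IsPushout φ ψ u v := by
  let q := quotMk (coprod S R') (pushoutIdeal φ ψ) (parity_mem_pushoutIdeal φ ψ)
  have hq := quotMk_surjective (coprod S R') (pushoutIdeal φ ψ) (parity_mem_pushoutIdeal φ ψ)
  have hq0 : ∀ a, Hom.ringHom q a = 0 ↔ a ∈ pushoutIdeal φ ψ := fun a =>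
    quotMk_eq_zero (coprod S R') (pushoutIdeal φ ψ) (parity_mem_pushoutIdeal φ ψ)
  have hcomm : φ ≫ coprodInl S R' ≫ q = ψ ≫ coprodInr S R' ≫ q := by
    refine hom_ext fun r => ?_
    rw [← sub_eq_zero]
    simp only [ringHom_comp_apply, ← map_sub]
    exact (hq0 _).2 (Ideal.subset_span ⟨r, rfl⟩)
  refine ⟨_, coprodInl S R' ≫ q, coprodInr S R' ≫ q, hcomm, ⟨?_, ?_⟩, ?_⟩
  · set μ := NCFlat.mulMap (Hom.ringHom φ) (Hom.ringHom ψ) (Hom.ringHom (coprodInl S R' ≫ q))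
      (Hom.ringHom (coprodInr S R' ≫ q)) (ringHom_comp_eq hcomm)
    -- Every t has a representative a in the coproduct that maps to t in the tensor product and to μ
    -- t in the quotient. If μ t = 0, then a is in the ideal, which maps to zero in the tensor
    -- product, so t = 0.
    have hμ : ∀ t, ∃ a : coprod S R', Hom.ringHom q a = μ t ∧ coprodToTensor φ ψ a = t := by
      intro t
      refine NCFlat.res_induction t ⟨0, by simp, by simp⟩ (fun s r => ?_) (fun x y hx hy => ?_)
      · exact ⟨_, map_mul _ _ _, coprodToTensor_mul φ ψ s r⟩
      · obtain ⟨a, h1, h2⟩ := hx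
        obtain ⟨b, h3, h4⟩ := hy
        exact ⟨a + b, by rw [map_add, map_add, h1, h3], by rw [map_add, h2, h4]⟩
    rw [injective_iff_map_eq_zero]
    intro t ht
    obtain ⟨a, h1, h2⟩ := hμ t
    rw [ht, hq0] at h1
    rw [← h2, coprodToTensor_eq_zero φ ψ a h1]
  · intro p
    obtain ⟨a, rfl⟩ := hq p
    refine coprod_induction a ⟨0, by rw [map_zero, map_zero]⟩
      (fun s r => ⟨NCFlat.resTmul _ _ s r, ?_⟩) (fun x y hx hy => ?_)
    · rw [map_mul]
      rfl
    · obtain ⟨s, hs⟩ := hx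
      obtain ⟨t, ht⟩ := hy
      exact ⟨s + t, by rw [map_add, map_add, hs, ht]⟩
  · intro Q a b hab
    obtain ⟨h, h1, h2⟩ := exists_coprod_desc a b
    obtain ⟨g, hg⟩ := exists_factor_surjective q hq h (fun x hx => by
      replace hx := (hq0 x).1 hx
      induction hx using Submodule.span_induction with
      | mem x hx =>
        obtain ⟨r, rfl⟩ := hx
        rw [pushoutRel, map_sub, sub_eq_zero, ← ringHom_comp_apply (coprodInl S R') h,
          ← ringHom_comp_apply (coprodInr S R') h, h1, h2, ← ringHom_comp_apply,
          ← ringHom_comp_apply, hab]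
      | zero => rw [map_zero]
      | add x y _ _ hx hy => rw [map_add, hx, hy, add_zero]
      | smul c x _ hx => rw [smul_eq_mul, map_mul, hx, mul_zero])
    exact ⟨g, by rw [Category.assoc, hg, h1], by rw [Category.assoc, hg, h2]⟩

variable {φ ψ}
variable {P : SAlg K} {u : S ⟶ P} {v : R' ⟶ P}

lemma IsPushout.induction (h : IsPushout φ ψ u v) {p : P → Prop} (x : P) (zero : p 0)
    (mul : ∀ s r, p (Hom.ringHom u s * Hom.ringHom v r)) (add : ∀ x y, p x → p y → p (x + y)) :
    p x := by
  obtain ⟨t, rfl⟩ := h.bijective.surjective x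
  refine NCFlat.res_induction t (by rwa [map_zero]) mul (fun x y hx hy => ?_)
  rw [map_add]
  exact add _ _ hx hy

lemma IsPushout.hom_ext (h : IsPushout φ ψ u v) {Q : SAlg K} {f g : P ⟶ Q} (hu : u ≫ f = u ≫ g)
    (hv : v ≫ f = v ≫ g) : f = g := by
  refine SAlg.hom_ext fun x => ?_
  refine h.induction (p := fun x => Hom.ringHom f x = Hom.ringHom g x) x
    (by rw [map_zero, map_zero]) (fun s r => ?_) (fun x y hx hy => by rw [map_add, map_add, hx, hy])
  have h1 := congrArg (fun k => Hom.ringHom k s) hu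
  have h2 := congrArg (fun k => Hom.ringHom k r) hv
  simp only [ringHom_comp_apply] at h1 h2
  rw [map_mul, map_mul, h1, h2]

lemma IsPushout.flat (h : IsPushout φ ψ u v) (hψ : NCFlat.Flat (Hom.ringHom ψ)) :
    NCFlat.Flat (Hom.ringHom u) := hψ.baseChange _ h.bijective

lemma IsPushout.faithfullyFlat (h : IsPushout φ ψ u v)
    (hψ : NCFlat.FaithfullyFlat (Hom.ringHom ψ)) : NCFlat.FaithfullyFlat (Hom.ringHom u) :=
  hψ.baseChange _ h.bijective

/-- A commutative square inducing a bijection from the tensor product is a pushout. -/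
lemma IsPushout.of_bijective (comm : φ ≫ u = ψ ≫ v)
    (hb : Function.Bijective (NCFlat.mulMap (Hom.ringHom φ) (Hom.ringHom ψ) (Hom.ringHom u)
      (Hom.ringHom v) (ringHom_comp_eq comm))) : IsPushout φ ψ u v := by
  refine ⟨comm, hb, fun {Q} a b hab => ?_⟩
  obtain ⟨P₀, u₀, v₀, h₀⟩ := exists_isPushout φ ψ
  obtain ⟨f, hf1, hf2⟩ := h₀.exists_desc u v comm
  obtain ⟨g, hg1, hg2⟩ := h₀.exists_desc a b hab
  have hf : ∀ t, Hom.ringHom f (NCFlat.mulMap (Hom.ringHom φ) (Hom.ringHom ψ) (Hom.ringHom u₀)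
      (Hom.ringHom v₀) (ringHom_comp_eq h₀.comm) t) = NCFlat.mulMap (Hom.ringHom φ)
      (Hom.ringHom ψ) (Hom.ringHom u) (Hom.ringHom v) (ringHom_comp_eq comm) t := by
    intro t
    refine NCFlat.res_induction t (by simp) (fun s r => ?_)
      (fun x y hx hy => by rw [map_add, map_add, map_add, hx, hy])
    rw [NCFlat.mulMap_tmul, NCFlat.mulMap_tmul, map_mul, ← ringHom_comp_apply,
      ← ringHom_comp_apply, hf1, hf2]
  have hfs : Function.Surjective (Hom.ringHom f) := fun p => by
    obtain ⟨t, rfl⟩ := hb.surjective p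
    exact ⟨_, hf t⟩
  obtain ⟨k, hk⟩ := exists_factor_surjective f hfs g (fun x hx => by
    obtain ⟨t, rfl⟩ := h₀.bijective.surjective x
    rw [hf] at hx
    rw [hb.injective (hx.trans (map_zero _).symm), map_zero, map_zero])
  exact ⟨k, by rw [← hf1, Category.assoc, hk, hg1], by rw [← hf2, Category.assoc, hk, hg2]⟩

/-- The structure morphism from the base field. -/
def fromField (A : SAlg K) : ofComm (K := K) K ⟶ A :=
  homMk (A := ofComm K) (Algebra.ofId K A) (fun k => by
    refine (congrArg (Algebra.ofId K A) (parity_ofComm K k)).trans ?_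
    exact ((A.parity).commutes k).symm)

lemma fromField_comp {A B : SAlg K} (f : A ⟶ B) : fromField A ≫ f = fromField B :=
  SAlg.hom_ext fun k => ringHom_algebraMap f k

end Pushout

end SAlg

/-! ### Localization at an even element -/

namespace SAlg

open MulOpposite

variable {K : Type u} [Field K] [NeZero (2 : K)]

section Construction

variable (R : SAlg K) (f : R.even)

/-- The parity as a linear map over the even part. -/
def parityEven : R →ₗ[R.even] R where
  toFun := R.parity
  map_add' := map_add R.parity
  map_smul' a b := by
    rw [even_smul_def, map_mul, parity_even a.2, RingHom.id_apply, even_smul_def]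

/-- The localized ring. -/
abbrev LocRing : Type u := LocalizedModule (Submonoid.powers f) R

instance : Algebra K (LocRing R f) := Algebra.compHom (LocRing R f) (algebraMap K R.even)

/-- The parity of the localized ring. -/
def locParity : LocRing R f →ₗ[R.even] LocRing R f :=
  IsLocalizedModule.map (Submonoid.powers f) (LocalizedModule.mkLinearMap _ R) (LocalizedModule.mkLinearMap _ R) (parityEven R)

lemma locParity_mk (r : R) (s : Submonoid.powers f) :
    locParity R f (LocalizedModule.mk r s) = LocalizedModule.mk (R.parity r) s :=
  IsLocalizedModule.map_LocalizedModules _ (parityEven R) r s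

lemma loc_algebraMap (k : K) : algebraMap K (LocRing R f) k = LocalizedModule.mk (algebraMap K R k) 1 := rfl

lemma loc_one : (1 : LocRing R f) = LocalizedModule.mk 1 1 := by
  rw [OreLocalization.one_def]

/-- The parity of the localized ring as an algebra map. -/
def locParityHom : LocRing R f →ₐ[K] LocRing R f where
  toFun := locParity R f
  map_zero' := map_zero _
  map_add' := map_add _
  map_one' := by rw [loc_one, locParity_mk, map_one]
  map_mul' x y := by
    induction x, y using LocalizedModule.induction_on₂ with
    | _ a b s t => rw [LocalizedModule.mk_mul_mk, locParity_mk, locParity_mk, locParity_mk, LocalizedModule.mk_mul_mk, map_mul]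
  commutes' k := by rw [loc_algebraMap, locParity_mk, AlgHom.commutes]

lemma locParityHom_mk (r : R) (s : Submonoid.powers f) :
    locParityHom R f (LocalizedModule.mk r s) = LocalizedModule.mk (R.parity r) s := locParity_mk R f r s

lemma mk_add_same (a b : R) (s : Submonoid.powers f) :
    (LocalizedModule.mk (a + b) s : LocRing R f) = LocalizedModule.mk a s + LocalizedModule.mk b s := by
  rw [LocalizedModule.mk_add_mk, LocalizedModule.mk_eq]
  refine ⟨1, ?_⟩
  simp only [one_smul, Submonoid.smul_def, mul_smul, smul_add]

/-- The localization of a superalgebra at an even element. -/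
def loc : SAlg K :=
  ofInvolution (LocRing R f) (locParityHom R f)
    (by
      intro x
      induction x using LocalizedModule.induction_on with
      | _ a s => rw [locParityHom_mk, locParityHom_mk, parity_parity])
    (by
      intro x y
      induction x, y using LocalizedModule.induction_on₂ with
      | _ a b s t =>
        rw [locParityHom_mk, locParityHom_mk, two_mul, LocalizedModule.mk_mul_mk, LocalizedModule.mk_mul_mk, LocalizedModule.mk_mul_mk, LocalizedModule.mk_mul_mk,
          LocalizedModule.mk_mul_mk, mul_comm t s, ← mk_add_same, ← mk_add_same, ← mk_add_same, ← two_mul,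
          supercomm, sub_eq_add_neg, mk_add_same, LocalizedModule.mk_neg, sub_eq_add_neg])

lemma parity_loc (x : LocRing R f) : (loc R f).parity x = locParityHom R f x :=
  parity_ofInvolution _ _ x

/-- The localization map. -/
def locMap : R ⟶ loc R f :=
  homMk (B := loc R f)
    { toFun := fun r => (LocalizedModule.mk r 1 : LocRing R f)
      map_zero' := map_zero (LocalizedModule.mkLinearMap (Submonoid.powers f) R)
      map_add' := map_add (LocalizedModule.mkLinearMap (Submonoid.powers f) R)
      map_one' := (loc_one R f).symm
      map_mul' := fun a b => by
        refine Eq.trans ?_ (LocalizedModule.mk_mul_mk (S := Submonoid.powers f)).symm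
        rw [one_mul]
      commutes' := fun _ => rfl }
    (fun a => ((parity_loc R f _).trans (locParityHom_mk R f a 1)).symm)

lemma isLocalizationAway_locMap : IsLocalizationAway (locMap R f) (f : R) where
  isUnit := by
    have hf : f ∈ Submonoid.powers f := Submonoid.mem_powers f
    have h : ∀ a : LocRing R f, a = LocalizedModule.mk (f : R) ⟨f, hf⟩ → a = 1 := by
      rintro _ rfl
      rw [loc_one, LocalizedModule.mk_eq]
      refine ⟨1, ?_⟩
      simp only [one_smul, Submonoid.smul_def, even_smul_def, mul_one]
    refine ⟨⟨(LocalizedModule.mk (f : R) 1 : LocRing R f), (LocalizedModule.mk 1 ⟨f, hf⟩ : LocRing R f), ?_, ?_⟩, rfl⟩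
    · exact h _ ((LocalizedModule.mk_mul_mk (S := Submonoid.powers f)).trans (by rw [one_mul, mul_one]))
    · exact h _ ((LocalizedModule.mk_mul_mk (S := Submonoid.powers f)).trans (by rw [mul_one, one_mul]))
  surj s := by
    induction (show LocRing R f from s) using LocalizedModule.induction_on with
    | _ r t =>
      obtain ⟨t, n, rfl⟩ := t
      refine ⟨n, r, ?_⟩
      rw [← map_pow]
      refine (LocalizedModule.mk_mul_mk (S := Submonoid.powers f)).trans (LocalizedModule.mk_eq.2 ⟨1, ?_⟩)
      simp only [one_smul, Submonoid.smul_def, even_smul_def, one_mul]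
      rfl
  eq_zero r hr := by
    have h : (LocalizedModule.mk r 1 : LocRing R f) = LocalizedModule.mk 0 1 := hr.trans (LocalizedModule.zero_mk _).symm
    obtain ⟨⟨_, n, rfl⟩, h⟩ := LocalizedModule.mk_eq.1 h
    refine ⟨n, ?_⟩
    simp only [one_smul, Submonoid.smul_def, even_smul_def, smul_zero] at h
    exact h

/-- A right module over a superalgebra as a module over the even part. -/
abbrev evenModule (N : Type u) [AddCommGroup N] [Module (R : Type u)ᵐᵒᵖ N] : Module R.even N :=
  Module.compHom N (RingHom.toOpposite R.even.val.toRingHom (fun a b => R.even_comm a a.2 b))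

/-- The tensor product N ⊗_R R_f maps to the localization N_f of N over the commutative ring R₀, by
n ⊗ r/s ↦ nr/s. So n ⊗ 1 = 0 forces n/1 = 0, and the usual criterion in N_f applies. -/
lemma exists_smul_eq_zero_of_unit_loc (N : Type u) [AddCommGroup N] [Module (R : Type u)ᵐᵒᵖ N]
    (n : N) (h : NCFlat.tmul (Hom.ringHom (locMap R f)) n 1 = 0) :
    ∃ k : ℕ, op ((f : R) ^ k) • n = 0 := by
  let _ := evenModule R N
  have hsm : ∀ (a : R.even) (n : N), a • n = op (a : R) • n := fun _ _ => rfl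
  let o : N → R →ₗ[R.even] N := fun n =>
    { toFun := fun r => op r • n
      map_add' := fun a b => by rw [MulOpposite.op_add, add_smul]
      map_smul' := fun a b => by
        rw [even_smul_def, R.even_comm a a.2, op_mul, mul_smul, hsm, RingHom.id_apply] }
  let M := Submonoid.powers f
  let L : N → (LocRing R f →ₗ[R.even] LocalizedModule M N) := fun n =>
    IsLocalizedModule.map M (LocalizedModule.mkLinearMap _ R) (LocalizedModule.mkLinearMap _ N) (o n)
  have hL : ∀ n r s, L n (LocalizedModule.mk r s) = LocalizedModule.mk (op r • n) s := fun n r s =>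
    IsLocalizedModule.map_LocalizedModules _ (o n) r s
  have hadd : ∀ (a b : N) (s : M), (LocalizedModule.mk (a + b) s : LocalizedModule M N) = LocalizedModule.mk a s + LocalizedModule.mk b s := by
    intro a b s
    rw [LocalizedModule.mk_add_mk, LocalizedModule.mk_eq]
    refine ⟨1, ?_⟩
    simp only [one_smul, Submonoid.smul_def, mul_smul, smul_add]
  let F : N →+ (loc R f) →+ LocalizedModule M N :=
    { toFun := fun n => (L n).toAddMonoidHom
      map_zero' := by
        ext x
        change L 0 x = 0
        induction (show LocRing R f from x) using LocalizedModule.induction_on with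
        | _ r t => rw [hL, smul_zero, LocalizedModule.zero_mk]
      map_add' := fun n m => by
        ext x
        change L (n + m) x = L n x + L m x
        induction (show LocRing R f from x) using LocalizedModule.induction_on with
        | _ r t => rw [hL, hL, hL, smul_add, hadd] }
  have h1 := congrArg (NCFlat.lift (Hom.ringHom (locMap R f)) F (fun n a x => by
    change L (op a • n) x = L n (Hom.ringHom (locMap R f) a * x)
    induction (show LocRing R f from x) using LocalizedModule.induction_on with
    | _ r t =>
      have : Hom.ringHom (locMap R f) a * (show loc R f from (LocalizedModule.mk r t : LocRing R f)) =
          (LocalizedModule.mk (a * r) t : LocRing R f) :=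
        (LocalizedModule.mk_mul_mk (S := Submonoid.powers f)).trans (by rw [one_mul])
      refine (hL _ _ _).trans (Eq.trans ?_ (congrArg (L n) this).symm)
      rw [hL, op_mul, mul_smul])) h
  rw [map_zero] at h1
  have h2 : L n (LocalizedModule.mk 1 1) = 0 := (congrArg (L n) (loc_one R f).symm).trans h1
  rw [hL, op_one, one_smul, ← LocalizedModule.zero_mk 1, LocalizedModule.mk_eq] at h2
  obtain ⟨⟨_, k, rfl⟩, h2⟩ := h2
  refine ⟨k, ?_⟩
  simp only [one_smul, Submonoid.smul_def, smul_zero] at h2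
  exact h2

lemma mul_pow_of_comm_inv {A : Type*} [Ring A] (u : Aˣ) (k : ℕ) :
    (u : A) ^ k * (↑u⁻¹ : A) ^ k = 1 := by
  rw [← Units.val_pow_eq_pow_val, ← Units.val_pow_eq_pow_val, inv_pow, Units.mul_inv]

/-- Up to a power of the unit f, each element of N ⊗ R_f has the form n ⊗ 1. If g n ⊗ 1 = 0, a power
of f kills g n, hence n by injectivity of g, and so n ⊗ 1 = 0. -/
lemma flat_locMap : NCFlat.Flat (Hom.ringHom (locMap R f)) := by
  intro N N' _ _ _ _ g hg
  refine (injective_iff_map_eq_zero _).2 fun t ht => ?_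
  obtain ⟨u, hu⟩ := (isLocalizationAway_locMap R f).isUnit
  have hc : ∀ (k : ℕ) (x : loc R f), Hom.ringHom (locMap R f) ((f : R) ^ k) * x =
      x * (u : loc R f) ^ k := fun k x => by
    exact ((loc R f).even_comm _ (ringHom_mem _ (f ^ k).2) x).trans
      (congrArg (x * ·) ((map_pow _ _ _).trans (congrArg (· ^ k) hu.symm)))
  have key : ∀ t : NCFlat.Tensor (Hom.ringHom (locMap R f)) N, ∃ (n : N) (k : ℕ),
      op ((u : loc R f) ^ k) • t = NCFlat.tmul (Hom.ringHom (locMap R f)) n 1 := by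
    intro t
    induction t using NCFlat.tensor_induction with
    | zero => exact ⟨0, 0, by rw [NCFlat.zero_tmul, smul_zero]⟩
    | tmul n s =>
      obtain ⟨k, r, hr⟩ := (isLocalizationAway_locMap R f).surj s
      refine ⟨op r • n, k, ?_⟩
      rw [NCFlat.op_smul_tmul, NCFlat.smul_tmul, ← hc, mul_one, map_pow]
      exact congrArg _ hr
    | add x y hx hy =>
      obtain ⟨n, k, hx⟩ := hx
      obtain ⟨m, l, hy⟩ := hy
      have e : ∀ (n : N) (k : ℕ), op ((u : loc R f) ^ k) •
          NCFlat.tmul (Hom.ringHom (locMap R f)) n 1 =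
          NCFlat.tmul (Hom.ringHom (locMap R f)) (op ((f : R) ^ k) • n) 1 := fun n k => by
        rw [NCFlat.op_smul_tmul, NCFlat.smul_tmul, hc]
      refine ⟨op ((f : R) ^ l) • n + op ((f : R) ^ k) • m, k + l, ?_⟩
      rw [smul_add, NCFlat.add_tmul, ← e, ← e, ← hx, ← hy, smul_smul, smul_smul, ← op_mul,
        ← op_mul, ← pow_add, ← pow_add, add_comm l k]
  obtain ⟨n, k, hk⟩ := key t
  have h1 : NCFlat.tmul (Hom.ringHom (locMap R f)) (g n) 1 = 0 := by
    rw [← NCFlat.map_tmul, ← hk]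
    exact ((NCFlat.mapₗ (Hom.ringHom (locMap R f)) g).map_smul _ t).trans
      ((congrArg _ ht).trans (smul_zero _))
  obtain ⟨l, hl⟩ := exists_smul_eq_zero_of_unit_loc R f N' (g n) h1
  rw [← map_smul] at hl
  have hl := hg (hl.trans (map_zero g).symm)
  have h2 : op ((u : loc R f) ^ l) • NCFlat.tmul (Hom.ringHom (locMap R f)) n 1 = 0 := by
    rw [NCFlat.op_smul_tmul, ← hc, ← NCFlat.smul_tmul, hl, NCFlat.zero_tmul]
  rw [← hk, smul_smul, ← op_mul, ← pow_add] at h2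
  have h3 : op ((↑u⁻¹ : loc R f) ^ (l + k)) • op ((u : loc R f) ^ (l + k)) • t = t := by
    rw [smul_smul, ← op_mul, mul_pow_of_comm_inv, op_one, one_smul]
  rw [← h3, add_comm, h2, smul_zero]

end Construction

section Universal

variable {R S T : SAlg K} {φ : R ⟶ S} {f : R.even} (hφ : IsLocalizationAway φ (f : R))

include hφ

/-- The value at s is the unique t with h(f)^n t = h(r) whenever φ(f)^n s = φ(r). It is independent
of (n, r) because elements killed by φ are f-power torsion; every compatibility is checked by
clearing denominators. -/
lemma IsLocalizationAway.exists_desc (h : R ⟶ T) (hf : IsUnit (Hom.ringHom h f)) :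
    ∃ g : S ⟶ T, φ ≫ g = h := by
  have hcomm : ∀ (n : ℕ) (t : T), Hom.ringHom h f ^ n * t = t * Hom.ringHom h f ^ n := fun n t => by
    rw [← map_pow]
    exact T.even_comm _ (ringHom_mem h (f ^ n).2) t
  have hcomm' : ∀ (n : ℕ) (t : S), Hom.ringHom φ f ^ n * t = t * Hom.ringHom φ f ^ n := fun n t => by
    rw [← map_pow]
    exact S.even_comm _ (ringHom_mem φ (f ^ n).2) t
  have key : ∀ (s : S), ∃ t : T, ∀ (n : ℕ) (r : R), Hom.ringHom φ f ^ n * s = Hom.ringHom φ r →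
      Hom.ringHom h f ^ n * t = Hom.ringHom h r := by
    intro s
    obtain ⟨n, r, hr⟩ := hφ.surj s
    obtain ⟨t, ht⟩ : ∃ t, Hom.ringHom h f ^ n * t = Hom.ringHom h r := by
      obtain ⟨v, hv⟩ := hf.pow n
      exact ⟨↑v⁻¹ * Hom.ringHom h r, by rw [← hv, Units.mul_inv_cancel_left]⟩
    refine ⟨t, fun m r' hr' => ?_⟩
    have h1 : Hom.ringHom φ ((f : R) ^ m * r - (f : R) ^ n * r') = 0 := by
      rw [map_sub, map_mul, map_mul, map_pow, map_pow, ← hr, ← hr', ← mul_assoc, ← mul_assoc,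
        ← pow_add, ← pow_add, add_comm, sub_self]
    obtain ⟨k, hk⟩ := hφ.eq_zero _ h1
    have h2 := congrArg (Hom.ringHom h) hk
    rw [map_mul, map_pow, map_zero, map_sub, map_mul, map_mul, map_pow, map_pow] at h2
    have h3 := (hf.pow k).mul_left_cancel (h2.trans (mul_zero _).symm)
    refine (hf.pow n).mul_left_cancel ?_
    rw [sub_eq_zero.1 h3 |>.symm, ← ht, ← mul_assoc, ← mul_assoc, ← pow_add, ← pow_add, add_comm]
  choose g hg using key
  have gspec : ∀ s t (n : ℕ) r, Hom.ringHom φ f ^ n * s = Hom.ringHom φ r →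
      Hom.ringHom h f ^ n * t = Hom.ringHom h r → g s = t := fun s t n r h1 h2 =>
    (hf.pow n).mul_left_cancel ((hg s n r h1).trans h2.symm)
  refine ⟨homMk (A := S) (B := T)
    { toFun := g
      map_one' := gspec _ _ 0 1 (by simp) (by simp)
      map_zero' := gspec _ _ 0 0 (by simp) (by simp)
      map_add' := fun a b => by
        obtain ⟨n, r, hr⟩ := hφ.surj a
        obtain ⟨m, s, hs⟩ := hφ.surj b
        refine gspec _ _ (n + m) ((f : R) ^ m * r + (f : R) ^ n * s) ?_ ?_
        · rw [map_add, map_mul, map_mul, map_pow, map_pow, ← hr, ← hs, mul_add,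
            ← mul_assoc, ← mul_assoc, ← pow_add, ← pow_add, add_comm m n]
        · rw [map_add, map_mul, map_mul, map_pow, map_pow, ← hg a n r hr, ← hg b m s hs, mul_add,
            ← mul_assoc, ← mul_assoc, ← pow_add, ← pow_add, add_comm m n]
      map_mul' := fun a b => by
        obtain ⟨n, r, hr⟩ := hφ.surj a
        obtain ⟨m, s, hs⟩ := hφ.surj b
        refine gspec _ _ (n + m) (r * s) ?_ ?_
        · rw [map_mul, ← hr, ← hs, pow_add, mul_assoc, mul_assoc, ← mul_assoc _ a, hcomm' m a,
            mul_assoc]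
        · rw [map_mul, ← hg a n r hr, ← hg b m s hs, pow_add, mul_assoc, mul_assoc,
            ← mul_assoc _ (g a), hcomm m (g a), mul_assoc]
      commutes' := fun k => gspec _ _ 0 (algebraMap K R k) (by simp) (by simp) }
    (fun a => by
      obtain ⟨n, r, hr⟩ := hφ.surj a
      refine gspec _ _ n (R.parity r) ?_ ?_
      · rw [ringHom_parity, ← hr, map_mul, map_pow, parity_even (ringHom_mem φ f.2)]
      · change _ * T.parity (g a) = _
        rw [ringHom_parity, ← hg a n r hr, map_mul, map_pow, parity_even (ringHom_mem h f.2)]),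
    SAlg.hom_ext fun r => gspec _ _ 0 r (by simp; rfl) (by rw [pow_zero, one_mul])⟩

end Universal

/-- An element of a module over a superalgebra vanishes if it does locally. -/
lemma eq_zero_of_local {R : SAlg K} {ι : Type*} {f : ι → R.even}
    (hf : Ideal.span (Set.range f) = ⊤) {N : Type*} [AddCommGroup N] [Module R.even N] {x : N}
    (h : ∀ i, ∃ n : ℕ, f i ^ n • x = 0) : x = 0 := by
  choose n hn using h
  -- The annihilator of x contains a power of each f i, and such powers still generate the unit
  -- ideal. The exponent is indexed by the values of f, hence the choice of an index for each value.
  have h1 := Ideal.span_range_pow_eq_top (Set.range f) hf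
    (fun s => n (Classical.choose s.2))
  have h2 : Ideal.span (Set.range fun s : Set.range f => (s : R.even) ^
      n (Classical.choose s.2)) ≤ LinearMap.ker (LinearMap.toSpanSingleton R.even N x) := by
    rw [Ideal.span_le]
    rintro _ ⟨s, rfl⟩
    have := hn (Classical.choose s.2)
    rw [Classical.choose_spec s.2] at this
    exact this
  rw [h1] at h2
  have h3 := h2 (Submodule.mem_top (x := 1))
  simpa using h3

end SAlg

/-! ### Faithful flatness over fields -/

namespace NCFlat

open MulOpposite

/-- A nonzero n in N gives an embedding k → N, hence an injection of k ⊗ B = B into N ⊗ B; so N ⊗ B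
= 0 would force 1 = 0 in B. -/
lemma faithfullyFlat_of_field {k B : Type u} [Field k] [Ring B] [Nontrivial B] (φ : k →+* B) :
    FaithfullyFlat φ := by
  refine ⟨flat_of_field φ, fun N _ _ h => ?_⟩
  by_contra hN
  rw [not_subsingleton_iff_nontrivial] at hN
  obtain ⟨n, hn⟩ := exists_ne (0 : N)
  have hn' : Function.Injective (orbitMap (S := k) n) := by
    refine (injective_iff_map_eq_zero _).2 fun a ha => ?_
    by_contra ha0
    apply hn
    have : op a⁻¹ • op a • n = op a⁻¹ • (0 : N) := congrArg (op a⁻¹ • ·) ha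
    rwa [smul_smul, ← op_mul, mul_inv_cancel₀ ha0, op_one, one_smul, smul_zero] at this
  have h1 := flat_of_field φ _ _ _ hn'
  have h2 : tmul φ (N := k) 1 1 = 0 := h1 (Subsingleton.elim _ _)
  have h3 := congrArg (lift φ (N := k)
    ((AddMonoidHom.mul (R := B)).comp φ.toAddMonoidHom) (fun n a b => by
      change φ (n * a) * b = φ n * (φ a * b)
      rw [map_mul, mul_assoc])) h2
  rw [lift_tmul, map_zero] at h3
  change φ 1 * 1 = 0 at h3
  rw [map_one, mul_one] at h3
  exact one_ne_zero h3

end NCFlat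

/-! ### Spectra of even parts: residue fields, going down, descent of open sets -/

namespace SAlg

open MulOpposite

variable {K : Type u} [Field K]

/-- The map on spectra of even parts. -/
def specMap {R S : SAlg K} (h : R ⟶ S) : PrimeSpectrum S.even → PrimeSpectrum R.even :=
  PrimeSpectrum.comap (Hom.even h).toRingHom

lemma mem_specMap {R S : SAlg K} (h : R ⟶ S) (q : PrimeSpectrum S.even) (a : R.even) :
    a ∈ (specMap h q).asIdeal ↔ Hom.even h a ∈ q.asIdeal := Iff.rfl

lemma specMap_comp {R S T : SAlg K} (g : R ⟶ S) (h : S ⟶ T) (q : PrimeSpectrum T.even) :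
    specMap (g ≫ h) q = specMap g (specMap h q) := rfl

variable [NeZero (2 : K)]

/-- The residue field as a superalgebra. -/
def resField {R : SAlg K} (q : PrimeSpectrum R.even) : SAlg K :=
  ofComm (K := K) q.asIdeal.ResidueField

/-- The map to the residue field. -/
def resMap {R : SAlg K} (q : PrimeSpectrum R.even) : R ⟶ resField q :=
  toComm (IsScalarTower.toAlgHom K R.even q.asIdeal.ResidueField)

lemma resMap_coe {R : SAlg K} (q : PrimeSpectrum R.even) (a : R.even) :
    Hom.ringHom (resMap q) (a : R) = algebraMap R.even q.asIdeal.ResidueField a :=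
  toComm_coe _ a

lemma resMap_eq_zero {R : SAlg K} (q : PrimeSpectrum R.even) (a : R.even) :
    Hom.ringHom (resMap q) (a : R) = 0 ↔ a ∈ q.asIdeal :=
  (Eq.congr_left (resMap_coe q a)).trans Ideal.algebraMap_residueField_eq_zero

lemma isFieldExtension_resField {R : SAlg K} (q : PrimeSpectrum R.even) :
    (resField q).IsFieldExtension := isFieldExtension_ofComm _

lemma asIdeal_eq_bot_of_isFieldExtension {L : SAlg K} (hL : L.IsFieldExtension)
    (x : PrimeSpectrum L.even) : x.asIdeal = ⊥ := by
  rw [eq_bot_iff]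
  intro a ha
  by_contra h
  have h0 : (a : L) ≠ 0 := fun e => h (Subtype.ext e)
  obtain ⟨b, hb⟩ := hL.1.mul_inv_cancel h0
  refine x.2.ne_top ((Ideal.eq_top_iff_one _).2 ?_)
  have hb' : b ∈ L.grading 0 := by
    have := L.proj_mem 1 b
    rw [hL.2, Submodule.mem_bot] at this
    rw [← proj_add_proj b, this, add_zero]
    exact L.proj_mem 0 b
  have : (1 : L.even) = a * ⟨b, hb'⟩ := Subtype.ext hb.symm
  rw [this]
  exact Ideal.mul_mem_right _ _ ha

lemma eq_of_isFieldExtension {L : SAlg K} (hL : L.IsFieldExtension)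
    (x y : PrimeSpectrum L.even) : x = y :=
  PrimeSpectrum.ext ((asIdeal_eq_bot_of_isFieldExtension hL x).trans
    (asIdeal_eq_bot_of_isFieldExtension hL y).symm)

lemma nontrivial_even (A : SAlg K) [Nontrivial A] : Nontrivial A.even :=
  ⟨⟨0, 1, fun h => zero_ne_one (congrArg (Subtype.val) h)⟩⟩

lemma exists_prime (A : SAlg K) [Nontrivial A] : Nonempty (PrimeSpectrum A.even) :=
  have := A.nontrivial_even
  inferInstance

lemma IsFieldExtension.exists_prime {L : SAlg K} (hL : L.IsFieldExtension) :
    Nonempty (PrimeSpectrum L.even) :=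
  have : Nontrivial L := ⟨hL.1.exists_pair_ne⟩
  L.exists_prime

lemma specMap_resMap {R : SAlg K} (q : PrimeSpectrum R.even)
    (x : PrimeSpectrum (resField q).even) : specMap (resMap q) x = q := by
  refine PrimeSpectrum.ext (Ideal.ext fun a => ?_)
  rw [mem_specMap, asIdeal_eq_bot_of_isFieldExtension (isFieldExtension_resField q) x,
    Ideal.mem_bot, ← resMap_eq_zero]
  exact Subtype.ext_iff

lemma exists_resField_hom {R S : SAlg K} (φ : R ⟶ S) {p : PrimeSpectrum R.even}
    {q : PrimeSpectrum S.even} (h : specMap φ q = p) :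
    ∃ k : resField p ⟶ resField q, resMap p ≫ k = φ ≫ resMap q := by
  subst h
  let f : (specMap φ q).asIdeal.ResidueField →ₐ[K] q.asIdeal.ResidueField :=
    Ideal.ResidueField.mapₐ (specMap φ q).asIdeal q.asIdeal (Hom.even φ) rfl
  refine ⟨homMk (A := resField (specMap φ q)) (B := resField q) f (fun a => ?_),
    SAlg.hom_ext fun a => ?_⟩
  · exact (congrArg f (parity_ofComm (specMap φ q).asIdeal.ResidueField a)).trans
      (parity_ofComm q.asIdeal.ResidueField (f a)).symm
  · refine (Ideal.ResidueField.map_algebraMap _ _ _ _ (R.evenProj a)).trans ?_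
    rw [ringHom_comp_apply]
    refine congrArg (algebraMap S.even q.asIdeal.ResidueField) (Subtype.ext ?_)
    exact ringHom_proj φ 0 a

lemma nontrivial_of_faithfullyFlat {R S : SAlg K} [hR : Nontrivial R] {φ : R ⟶ S}
    (hφ : NCFlat.FaithfullyFlat (Hom.ringHom φ)) : Nontrivial S := by
  obtain ⟨a, b, h⟩ := hR.exists_pair_ne
  exact ⟨_, _, fun e => h (hφ.injective e)⟩

instance {R : SAlg K} (q : PrimeSpectrum R.even) : Nontrivial (resField q) :=
  inferInstanceAs (Nontrivial q.asIdeal.ResidueField)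

lemma faithfullyFlat_of_resField {R S : SAlg K} (q : PrimeSpectrum R.even) [Nontrivial S]
    (k : resField q ⟶ S) : NCFlat.FaithfullyFlat (Hom.ringHom k) :=
  NCFlat.faithfullyFlat_of_field (k := q.asIdeal.ResidueField) (Hom.ringHom k)

/-- Two points of spectra over the same point have residue fields with a common extension. -/
lemma exists_common_extension {R S T : SAlg K} (φ : R ⟶ S) (ψ : R ⟶ T)
    (q : PrimeSpectrum S.even) (q' : PrimeSpectrum T.even) (h : specMap φ q = specMap ψ q') :
    ∃ (L : SAlg K) (u : S ⟶ L) (v : T ⟶ L) (x : PrimeSpectrum L.even),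
      φ ≫ u = ψ ≫ v ∧ specMap u x = q ∧ specMap v x = q' := by
  obtain ⟨k, hk⟩ := exists_resField_hom φ h
  obtain ⟨k', hk'⟩ := exists_resField_hom ψ (rfl : specMap ψ q' = _)
  -- The tensor product of two residue fields over a third need not be a field, but it is nonzero by
  -- faithful flatness over a field, and any point of its spectrum lies over both given points.
  obtain ⟨P, u, v, hP⟩ := exists_isPushout k k'
  have : Nontrivial P :=
    nontrivial_of_faithfullyFlat (hP.faithfullyFlat (faithfullyFlat_of_resField _ k'))
  obtain ⟨x⟩ := P.exists_prime
  refine ⟨P, resMap q ≫ u, resMap q' ≫ v, x, ?_, ?_, ?_⟩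
  · rw [← Category.assoc, ← hk, Category.assoc, hP.comm, ← Category.assoc, hk', Category.assoc]
  · rw [specMap_comp, specMap_resMap]
  · rw [specMap_comp, specMap_resMap]

/-- The fibre of S over the residue field of p is nonzero, being faithfully flat over that field;
any of its points gives a point over p. -/
lemma specMap_surjective {R S : SAlg K} {φ : R ⟶ S}
    (hφ : NCFlat.FaithfullyFlat (Hom.ringHom φ)) : Function.Surjective (specMap φ) := by
  intro p
  obtain ⟨P, u, v, hP⟩ := exists_isPushout (resMap p) φ
  have : Nontrivial P := nontrivial_of_faithfullyFlat (hP.faithfullyFlat hφ)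
  obtain ⟨x⟩ := P.exists_prime
  refine ⟨specMap v x, ?_⟩
  rw [← specMap_comp, ← hP.comm, specMap_comp, specMap_resMap]

/-- Going down for flat morphisms. -/
lemma exists_le_specMap_eq {R S : SAlg K} {φ : R ⟶ S} (hφ : NCFlat.Flat (Hom.ringHom φ))
    (p : PrimeSpectrum R.even) (q : PrimeSpectrum S.even) (hp : p ≤ specMap φ q) :
    ∃ q' ≤ q, specMap φ q' = p := by
  let D := R.even ⧸ p.asIdeal
  let π : R ⟶ ofComm (K := K) D := toComm (Ideal.Quotient.mkₐ K p.asIdeal)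
  have hπ : ∀ a : R.even, Hom.ringHom π (a : R) = Ideal.Quotient.mk p.asIdeal a := toComm_coe _
  let j : D →ₐ[K] q.asIdeal.ResidueField :=
    Ideal.Quotient.liftₐ p.asIdeal
      ((IsScalarTower.toAlgHom K S.even q.asIdeal.ResidueField).comp (Hom.even φ))
      (fun a ha => Ideal.algebraMap_residueField_eq_zero.2 (hp ha))
  let ι : ofComm (K := K) D ⟶ resField q :=
    homMk (A := ofComm (K := K) D) (B := resField q) j (fun a =>
      (congrArg j (parity_ofComm D a)).trans (parity_ofComm q.asIdeal.ResidueField (j a)).symm)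
  have hι : π ≫ ι = φ ≫ resMap q := by
    refine SAlg.hom_ext fun a => ?_
    rw [ringHom_comp_apply]
    refine congrArg (algebraMap S.even q.asIdeal.ResidueField) (Subtype.ext ?_)
    exact (ringHom_proj φ 0 a)
  let t : S → NCFlat.Tensor (Hom.ringHom φ) (NCFlat.Res (Hom.ringHom π) (ofComm (K := K) D)) :=
    fun s => NCFlat.resTmul (Hom.ringHom π) (Hom.ringHom φ) 1 s
  -- Multiplication by a on D = R₀/p is injective, hence so is its base change to D ⊗_R S by
  -- flatness. If sφ(a) lies in pS₀, then 1 ⊗ sφ(a) = 0, so 1 ⊗ s = 0; mapping to the residue field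
  -- at q gives s ∈ q.
  have key : ∀ (s : S.even) (a : R.even), s ∉ q.asIdeal → a ∉ p.asIdeal →
      s * Hom.even φ a ∉ p.asIdeal.map (Hom.even φ) := by
    intro s a hs ha hmem
    have ht0 : ∀ b ∈ p.asIdeal.map (Hom.even φ), t (b : S) = 0 := by
      intro b hb
      induction hb using Submodule.span_induction with
      | mem x hx =>
        obtain ⟨r, hr, rfl⟩ := hx
        have h1 := NCFlat.mul_resTmul (Hom.ringHom π) (Hom.ringHom φ) 1 (r : R) 1
        rw [mul_one, one_mul, hπ, Ideal.Quotient.eq_zero_iff_mem.2 hr] at h1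
        exact h1.symm.trans (NCFlat.zero_resTmul _ _ _)
      | zero => exact map_zero (NCFlat.resTmulHom (Hom.ringHom π) (Hom.ringHom φ) 1)
      | add x y _ _ hx hy =>
        exact (map_add (NCFlat.resTmulHom (Hom.ringHom π) (Hom.ringHom φ) 1) _ _).trans
          ((congrArg₂ _ hx hy).trans (add_zero _))
      | smul c x _ hx =>
        have h1 := congrArg (op (c : S) • ·) hx
        simp only [smul_zero] at h1
        refine Eq.trans ?_ h1
        refine Eq.trans ?_ (NCFlat.op_smul_tmul _ _ _ _).symm
        exact congrArg t (S.even_comm _ c.2 _)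
    have h0 := ht0 _ hmem
    let m : NCFlat.Res (Hom.ringHom π) (ofComm (K := K) D) →ₗ[(R : Type u)ᵐᵒᵖ]
        NCFlat.Res (Hom.ringHom π) (ofComm (K := K) D) :=
      { toFun := fun d => (show D from Ideal.Quotient.mk p.asIdeal a * (show D from d))
        map_add' := fun x y => mul_add (R := D) _ x y
        map_smul' := fun x y => (mul_assoc (G := D) _ y _).symm }
    have hm : Function.Injective m := fun x y hxy => by
      have h2 : (Ideal.Quotient.mk p.asIdeal a : D) ≠ 0 := fun h =>
        ha (Ideal.Quotient.eq_zero_iff_mem.1 h)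
      exact mul_left_cancel₀ (M₀ := D) h2 hxy
    have h1 := hφ _ _ m hm
    have h2 : NCFlat.map (Hom.ringHom φ) m (t s) = t ((s * Hom.even φ a : S.even) : S) := by
      refine (NCFlat.map_tmul _ _ _ _).trans ?_
      have h3 := NCFlat.mul_resTmul (Hom.ringHom π) (Hom.ringHom φ) 1 (a : R) s
      rw [one_mul] at h3
      refine Eq.trans ?_ (h3.trans (congrArg t ?_))
      · refine congrArg (fun d : D => NCFlat.resTmul (Hom.ringHom π) (Hom.ringHom φ)
          (show ofComm (K := K) D from d) (s : S)) ?_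
        exact (mul_one (M := D) _).trans (hπ a).symm
      · exact S.even_comm _ (ringHom_mem φ a.2) _
    have h3 : t s = 0 := h1 ((h2.trans h0).trans (map_zero _).symm)
    have h4 := congrArg (NCFlat.mulMap (Hom.ringHom π) (Hom.ringHom φ) (Hom.ringHom ι)
      (Hom.ringHom (resMap q)) (ringHom_comp_eq hι)) h3
    rw [map_zero] at h4
    have h5 : Hom.ringHom ι 1 * Hom.ringHom (resMap q) s = 0 := h4
    rw [map_one, one_mul] at h5
    exact hs ((resMap_eq_zero q s).1 h5)
  -- A prime containing pS₀ and disjoint from both S₀ ∖ q and φ(R₀ ∖ p) is exactly a prime q' ≤ q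
  -- lying over p.
  let M : Submonoid S.even := q.asIdeal.primeCompl ⊔ p.asIdeal.primeCompl.map (Hom.even φ)
  obtain ⟨q', hq', h1, h2⟩ := Ideal.exists_le_prime_disjoint (p.asIdeal.map (Hom.even φ)) M (by
    rw [Set.disjoint_left]
    rintro x hx hM
    obtain ⟨s, hs, _, ⟨a, ha, rfl⟩, rfl⟩ := Submonoid.mem_sup.1 hM
    exact key s a hs ha hx)
  rw [Set.disjoint_left] at h2
  refine ⟨⟨q', hq'⟩, fun s hs => ?_, PrimeSpectrum.ext (le_antisymm (fun a ha => ?_) ?_)⟩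
  · by_contra h
    exact h2 hs (Submonoid.mem_sup_left h)
  · by_contra h
    exact h2 ha (Submonoid.mem_sup_right ⟨a, h, rfl⟩)
  · exact fun a ha => h1 (Ideal.mem_map_of_mem _ ha)

/-- Saturated open sets descend along faithfully flat morphisms. -/
lemma exists_isOpen_preimage {R S : SAlg K} {φ : R ⟶ S}
    (hφ : NCFlat.FaithfullyFlat (Hom.ringHom φ)) {W : Set (PrimeSpectrum S.even)} (hW : IsOpen W)
    (hs : ∀ q q', specMap φ q = specMap φ q' → q ∈ W → q' ∈ W) :
    ∃ V : Set (PrimeSpectrum R.even), IsOpen V ∧ W = specMap φ ⁻¹' V := by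
  refine ⟨(specMap φ '' Wᶜ)ᶜ, ?_, ?_⟩
  · rw [isOpen_compl_iff]
    -- For maps of spectra, the image of a closed set is closed once stable under specialization.
    -- Given q₁ over a specialization of the image of q ∉ W, going down yields q' ≤ q₁ over the
    -- image of q; if q₁ were in W, so would be q' (W is open), and then q by saturation.
    refine PrimeSpectrum.isClosed_image_of_stableUnderSpecialization _ _ hW.isClosed_compl ?_
    rintro p p₁ hp ⟨q, hq, rfl⟩
    obtain ⟨q₁, rfl⟩ := specMap_surjective hφ p₁
    obtain ⟨q', hle, hq'⟩ := exists_le_specMap_eq hφ.1 _ q₁ ((PrimeSpectrum.le_iff_specializes _ _).2 hp)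
    refine ⟨q₁, fun h => hq (hs q' q hq' ?_), rfl⟩
    exact ((PrimeSpectrum.le_iff_specializes _ _).1 hle).mem_open hW h
  · ext q
    constructor
    · rintro hq ⟨q', hq', h⟩
      exact hq' (hs q q' h.symm hq)
    · intro hq
      by_contra h
      exact hq ⟨q, h, rfl⟩

end SAlg

/-! ### Even parts of superideals and coverings by basic open sets -/

namespace SAlg

variable {K : Type u} [Field K] [NeZero (2 : K)]

/-- The even part of an ideal. -/
def evenIdeal {R : SAlg K} (I : Ideal R) : Ideal R.even := I.comap R.even.val.toRingHom

lemma IsSuperideal.proj_mem {R : SAlg K} {I : Ideal R} (hI : R.IsSuperideal I) (i : ZMod 2)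
    {a : R} (ha : a ∈ I) : R.proj i a ∈ I := hI i ha

/-- Odd elements die in every residue field, so a superideal and its even part are contained in the
same primes. Open subfunctors can thus be studied on the spectrum of the even part. -/
lemma map_eq_top_iff_even {R S : SAlg K} {I : Ideal R} (hI : R.IsSuperideal I) (h : R ⟶ S) :
    I.map (Hom.ringHom h) = ⊤ ↔ (evenIdeal I).map (Hom.even h) = ⊤ := by
  constructor
  · intro H
    by_contra hne
    obtain ⟨m, hm, hle⟩ := Ideal.exists_le_maximal _ hne
    let q : PrimeSpectrum S.even := ⟨m, hm.isPrime⟩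
    have h1 : I.map (Hom.ringHom h) ≤ RingHom.ker (Hom.ringHom (resMap q)) := by
      refine Ideal.span_le.2 ?_
      rintro _ ⟨a, ha, rfl⟩
      rw [SetLike.mem_coe, RingHom.mem_ker]
      refine congrArg (algebraMap S.even m.ResidueField) (Subtype.ext (ringHom_proj h 0 a).symm :
        S.evenProj (Hom.ringHom h a) = Hom.even h (R.evenProj a)) |>.trans ?_
      exact Ideal.algebraMap_residueField_eq_zero.2
        (hle (Ideal.mem_map_of_mem _ (hI.proj_mem 0 ha)))
    rw [H] at h1
    have h2 := h1 (Submodule.mem_top (x := 1))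
    rw [RingHom.mem_ker, map_one] at h2
    exact one_ne_zero h2
  · intro H
    have h1 : (evenIdeal I).map (Hom.even h) ≤ evenIdeal (I.map (Hom.ringHom h)) := by
      refine Ideal.map_le_iff_le_comap.2 fun a ha => ?_
      exact Ideal.mem_map_of_mem (Hom.ringHom h) ha
    rw [H] at h1
    exact (Ideal.eq_top_iff_one _).2 (h1 (Submodule.mem_top (x := 1)))

lemma map_even_eq_top_iff {R S : SAlg K} (I : Ideal R.even) (h : R ⟶ S) :
    I.map (Hom.even h) = ⊤ ↔ ∀ q : PrimeSpectrum S.even, ¬ I ≤ (specMap h q).asIdeal := by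
  constructor
  · intro H q hq
    refine q.2.ne_top (top_le_iff.1 (H ▸ Ideal.map_le_iff_le_comap.2 hq))
  · intro H
    by_contra hne
    obtain ⟨m, hm, hle⟩ := Ideal.exists_le_maximal _ hne
    exact H ⟨m, hm.isPrime⟩ (Ideal.map_le_iff_le_comap.1 hle)

lemma specMap_mem_basicOpen {R S : SAlg K} {h : R ⟶ S} {f : R.even}
    (hf : IsUnit (Hom.ringHom h f)) (q : PrimeSpectrum S.even) :
    specMap h q ∈ PrimeSpectrum.basicOpen f := fun hq => by
  have h1 := (resMap_eq_zero q (Hom.even h f)).2 hq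
  exact (hf.map (Hom.ringHom (resMap q))).ne_zero h1

lemma span_eq_top_iff {R : SAlg K} {ι : Type*} (f : ι → R.even) :
    Ideal.span (Set.range f) = ⊤ ↔
      ∀ q : PrimeSpectrum R.even, ∃ i, q ∈ PrimeSpectrum.basicOpen (f i) := by
  constructor
  · intro H q
    by_contra! hq
    refine q.2.ne_top (top_le_iff.1 (H ▸ Ideal.span_le.2 ?_))
    rintro _ ⟨i, rfl⟩
    exact not_not.1 (hq i)
  · intro H
    by_contra hne
    obtain ⟨m, hm, hle⟩ := Ideal.exists_le_maximal _ hne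
    obtain ⟨i, hi⟩ := H ⟨m, hm.isPrime⟩
    exact hi (hle (Ideal.subset_span ⟨i, rfl⟩))

lemma span_map_eq_top {R S : SAlg K} (h : R ⟶ S) {ι : Type*} {f : ι → R.even}
    (hf : Ideal.span (Set.range f) = ⊤) :
    Ideal.span (Set.range fun i => Hom.even h (f i)) = ⊤ := by
  rw [span_eq_top_iff] at hf ⊢
  exact fun q => hf (specMap h q)

lemma exists_fin_span_eq_top {R : SAlg K} {ι : Type*} {f : ι → R.even}
    (hf : Ideal.span (Set.range f) = ⊤) :
    ∃ (n : ℕ) (g : Fin n → ι), Ideal.span (Set.range fun i => f (g i)) = ⊤ := by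
  obtain ⟨s, hs, h⟩ := (Ideal.span_eq_top_iff_finite _).1 hf
  have hs' : ∀ a : s, ∃ i, f i = a := fun a => hs a.2
  choose g hg using hs'
  refine ⟨s.card, fun i => g (s.equivFin.symm i), ?_⟩
  rw [← h]
  congr 1
  ext a
  constructor
  · rintro ⟨i, rfl⟩
    change f (g (s.equivFin.symm i)) ∈ s
    rw [hg]
    exact (s.equivFin.symm i).2
  · intro ha
    exact ⟨s.equivFin ⟨a, ha⟩, by simp [hg]⟩

end SAlg

/-! ### Points of K-functors, descent for affine functors, open loci -/

namespace KFunctor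

open SAlg

variable {K : Type u} [Field K]

section Basic

variable {X Y Z : KFunctor K} {A B C R S T : SAlg K}

/-- The point of `SSp A` given by a morphism. -/
def SSp.mk (h : A ⟶ B) : (SSp A).obj B := ULift.up h

lemma SSp.hom_injective : Function.Injective (SSp.hom : (SSp A).obj B → (A ⟶ B)) :=
  ULift.down_injective

lemma map_comp_apply (X : KFunctor K) (f : A ⟶ B) (g : B ⟶ C) (x : X.obj A) :
    X.map (f ≫ g) x = X.map g (X.map f x) := by
  rw [X.map_comp]; rfl

lemma map_id_apply (X : KFunctor K) (x : X.obj A) : X.map (𝟙 A) x = x := by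
  rw [X.map_id]; rfl

lemma app_map (f : X ⟶ Y) (g : A ⟶ B) (x : X.obj A) :
    f.app B (X.map g x) = Y.map g (f.app A x) := NatTrans.naturality_apply f g x

/-- The morphism from an affine superscheme given by a point. -/
def ofPoint (z : X.obj R) : SSp R ⟶ X where
  app S := ↾fun x => X.map (SSp.hom x) z
  naturality S T g := by
    ext x
    exact map_comp_apply X (SSp.hom x) g z

lemma eq_ofPoint (f : SSp R ⟶ X) : f = ofPoint (f.app R (SSp.mk (𝟙 R))) := by
  ext S x
  exact app_map f (SSp.hom x) (SSp.mk (𝟙 R))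

/-- The coordinates of a point of an affine functor. -/
def coord (e : X ≅ SSp A) (x : X.obj R) : A ⟶ R := SSp.hom (e.hom.app R x)

/-- The point of an affine functor with given coordinates. -/
def ofCoord (e : X ≅ SSp A) (a : A ⟶ R) : X.obj R := e.inv.app R (SSp.mk a)

lemma coord_map (e : X ≅ SSp A) (g : R ⟶ S) (x : X.obj R) :
    coord e (X.map g x) = coord e x ≫ g :=
  congrArg SSp.hom (app_map e.hom g x)

lemma ofCoord_map (e : X ≅ SSp A) (g : R ⟶ S) (a : A ⟶ R) :
    X.map g (ofCoord e a) = ofCoord e (a ≫ g) :=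
  (app_map e.inv g (SSp.mk a)).symm

@[simp] lemma coord_ofCoord (e : X ≅ SSp A) (a : A ⟶ R) : coord e (ofCoord e a) = a := by
  have h := congrArg (fun k : SSp A ⟶ SSp A => k.app R (SSp.mk a)) e.inv_hom_id
  exact congrArg SSp.hom h

@[simp] lemma ofCoord_coord (e : X ≅ SSp A) (x : X.obj R) : ofCoord e (coord e x) = x :=
  congrArg (fun k : X ⟶ X => k.app R x) e.hom_inv_id

lemma coord_injective (e : X ≅ SSp A) : Function.Injective (coord e : X.obj R → (A ⟶ R)) :=
  Function.LeftInverse.injective (ofCoord_coord e)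

/-- Points of a functor descend along faithfully flat morphisms. -/
def FFDescent (Z : KFunctor K) : Prop :=
  ∀ ⦃R R' : SAlg K⦄ (φ : R ⟶ R'), NCFlat.FaithfullyFlat (Hom.ringHom φ) → ∀ z' : Z.obj R',
    (∀ (S : SAlg K) (u v : R' ⟶ S), φ ≫ u = φ ≫ v → Z.map u z' = Z.map v z') →
      ∃! z, Z.map φ z = z'

lemma FFDescent.injective (hZ : FFDescent Z) (φ : R ⟶ S)
    (hφ : NCFlat.FaithfullyFlat (Hom.ringHom φ)) : Function.Injective (Z.map φ) := by
  intro a b h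
  obtain ⟨z, -, hz⟩ := hZ φ hφ (Z.map φ a) (fun T u v e => by
    rw [← map_comp_apply, ← map_comp_apply, e])
  rw [hz a rfl, hz b h.symm]

end Basic

variable [NeZero (2 : K)]
variable {X Y Z : KFunctor K} {A B C R S T : SAlg K}

/-- Exactness of R → S ⇉ S ⊗_R S, with the tensor product replaced by any pushout. -/
lemma eq_unit_of_isPushout {P : SAlg K} {φ : R ⟶ S} {u v : S ⟶ P} (h : SAlg.IsPushout φ φ u v)
    (hφ : NCFlat.FaithfullyFlat (Hom.ringHom φ)) {b : S} (hb : Hom.ringHom u b = Hom.ringHom v b) :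
    ∃ a, Hom.ringHom φ a = b := by
  refine hφ.exists_eq_unit b (h.bijective.injective ?_)
  refine (NCFlat.mulMap_tmul _ _ _).trans (Eq.trans ?_ (NCFlat.mulMap_tmul _ _ _).symm)
  rw [map_one, map_one, mul_one, one_mul, hb]

/-- A morphism A → R' whose composites with both maps R' → R' ⊗_R R' agree takes its values in R. -/
lemma ffDescent_of_iso (e : Z ≅ SSp A) : FFDescent Z := by
  intro R R' φ hφ z' hz'
  obtain ⟨P, u, v, hP⟩ := exists_isPushout φ φ
  have h1 : coord e z' ≫ u = coord e z' ≫ v := by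
    rw [← coord_map, ← coord_map, hz' P u v hP.comm]
  obtain ⟨g, hg⟩ := exists_factor φ hφ.injective (coord e z') (fun a => by
    refine eq_unit_of_isPushout hP hφ ?_
    exact congrArg (fun k => Hom.ringHom k a) h1)
  refine ⟨ofCoord e g, ?_, fun y hy => ?_⟩
  · change Z.map φ (ofCoord e g) = z'
    rw [ofCoord_map, hg, ofCoord_coord]
  · refine coord_injective e ?_
    rw [coord_ofCoord]
    refine SAlg.hom_ext fun a => hφ.injective ?_
    rw [← ringHom_comp_apply, ← ringHom_comp_apply, hg, ← coord_map, hy]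

/-! ### Local functors -/

/-- The sheaf condition for a generating covering, pulled back along the identity and written in
terms of points. -/
lemma IsLocal.existsUnique (hZ : Z.IsLocal) {n : ℕ} {f : Fin n → R.even}
    (hf : Ideal.span (Set.range f) = ⊤) {S : Fin n → SAlg K} {φ : ∀ i, R ⟶ S i}
    (hφ : ∀ i, IsLocalizationAway (φ i) (f i : R)) (z : ∀ i, Z.obj (S i))
    (hz : ∀ i j (T : SAlg K) (u : S i ⟶ T) (v : S j ⟶ T), φ i ≫ u = φ j ≫ v →
      Z.map u (z i) = Z.map v (z j)) : ∃! y, ∀ i, Z.map (φ i) y = z i := by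
  have h1 : Presieve.ofArrows (fun i => Opposite.op (S i)) (fun i => (φ i).op) ∈
      (locCoverings K).coverings (Opposite.op R) := by
    obtain ⟨c, hc⟩ := (Ideal.mem_span_range_iff_exists_fun).1
      (hf ▸ Submodule.mem_top : (1 : R.even) ∈ Ideal.span (Set.range f))
    refine ⟨n, fun i => f i, S, φ, fun i => (f i).2, ⟨fun i => c i, fun i => (c i).2, ?_⟩, hφ, rfl⟩
    have := congrArg Subtype.val hc
    refine Eq.trans ?_ this
    exact (map_sum R.even.val (fun i => c i * f i) Finset.univ).symm
  have h2 := ((locCoverings K).isSheaf_toGrothendieck_iff Z.presheaf).1 hZ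
    (f := 𝟙 (Opposite.op R)) _ h1
  rw [Sieve.pullback_id, ← Presieve.isSheafFor_iff_generate, Presieve.isSheafFor_arrows_iff] at h2
  exact h2 z (fun i j T u v e => hz i j T.unop u.unop v.unop (congrArg Quiver.Hom.unop e))

lemma IsLocal.eq_of_map_eq (hZ : Z.IsLocal) {ι : Type*} {f : ι → R.even}
    (hf : Ideal.span (Set.range f) = ⊤) {S : ι → SAlg K} {φ : ∀ i, R ⟶ S i}
    (hφ : ∀ i, IsLocalizationAway (φ i) (f i : R)) {x y : Z.obj R}
    (h : ∀ i, Z.map (φ i) x = Z.map (φ i) y) : x = y := by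
  obtain ⟨n, g, hg⟩ := exists_fin_span_eq_top hf
  obtain ⟨z, -, hz⟩ := hZ.existsUnique hg (fun i => hφ (g i)) (fun i => Z.map (φ (g i)) x)
    (fun i j T u v e => by rw [← map_comp_apply, ← map_comp_apply, e])
  rw [hz x fun _ => rfl, hz y fun i => (h (g i)).symm]

/-- The empty family covers the zero superalgebra. -/
lemma IsLocal.subsingleton (hZ : Z.IsLocal) [Subsingleton R] : Subsingleton (Z.obj R) := by
  refine ⟨fun x y => hZ.eq_of_map_eq (ι := Empty) (f := Empty.elim) ?_ (S := Empty.elim)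
    (φ := fun i => i.elim) (fun i => i.elim) (fun i => i.elim)⟩
  rw [Ideal.eq_top_iff_one, show (1 : R.even) = 0 from Subtype.ext (Subsingleton.elim _ _)]
  exact zero_mem _

/-! ### Open subfunctors -/

/-- The open subset of the spectrum where a point lies in a subfunctor. -/
def locus (U : Subfunctor Z) (z : Z.obj R) : Set (PrimeSpectrum R.even) :=
  {q | Z.map (resMap q) z ∈ U.obj (resField q)}

lemma IsOpen.exists_ideal {U : Subfunctor Z} (hU : IsOpen U) (z : Z.obj R) :
    ∃ I : Ideal R.even, ∀ (S : SAlg K) (h : R ⟶ S),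
      Z.map h z ∈ U.obj S ↔ I.map (Hom.even h) = ⊤ := by
  obtain ⟨I, hI, h⟩ := hU R (ofPoint z)
  exact ⟨evenIdeal I, fun S g => (h S (SSp.mk g)).trans (map_eq_top_iff_even hI g)⟩

lemma IsOpen.locus_eq {U : Subfunctor Z} {z : Z.obj R} {I : Ideal R.even}
    (h : ∀ (S : SAlg K) (h : R ⟶ S), Z.map h z ∈ U.obj S ↔ I.map (Hom.even h) = ⊤) :
    locus U z = (PrimeSpectrum.zeroLocus (I : Set R.even))ᶜ := by
  ext q
  refine (h _ _).trans ((map_even_eq_top_iff _ _).trans ?_)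
  constructor
  · intro H hq
    obtain ⟨x⟩ := (isFieldExtension_resField q).exists_prime
    refine H x ?_
    rw [specMap_resMap]
    exact hq
  · intro H x hx
    rw [specMap_resMap] at hx
    exact H hx

lemma IsOpen.isOpen_locus {U : Subfunctor Z} (hU : IsOpen U) (z : Z.obj R) :
    _root_.IsOpen (locus U z) := by
  obtain ⟨I, hI⟩ := hU.exists_ideal z
  rw [IsOpen.locus_eq hI]
  exact (PrimeSpectrum.isClosed_zeroLocus _).isOpen_compl

/-- An ideal generates the unit ideal exactly when no prime contains its image, so membership in an
open subfunctor is tested pointwise on the spectrum. -/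
lemma IsOpen.map_mem_iff {U : Subfunctor Z} (hU : IsOpen U) (z : Z.obj R) (h : R ⟶ S) :
    Z.map h z ∈ U.obj S ↔ ∀ q, specMap h q ∈ locus U z := by
  obtain ⟨I, hI⟩ := hU.exists_ideal z
  rw [hI, map_even_eq_top_iff, IsOpen.locus_eq hI]
  rfl

lemma IsOpen.mem_iff {U : Subfunctor Z} (hU : IsOpen U) (z : Z.obj R) :
    z ∈ U.obj R ↔ ∀ q, q ∈ locus U z := by
  have := hU.map_mem_iff z (𝟙 R)
  rwa [map_id_apply] at this

lemma IsOpen.mem_locus_map {U : Subfunctor Z} (hU : IsOpen U) (z : Z.obj R) (h : R ⟶ S)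
    (q : PrimeSpectrum S.even) : q ∈ locus U (Z.map h z) ↔ specMap h q ∈ locus U z := by
  change Z.map (resMap q) (Z.map h z) ∈ U.obj _ ↔ _
  rw [← map_comp_apply, hU.map_mem_iff]
  constructor
  · intro H
    obtain ⟨x⟩ := (isFieldExtension_resField q).exists_prime
    simpa only [specMap_comp, specMap_resMap] using H x
  · intro H x
    rwa [specMap_comp, specMap_resMap]

lemma IsOpen.exists_basicOpen {V : Set (PrimeSpectrum R.even)} (hV : _root_.IsOpen V)
    {q : PrimeSpectrum R.even} (hq : q ∈ V) :
    ∃ f : R.even, q ∈ PrimeSpectrum.basicOpen f ∧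
      (PrimeSpectrum.basicOpen f : Set (PrimeSpectrum R.even)) ⊆ V := by
  obtain ⟨_, ⟨f, rfl⟩, h1, h2⟩ :=
    (PrimeSpectrum.isTopologicalBasis_basic_opens (R := R.even)).exists_subset_of_mem_open hq hV
  exact ⟨f, h1, h2⟩

lemma IsOpenCovering.exists_mem_locus {𝒰 : Set (Subfunctor Z)} (h : IsOpenCovering 𝒰)
    (z : Z.obj R) (q : PrimeSpectrum R.even) : ∃ U ∈ 𝒰, q ∈ locus U z :=
  h.2 _ (isFieldExtension_resField q) _

end KFunctor

/-! ### Faithfully flat descent of points of superschemes -/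

namespace KFunctor

open SAlg

variable {K : Type u} [Field K] [NeZero (2 : K)]
variable {X Y Z : KFunctor K} {A B C R S T : SAlg K}

lemma IsOpen.map_mem_of_basicOpen {U : Subfunctor Z} (hU : IsOpen U) {z : Z.obj R} {f : R.even}
    (hf : (PrimeSpectrum.basicOpen f : Set (PrimeSpectrum R.even)) ⊆ locus U z) {h : R ⟶ S}
    (hu : IsUnit (Hom.ringHom h f)) : Z.map h z ∈ U.obj S :=
  (hU.map_mem_iff z h).2 fun q => hf (specMap_mem_basicOpen hu q)

/-- Points of a superscheme are determined after a faithfully flat extension. -/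
theorem IsSuperscheme.injective_of_faithfullyFlat (hZ : Z.IsSuperscheme) {φ : R ⟶ S}
    (hφ : NCFlat.FaithfullyFlat (Hom.ringHom φ)) : Function.Injective (Z.map φ) := by
  obtain ⟨hl, 𝒰, h𝒰, haff⟩ := hZ
  intro z₁ z₂ h
  -- Both points lie in a common affine open near q: by surjectivity of spectra q comes from S,
  -- where z₁ and z₂ agree, so their loci contain q simultaneously. On such a basic open the affine
  -- case applies.
  have key : ∀ q : PrimeSpectrum R.even, ∃ f : R.even, q ∈ PrimeSpectrum.basicOpen f ∧ ∃ U ∈ 𝒰,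
      (PrimeSpectrum.basicOpen f : Set (PrimeSpectrum R.even)) ⊆ locus U z₁ ∩ locus U z₂ := by
    intro q
    obtain ⟨U, hU, hq⟩ := h𝒰.exists_mem_locus z₁ q
    have hq' : q ∈ locus U z₂ := by
      obtain ⟨q', rfl⟩ := specMap_surjective hφ q
      rwa [← (h𝒰.1 U hU).mem_locus_map, ← h, (h𝒰.1 U hU).mem_locus_map]
    obtain ⟨f, h1, h2⟩ := IsOpen.exists_basicOpen
      (((h𝒰.1 U hU).isOpen_locus z₁).inter ((h𝒰.1 U hU).isOpen_locus z₂)) ⟨hq, hq'⟩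
    exact ⟨f, h1, U, hU, h2⟩
  choose f hf U hU hsub using key
  refine hl.eq_of_map_eq (f := f) ((span_eq_top_iff f).2 fun q => ⟨q, hf q⟩)
    (fun q => isLocalizationAway_locMap R (f q)) (fun q => ?_)
  have hu := (isLocalizationAway_locMap R (f q)).isUnit
  obtain ⟨P, u, v, hP⟩ := exists_isPushout (locMap R (f q)) φ
  obtain ⟨A, ⟨e⟩⟩ := haff (U q) (hU q)
  have m₁ := (h𝒰.1 _ (hU q)).map_mem_of_basicOpen ((hsub q).trans Set.inter_subset_left) hu
  have m₂ := (h𝒰.1 _ (hU q)).map_mem_of_basicOpen ((hsub q).trans Set.inter_subset_right) hu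
  have h1 := @FFDescent.injective _ _ _ _ _ (ffDescent_of_iso e) u (hP.faithfullyFlat hφ)
    ⟨_, m₁⟩ ⟨_, m₂⟩ (Subtype.ext (by
      change Z.map u (Z.map _ z₁) = Z.map u (Z.map _ z₂)
      rw [← map_comp_apply, ← map_comp_apply, hP.comm, map_comp_apply, map_comp_apply, h]))
  exact congrArg Subtype.val h1

/-- Points of a superscheme descend along faithfully flat morphisms. -/
theorem IsSuperscheme.ffDescent (hZ : Z.IsSuperscheme) : FFDescent Z := by
  intro R R' φ hφ z' hz'
  have hZ' := hZ
  obtain ⟨hl, 𝒰, h𝒰, haff⟩ := hZ'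
  suffices h : ∃ z, Z.map φ z = z' by
    obtain ⟨z, hz⟩ := h
    exact ⟨z, hz, fun y hy => hZ.injective_of_faithfullyFlat hφ (hy.trans hz.symm)⟩
  -- The locus of U for z' is saturated over Spec R₀: two points over the same prime have a common
  -- extension on which the pullbacks of z' agree by `hz'`. So it is the preimage of an open set,
  -- and z' lies in U over a basic neighbourhood of p.
  have key : ∀ p : PrimeSpectrum R.even, ∃ f : R.even, p ∈ PrimeSpectrum.basicOpen f ∧ ∃ U ∈ 𝒰,
      ∀ q, specMap φ q ∈ PrimeSpectrum.basicOpen f → q ∈ locus U z' := by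
    intro p
    obtain ⟨q, rfl⟩ := specMap_surjective hφ p
    obtain ⟨U, hU, hq⟩ := h𝒰.exists_mem_locus z' q
    obtain ⟨V, hV, hV'⟩ := exists_isOpen_preimage hφ ((h𝒰.1 U hU).isOpen_locus z')
      (fun q₁ q₂ h12 h1 => by
        obtain ⟨L, u, v, x, huv, rfl, rfl⟩ := exists_common_extension φ φ q₁ q₂ h12
        rwa [← (h𝒰.1 U hU).mem_locus_map, ← hz' L u v huv, (h𝒰.1 U hU).mem_locus_map])
    have hq' : specMap φ q ∈ V := by
      rw [hV'] at hq
      exact hq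
    obtain ⟨f, h1, h2⟩ := IsOpen.exists_basicOpen hV hq'
    refine ⟨f, h1, U, hU, fun q₁ hq₁ => ?_⟩
    rw [hV']
    exact h2 hq₁
  choose f₀ hf₀ U₀ hU₀ hsub₀ using key
  obtain ⟨n, g, hg⟩ := exists_fin_span_eq_top ((span_eq_top_iff f₀).2 fun q => ⟨q, hf₀ q⟩)
  have hloc := fun i => isLocalizationAway_locMap R (f₀ (g i))
  have hP := fun i => exists_isPushout (locMap R (f₀ (g i))) φ
  choose P u v hP using hP
  -- Over R_f the point z' lies in an affine open, and the compatibility of z' passes to the base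
  -- change R_f → R_f ⊗_R R'.
  have hdesc : ∀ i, ∃ y : Z.obj (loc R (f₀ (g i))), Z.map (u i) y = Z.map (v i) z' := by
    intro i
    have hU := h𝒰.1 _ (hU₀ (g i))
    have hm : Z.map (v i) z' ∈ (U₀ (g i)).obj (P i) := by
      refine (hU.map_mem_iff _ _).2 fun q => hsub₀ _ _ ?_
      rw [← specMap_comp, ← (hP i).comm, specMap_comp]
      exact specMap_mem_basicOpen (hloc i).isUnit _
    obtain ⟨A, ⟨e⟩⟩ := haff _ (hU₀ (g i))
    obtain ⟨y, hy, -⟩ := ffDescent_of_iso e (u i) ((hP i).faithfullyFlat hφ) ⟨_, hm⟩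
      (fun T a b hab => Subtype.ext (by
        change Z.map a (Z.map (v i) z') = Z.map b (Z.map (v i) z')
        rw [← map_comp_apply, ← map_comp_apply]
        refine hz' T _ _ ?_
        rw [← Category.assoc, ← (hP i).comm, Category.assoc, hab, ← Category.assoc, (hP i).comm,
          Category.assoc]))
    exact ⟨y.1, congrArg Subtype.val hy⟩
  choose y hy using hdesc
  -- The local solutions agree on an overlap T because they agree after the faithfully flat
  -- extension T → T ⊗_R R', where both become the pullback of z'.
  obtain ⟨z, hz, -⟩ := hl.existsUnique hg hloc y (fun i j T a b hab => by
    obtain ⟨Q, c, d, hQ⟩ := exists_isPushout (locMap R (f₀ (g i)) ≫ a) φ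
    obtain ⟨k, hk1, hk2⟩ := (hP i).exists_desc (a ≫ c) d (by rw [← Category.assoc, hQ.comm])
    obtain ⟨l, hl1, hl2⟩ := (hP j).exists_desc (b ≫ c) d (by
      rw [← Category.assoc, ← hab, hQ.comm])
    refine hZ.injective_of_faithfullyFlat (hQ.faithfullyFlat hφ) ?_
    rw [← map_comp_apply, ← map_comp_apply, ← hk1, ← hl1, map_comp_apply, map_comp_apply, hy, hy,
      ← map_comp_apply, ← map_comp_apply, hk2, hl2])
  refine ⟨z, ?_⟩
  refine hl.eq_of_map_eq (span_map_eq_top φ hg)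
    (fun i => isLocalizationAway_locMap R' (Hom.even φ (f₀ (g i)))) (fun i => ?_)
  have hunit := (isLocalizationAway_locMap R' (Hom.even φ (f₀ (g i)))).isUnit
  obtain ⟨a, ha⟩ := (hloc i).exists_desc (φ ≫ locMap R' (Hom.even φ (f₀ (g i)))) hunit
  obtain ⟨b, hb1, hb2⟩ := (hP i).exists_desc a (locMap R' (Hom.even φ (f₀ (g i)))) ha
  rw [← map_comp_apply, ← ha, map_comp_apply, hz, ← hb1, map_comp_apply, hy, ← map_comp_apply, hb2]

end KFunctor

/-! ### Jointly faithfully flat finite families -/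

namespace NCFlat

open MulOpposite

section Family

variable {A : Type u} [Ring A] {ι : Type} {S : ι → Type u} [∀ i, Ring (S i)]

/-- A jointly faithfully flat family of ring homomorphisms. -/
def FFFamily (φ : ∀ i, A →+* S i) : Prop :=
  (∀ i, Flat (φ i)) ∧ ∀ (N : Type u) [AddCommGroup N] [Module Aᵐᵒᵖ N],
    (∀ i, Subsingleton (Tensor (φ i) N)) → Subsingleton N

variable (φ : ∀ i, A →+* S i) {N N' : Type u} [AddCommGroup N] [Module Aᵐᵒᵖ N]
  [AddCommGroup N'] [Module Aᵐᵒᵖ N']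

/-- The projection `N ⊗ ∏ S_i → N ⊗ S_i`. -/
def projTensor (i : ι) : Tensor (RingHom.pi φ) N →+ Tensor (φ i) N :=
  lmap (Pi.evalAddMonoidHom S i) (fun _ _ => rfl)

variable [DecidableEq ι]

/-- The inclusion `N ⊗ S_i → N ⊗ ∏ S_i`. -/
def inclTensor (i : ι) : Tensor (φ i) N →+ Tensor (RingHom.pi φ) N :=
  lmap (AddMonoidHom.single S i) (fun a b => by
    funext j
    by_cases h : j = i
    · subst h
      simp
    · simp [h])

lemma projTensor_inclTensor (i : ι) (t : Tensor (φ i) N) :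
    projTensor φ i (inclTensor φ i t) = t := by
  refine tensor_induction t (by simp) (fun n b => ?_) (fun x y hx hy => by rw [map_add, map_add, hx, hy])
  change tmul (φ i) n (Pi.single (M := S) i b i) = _
  rw [Pi.single_eq_same]

lemma sum_inclTensor_projTensor [Fintype ι] (t : Tensor (RingHom.pi φ) N) :
    ∑ i, inclTensor φ i (projTensor φ i t) = t := by
  refine tensor_induction t (by simp) (fun n b => ?_) (fun x y hx hy => ?_)
  · change ∑ i, tmul (RingHom.pi φ) n (Pi.single (M := S) i (b i)) = _
    rw [← tmul_sum, Finset.univ_sum_single]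
  · simp only [map_add, Finset.sum_add_distrib, hx, hy]

variable {φ}

lemma projTensor_map (i : ι) (f : N →ₗ[Aᵐᵒᵖ] N') (t : Tensor (RingHom.pi φ) N) :
    projTensor φ i (map _ f t) = map _ f (projTensor φ i t) := lmap_map _ _ _ _

lemma inclTensor_map (i : ι) (f : N →ₗ[Aᵐᵒᵖ] N') (t : Tensor (φ i) N) :
    inclTensor φ i (map _ f t) = map _ f (inclTensor φ i t) := lmap_map _ _ _ _

-- For a finite family, N ⊗ ∏ S_i is the direct sum of the N ⊗ S_i, naturally in N.
omit [DecidableEq ι] in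
lemma FFFamily.pi [Finite ι] (h : FFFamily φ) : FaithfullyFlat (RingHom.pi φ) := by
  classical
  have := Fintype.ofFinite ι
  refine ⟨fun N N' _ _ _ _ f hf => ?_, fun N _ _ hN => h.2 N fun i => ?_⟩
  · refine (injective_iff_map_eq_zero _).2 fun t ht => ?_
    rw [← sum_inclTensor_projTensor φ t]
    refine Finset.sum_eq_zero fun i _ => ?_
    have h1 : map (φ i) f (projTensor φ i t) = 0 := by rw [← projTensor_map, ht, map_zero]
    rw [h.1 i N N' f hf (h1.trans (map_zero _).symm), map_zero]
  · exact (Function.LeftInverse.injective (projTensor_inclTensor φ i)).subsingleton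

omit [DecidableEq ι] in
lemma FFFamily.of_pi [Finite ι] (h : FaithfullyFlat (RingHom.pi φ)) : FFFamily φ := by
  classical
  have := Fintype.ofFinite ι
  refine ⟨fun i N N' _ _ _ _ f hf => ?_, fun N _ _ hN => h.2 N ⟨fun s t => ?_⟩⟩
  · refine (injective_iff_map_eq_zero _).2 fun t ht => ?_
    have h1 : map (RingHom.pi φ) f (inclTensor φ i t) = 0 := by rw [← inclTensor_map, ht, map_zero]
    rw [← projTensor_inclTensor φ i t, h.1 N N' f hf (h1.trans (map_zero _).symm), map_zero]
  · rw [← sum_inclTensor_projTensor φ s, ← sum_inclTensor_projTensor φ t]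
    refine Finset.sum_congr rfl fun i _ => ?_
    rw [(hN i).elim (projTensor φ i s) (projTensor φ i t)]

end Family

lemma FFFamily.comp {A : Type u} [Ring A] {ι : Type} {S : ι → Type u} [∀ i, Ring (S i)]
    {φ : ∀ i, A →+* S i} (h : FFFamily φ) {κ : ι → Type} {T : ∀ i, κ i → Type u}
    [∀ i k, Ring (T i k)] {ψ : ∀ i k, S i →+* T i k} (hψ : ∀ i, FFFamily (ψ i)) :
    FFFamily (S := fun j : Σ i, κ i => T j.1 j.2) (fun j => (ψ j.1 j.2).comp (φ j.1)) := by
  refine ⟨fun j => (h.1 _).comp ((hψ _).1 _), fun N _ _ hN => h.2 N fun i => (hψ i).2 _ fun k => ?_⟩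
  exact (subsingleton_comp_iff _ _ N).1 (hN ⟨i, k⟩)

lemma FFFamily.id {A : Type u} [Ring A] : FFFamily (ι := Unit) (S := fun _ => A)
    (fun _ => RingHom.id A) := by
  have hb : ∀ (N : Type u) [AddCommGroup N] [Module Aᵐᵒᵖ N],
      Function.Injective (unit (RingHom.id A) N) := by
    intro N _ _ x y h
    have := congrArg (lift (RingHom.id A) (N := N)
      { toFun := fun n =>
          { toFun := fun a => op a • n
            map_zero' := by rw [op_zero, zero_smul]
            map_add' := fun a b => by rw [MulOpposite.op_add, add_smul] }
        map_zero' := by ext; exact smul_zero _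
        map_add' := fun a b => by ext; exact smul_add _ _ _ }
      (fun n a b => by
        change op b • op a • n = op (a * b) • n
        rw [smul_smul, op_mul])) h
    change op (1 : A) • x = op (1 : A) • y at this
    rwa [op_one, one_smul, one_smul] at this
  have hs : ∀ (N : Type u) [AddCommGroup N] [Module Aᵐᵒᵖ N] (t : Tensor (RingHom.id A) N),
      ∃ n, t = tmul (RingHom.id A) n 1 := by
    intro N _ _ t
    refine tensor_induction t ⟨0, (zero_tmul _ _).symm⟩ (fun n b => ⟨op b • n, ?_⟩) ?_
    · rw [smul_tmul]
      simp
    · rintro _ _ ⟨n, rfl⟩ ⟨m, rfl⟩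
      exact ⟨n + m, (add_tmul _ _ _ _).symm⟩
  refine ⟨fun _ N N' _ _ _ _ f hf => (injective_iff_map_eq_zero _).2 fun t ht => ?_,
    fun N _ _ hN => have : Subsingleton (Res (RingHom.id A) (Tensor (RingHom.id A) N)) := hN ()
      (hb N).subsingleton⟩
  obtain ⟨n, rfl⟩ := hs N t
  have h1 : unit (RingHom.id A) N' (f n) = unit (RingHom.id A) N' 0 := ht.trans (map_zero _).symm
  rw [hf ((hb N' h1).trans (map_zero f).symm), zero_tmul]

end NCFlat

/-! ### The factors of a finite product as localizations at idempotents -/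

namespace SAlg

variable {K : Type u} [Field K] [NeZero (2 : K)]

section Pi

variable {ι : Type} [DecidableEq ι] (T : ι → SAlg K)

/-- The idempotent of a factor of a product. -/
def piIdem (i : ι) : (pi T).even :=
  ⟨(Pi.single i 1 : ∀ i, T i), by
    refine mem_even_iff.2 ((parity_pi T _).trans (funext fun j => ?_))
    by_cases h : j = i
    · subst h
      rw [Pi.single_eq_same, map_one]
    · rw [Pi.single_eq_of_ne h, map_zero]⟩

lemma piProj_piIdem_same (i : ι) : Hom.ringHom (piProj T i) (piIdem T i : pi T) = 1 :=
  Pi.single_eq_same (M := fun i => (T i : Type u)) i 1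

lemma piProj_piIdem_ne {i j : ι} (h : j ≠ i) :
    Hom.ringHom (piProj T j) (piIdem T i : pi T) = 0 :=
  Pi.single_eq_of_ne (M := fun i => (T i : Type u)) h 1

lemma piProj_surjective (i : ι) : Function.Surjective (Hom.ringHom (piProj T i)) := fun t =>
  ⟨(Pi.single i t : ∀ i, T i), Pi.single_eq_same (M := fun i => (T i : Type u)) i t⟩

lemma pi_ext {x y : pi T} (h : ∀ i, Hom.ringHom (piProj T i) x = Hom.ringHom (piProj T i) y) :
    x = y := funext h

lemma isLocalizationAway_piProj (i : ι) :
    IsLocalizationAway (piProj T i) (piIdem T i : pi T) where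
  isUnit := by rw [piProj_piIdem_same]; exact isUnit_one
  surj s := by
    obtain ⟨r, rfl⟩ := piProj_surjective T i s
    exact ⟨0, r, by rw [pow_zero, one_mul]⟩
  eq_zero r hr := by
    refine ⟨1, pi_ext T fun j => ?_⟩
    rw [pow_one, map_mul, map_zero]
    by_cases h : j = i
    · subst h
      rw [hr, mul_zero]
    · rw [piProj_piIdem_ne T h, zero_mul]

lemma span_piIdem [Finite ι] : Ideal.span (Set.range (piIdem T)) = ⊤ := by
  have := Fintype.ofFinite ι
  rw [Ideal.eq_top_iff_one]
  have h : (1 : (pi T).even) = ∑ i, piIdem T i := by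
    refine Subtype.ext ?_
    refine Eq.trans ?_ (map_sum (pi T).even.val _ _).symm
    exact (Finset.univ_sum_single (M := fun i => (T i : Type u)) 1).symm
  rw [h]
  exact sum_mem fun i _ => Ideal.subset_span ⟨i, rfl⟩

end Pi

end SAlg

/-! ### Superschemes are sheaves for the fppf topology -/

namespace KFunctor

open SAlg

variable {K : Type u} [Field K] [NeZero (2 : K)]
variable {X Y Z : KFunctor K} {R S : SAlg K} {ι : Type} [Finite ι] {T : ι → SAlg K}

lemma IsLocal.pi_ext (hZ : Z.IsLocal) {x y : Z.obj (pi T)}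
    (h : ∀ i, Z.map (piProj T i) x = Z.map (piProj T i) y) : x = y := by
  classical
  exact hZ.eq_of_map_eq (span_piIdem T) (isLocalizationAway_piProj T) h

/-- The factors form a covering of the product. On an overlap of distinct factors an idempotent is
both 1 and 0, so the overlap is the zero superalgebra, where any two points agree. -/
lemma IsLocal.exists_pi (hZ : Z.IsLocal) (x : ∀ i, Z.obj (T i)) :
    ∃ y : Z.obj (pi T), ∀ i, Z.map (piProj T i) y = x i := by
  classical
  let e := (Finite.equivFin ι).symm
  have hspan : Ideal.span (Set.range fun i => piIdem T (e i)) = ⊤ := by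
    rw [← span_piIdem T]
    congr 1
    exact e.surjective.range_comp (piIdem T)
  obtain ⟨y, hy, -⟩ := hZ.existsUnique hspan (fun i => isLocalizationAway_piProj T (e i))
    (fun i => x (e i)) (fun i j Q u v huv => by
      by_cases hij : i = j
      · subst hij
        rw [epi_of_surjective (piProj_surjective T (e i)) huv]
      · have h1 := congrArg (fun k => Hom.ringHom k (piIdem T (e i) : pi T)) huv
        simp only [ringHom_comp_apply, piProj_piIdem_same,
          piProj_piIdem_ne T (fun h => hij (e.injective h.symm) : e j ≠ e i), map_one,
          map_zero] at h1
        have : Subsingleton Q := subsingleton_of_zero_eq_one h1.symm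
        exact hZ.subsingleton.elim _ _)
  refine ⟨y, fun i => ?_⟩
  obtain ⟨i, rfl⟩ := e.surjective i
  exact hy i

/-- A compatible family on a jointly faithfully flat family glues. -/
lemma IsLocal.existsUnique_of_ffFamily (hZ : Z.IsLocal) (hd : FFDescent Z) {φ : ∀ i, R ⟶ T i}
    (hφ : NCFlat.FFFamily fun i => Hom.ringHom (φ i)) (z : ∀ i, Z.obj (T i))
    (hz : ∀ i j (Q : SAlg K) (u : T i ⟶ Q) (v : T j ⟶ Q), φ i ≫ u = φ j ≫ v →
      Z.map u (z i) = Z.map v (z j)) : ∃! y, ∀ i, Z.map (φ i) y = z i := by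
  classical
  have hff : NCFlat.FaithfullyFlat (Hom.ringHom (piLift T φ)) := hφ.pi
  obtain ⟨x, hx⟩ := hZ.exists_pi z
  have key : ∀ (y : Z.obj R), (∀ i, Z.map (φ i) y = z i) ↔ Z.map (piLift T φ) y = x := by
    intro y
    constructor
    · intro h
      refine hZ.pi_ext fun i => ?_
      rw [← map_comp_apply, piLift_proj, h, hx]
    · intro h i
      rw [← hx, ← h, ← map_comp_apply, piLift_proj]
  -- The family is replaced by the single morphism to its product. To compare the two pullbacks of x
  -- to Q, localize at the images of the idempotents under u and then under v; on each piece u and v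
  -- factor through single factors T i and T j, and `hz` applies.
  obtain ⟨y, hy, hyu⟩ := hd (piLift T φ) hff x (fun Q u v huv => by
    refine hZ.eq_of_map_eq (span_map_eq_top u (span_piIdem T))
      (fun i => isLocalizationAway_locMap Q _) (fun i => ?_)
    set l := locMap Q (Hom.even u (piIdem T i))
    obtain ⟨a, ha⟩ := (isLocalizationAway_piProj T i).exists_desc (u ≫ l)
      (isLocalizationAway_locMap Q (Hom.even u (piIdem T i))).isUnit
    refine hZ.eq_of_map_eq (span_map_eq_top (v ≫ l) (span_piIdem T))
      (fun i => isLocalizationAway_locMap _ _) (fun j => ?_)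
    set l' := locMap _ (Hom.even (v ≫ l) (piIdem T j))
    obtain ⟨b, hb⟩ := (isLocalizationAway_piProj T j).exists_desc ((v ≫ l) ≫ l')
      (isLocalizationAway_locMap _ (Hom.even (v ≫ l) (piIdem T j))).isUnit
    rw [← map_comp_apply Z u l, ← ha, map_comp_apply, hx, ← map_comp_apply, ← map_comp_apply Z v l,
      ← map_comp_apply Z (v ≫ l) l', ← hb, map_comp_apply Z (piProj T j), hx]
    refine hz i j _ _ _ ?_
    rw [← piLift_proj T φ i, ← piLift_proj T φ j, Category.assoc, Category.assoc,
      ← Category.assoc _ a, ha, hb]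
    simp only [← Category.assoc]
    rw [huv])
  exact ⟨y, (key y).2 hy, fun y' hy' => hyu y' ((key y').1 hy')⟩

variable (K) in
/-- The topology of finite jointly faithfully flat families. -/
def ffTopology : GrothendieckTopology (SAlg K)ᵒᵖ where
  sieves X := {S | ∃ (ι : Type) (_ : Finite ι) (T : ι → SAlg K) (φ : ∀ i, X.unop ⟶ T i),
    NCFlat.FFFamily (fun i => Hom.ringHom (φ i)) ∧ ∀ i, S.arrows (φ i).op}
  top_mem' X := ⟨Unit, inferInstance, fun _ => X.unop, fun _ => 𝟙 _, NCFlat.FFFamily.id,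
    fun _ => trivial⟩
  pullback_stable' := by
    rintro X Y S f ⟨ι, _, T, φ, hφ, h⟩
    have hP := fun i => exists_isPushout f.unop (φ i)
    choose P u v hP using hP
    refine ⟨ι, inferInstance, P, u, ⟨fun i => (hP i).flat (hφ.1 i), fun N _ _ hN => ?_⟩, fun i => ?_⟩
    · refine hφ.2 (NCFlat.Res (Hom.ringHom f.unop) N) fun i => ?_
      exact (Equiv.ofBijective _ (NCFlat.baseChangeMap_bijective
        (ringHom_comp_eq (hP i).comm) (hP i).bijective N)).subsingleton_congr.2 (hN i)
    · have h1 : (u i).op ≫ f = (v i).op ≫ (φ i).op := congrArg Quiver.Hom.op (hP i).comm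
      change S.arrows ((u i).op ≫ f)
      rw [h1]
      exact S.downward_closed (h i) _
  transitive' := by
    rintro X S ⟨ι, _, T, φ, hφ, h⟩ S' H
    have h1 := fun i => H (h i)
    choose κ hκ Q ψ hψ h2 using h1
    exact ⟨Σ i, κ i, inferInstance, fun j => Q j.1 j.2, fun j => φ j.1 ≫ ψ j.1 j.2,
      hφ.comp hψ, fun j => h2 j.1 j.2⟩

/-- The fppf topology is generated by its coverings, so its sieves have no direct description. In
the larger topology every covering sieve contains a finite jointly faithfully flat family, which is
what the torsor argument extracts; finite presentation is not needed. -/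
lemma fppfTopology_le : fppfTopology K ≤ ffTopology K := by
  rw [fppfTopology, Precoverage.toGrothendieck_eq_sInf]
  refine sInf_le ?_
  rintro X _ ⟨n, S, φ, -, h2, rfl⟩
  exact ⟨Fin n, inferInstance, S, φ, NCFlat.FFFamily.of_pi h2, fun i =>
    ⟨_, 𝟙 _, (φ i).op, Presieve.ofArrows.mk i, Category.id_comp _⟩⟩

lemma IsLocal.isSeparatedFor (hZ : Z.IsLocal) (hd : FFDescent Z) {X : (SAlg K)ᵒᵖ} {S : Sieve X}
    (hS : S ∈ ffTopology K X) : Presieve.IsSeparatedFor Z.presheaf S.arrows := by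
  obtain ⟨ι, _, T, φ, hφ, h⟩ := hS
  intro x t₁ t₂ h₁ h₂
  refine hd.injective (piLift T φ) hφ.pi (hZ.pi_ext fun i => ?_)
  rw [← map_comp_apply, ← map_comp_apply, piLift_proj]
  exact (h₁ _ (h i)).trans (h₂ _ (h i)).symm

/-- A covering sieve contains the sieve generated by a faithfully flat family. The sheaf condition
for the smaller sieve, together with separatedness for its pullbacks, gives it for the larger one.
-/
lemma IsLocal.isSheaf_ffTopology (hZ : Z.IsLocal) (hd : FFDescent Z) :
    Presieve.IsSheaf (ffTopology K) Z.presheaf := by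
  rintro X S ⟨ι, _, T, φ, hφ, h⟩
  refine Presieve.isSheafFor_subsieve_aux _
    (S := Sieve.generate (Presieve.ofArrows (fun i => Opposite.op (T i)) fun i => (φ i).op))
    ?_ ?_ ?_
  · refine (Sieve.generate_le_iff _ _).2 ?_
    rintro _ _ ⟨i⟩
    exact h i
  · rw [← Presieve.isSheafFor_iff_generate, Presieve.isSheafFor_arrows_iff]
    intro z hz
    exact hZ.existsUnique_of_ffFamily hd hφ z
      (fun i j Q u v e => hz i j _ u.op v.op (congrArg Quiver.Hom.op e))
  · intro Y f _
    refine hZ.isSeparatedFor hd ((ffTopology K).pullback_stable f ?_)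
    exact ⟨ι, inferInstance, T, φ, hφ, fun i =>
      ⟨_, 𝟙 _, (φ i).op, Presieve.ofArrows.mk i, Category.id_comp _⟩⟩

/-- Superschemes are sheaves for the fppf topology. -/
theorem IsSuperscheme.isSheaf_fppfTopology (hZ : Z.IsSuperscheme) :
    Presieve.IsSheaf (fppfTopology K) Z.presheaf :=
  Presieve.isSheaf_of_le _ fppfTopology_le (hZ.1.isSheaf_ffTopology hZ.ffDescent)

end KFunctor

/-! ### Effective descent of superalgebras -/

namespace NCFlat

open MulOpposite

/-- A ring homomorphism as a homomorphism of right modules over a base ring. -/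
def resHom {R A B : Type u} [Ring R] [Ring A] [Ring B] (φ : R →+* A) (ψ : R →+* B) (f : A →+* B)
    (h : ∀ a, f (φ a) = ψ a) : Res φ A →ₗ[Rᵐᵒᵖ] Res ψ B where
  toFun a := f a
  map_add' a b := map_add f a b
  map_smul' a b := by
    change f ((show A from b) * φ a.unop) = f (show A from b) * ψ a.unop
    rw [map_mul, h]

end NCFlat

namespace SAlg

variable {K : Type u} [Field K] [NeZero (2 : K)]

/-- Effectivity of descent for algebras along a faithfully flat morphism. -/
lemma isPushout_equalizer {R R' E E' : SAlg K} {φ : R ⟶ R'}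
    (hφ : NCFlat.Flat (Hom.ringHom φ)) {s : R' ⟶ E} {d₁ d₂ : E ⟶ E'} {w : R' ⟶ E'}
    (hE : IsPushout (φ ≫ s) φ d₁ w) (h₂ : s ≫ d₂ = w)
    (hp : ∀ p : E' ⟶ E, d₁ ≫ p = 𝟙 E → w ≫ p = s → d₂ ≫ p = 𝟙 E)
    (hc : ∀ (Q : SAlg K) (D₁ D₂ q : E' ⟶ Q), w ≫ D₁ = w ≫ D₂ → d₁ ≫ D₁ = d₁ ≫ q →
      d₁ ≫ D₂ = d₂ ≫ q → d₂ ≫ D₁ = d₂ ≫ D₂)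
    {r : R ⟶ equalizer d₁ d₂} (hr : r ≫ equalizerι d₁ d₂ = φ ≫ s) :
    IsPushout r φ (equalizerι d₁ d₂) s := by
  -- Here E' = E ⊗_R R' and `d₂` is a descent datum on E: `hp` is its unit condition and `hc` its
  -- cocycle condition. The aim is that the equalizer C satisfies C ⊗_R R' = E.
  set ι := equalizerι d₁ d₂ with hι
  have hιd : ∀ c, Hom.ringHom d₁ (Hom.ringHom ι c) = Hom.ringHom d₂ (Hom.ringHom ι c) :=
    equalizer_condition d₁ d₂
  have hf : φ ≫ s ≫ d₁ = φ ≫ s ≫ d₂ := by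
    rw [h₂, ← hE.comm, Category.assoc]
  obtain ⟨p, hp1, hp2⟩ := hE.exists_desc (𝟙 E) s (by rw [Category.comp_id])
  have hp3 := hp p hp1 hp2
  -- The multiplication p : E ⊗_R R' → E is a retraction of d₂ by the unit condition.
  have hd₂ : Function.Injective (Hom.ringHom d₂) :=
    Function.LeftInverse.injective (g := Hom.ringHom p) fun e =>
      congrArg (fun k => Hom.ringHom k e) hp3
  -- With Q = E' ⊗_R R', the maps D₁ and D₂ are d₁ ⊗ 1 and d₂ ⊗ 1, and the cocycle condition says
  -- that d₂ equalizes them.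
  obtain ⟨Q, q₁, q₂, hQ⟩ := exists_isPushout ((φ ≫ s) ≫ d₁) φ
  obtain ⟨D₁, hD₁, hD₁'⟩ := hE.exists_desc (d₁ ≫ q₁) q₂ (by rw [← Category.assoc, hQ.comm])
  obtain ⟨D₂, hD₂, hD₂'⟩ := hE.exists_desc (d₂ ≫ q₁) q₂ (by
    rw [← hQ.comm, ← Category.assoc, Category.assoc φ, ← hf, ← Category.assoc φ])
  have hD := hc Q D₁ D₂ q₁ (hD₁'.trans hD₂'.symm) hD₁ hD₂
  refine IsPushout.of_bijective hr ?_
  set μ := NCFlat.mulMap (Hom.ringHom r) (Hom.ringHom φ) (Hom.ringHom ι) (Hom.ringHom s)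
    (ringHom_comp_eq hr)
  set m := NCFlat.mulMap (Hom.ringHom (φ ≫ s)) (Hom.ringHom φ) (Hom.ringHom d₁) (Hom.ringHom w)
    (ringHom_comp_eq hE.comm)
  set m' := NCFlat.mulMap (Hom.ringHom ((φ ≫ s) ≫ d₁)) (Hom.ringHom φ) (Hom.ringHom q₁)
    (Hom.ringHom q₂) (ringHom_comp_eq hQ.comm)
  have hre : ∀ a, Hom.ringHom ι (Hom.ringHom r a) = Hom.ringHom (φ ≫ s) a := fun a =>
    congrArg (fun k => Hom.ringHom k a) hr
  let i := NCFlat.resHom (Hom.ringHom r) (Hom.ringHom (φ ≫ s)) (Hom.ringHom ι) hre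
  have hi : Function.Injective i := equalizerι_injective d₁ d₂
  have hd₂R : ∀ a, Hom.ringHom d₂ (Hom.ringHom (φ ≫ s) a) =
      Hom.ringHom ((φ ≫ s) ≫ d₁) a := fun a =>
    (congrArg (fun k => Hom.ringHom k a) hf).symm
  let e₁ := NCFlat.resHom (Hom.ringHom (φ ≫ s)) (Hom.ringHom ((φ ≫ s) ≫ d₁)) (Hom.ringHom d₁)
    (fun _ => rfl)
  let e₂ := NCFlat.resHom (Hom.ringHom (φ ≫ s)) (Hom.ringHom ((φ ≫ s) ≫ d₁)) (Hom.ringHom d₂) hd₂R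
  -- Under E ⊗_R R' = E', the inclusion C ⊗_R R' → E ⊗_R R' becomes d₂ composed with μ. Hence μ is
  -- injective, since C → E stays injective by flatness.
  have hm : ∀ t, m (NCFlat.map (Hom.ringHom φ) i t) = Hom.ringHom d₂ (μ t) := by
    intro t
    refine NCFlat.res_induction t (by simp) (fun c b => ?_)
      (fun x y hx hy => by simp only [map_add, hx, hy])
    change Hom.ringHom d₁ (Hom.ringHom ι c) * Hom.ringHom w b =
      Hom.ringHom d₂ (Hom.ringHom ι c * Hom.ringHom s b)
    rw [map_mul, hιd, ← h₂, ringHom_comp_apply]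
  have hm₁ : ∀ t, m' (NCFlat.map (Hom.ringHom φ) e₁ t) = Hom.ringHom D₁ (m t) := by
    intro t
    refine NCFlat.res_induction t (by simp) (fun c b => ?_)
      (fun x y hx hy => by simp only [map_add, hx, hy])
    change Hom.ringHom q₁ (Hom.ringHom d₁ c) * Hom.ringHom q₂ b =
      Hom.ringHom D₁ (Hom.ringHom d₁ c * Hom.ringHom w b)
    rw [map_mul, ← ringHom_comp_apply w D₁, hD₁', ← ringHom_comp_apply d₁ D₁, hD₁,
      ringHom_comp_apply]
  have hm₂ : ∀ t, m' (NCFlat.map (Hom.ringHom φ) e₂ t) = Hom.ringHom D₂ (m t) := by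
    intro t
    refine NCFlat.res_induction t (by simp) (fun c b => ?_)
      (fun x y hx hy => by simp only [map_add, hx, hy])
    change Hom.ringHom q₁ (Hom.ringHom d₂ c) * Hom.ringHom q₂ b =
      Hom.ringHom D₂ (Hom.ringHom d₁ c * Hom.ringHom w b)
    rw [map_mul, ← ringHom_comp_apply w D₂, hD₂', ← ringHom_comp_apply d₁ D₂, hD₂,
      ringHom_comp_apply]
  constructor
  · intro x y hxy
    refine hφ _ _ i hi (hE.bijective.injective ?_)
    exact (hm x).trans ((congrArg (Hom.ringHom d₂) hxy).trans (hm y).symm)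
  · intro e
    -- View d₂(e) as an element τ of E ⊗_R R'. By the cocycle condition it is killed by (d₁ - d₂) ⊗
    -- 1; by flatness it comes from ker(d₁ - d₂) ⊗ R' = C ⊗ R', and injectivity of d₂ turns this
    -- into a preimage of e.
    obtain ⟨τ, hτ⟩ := hE.bijective.surjective (Hom.ringHom d₂ e)
    change m τ = _ at hτ
    have h1 : NCFlat.map (Hom.ringHom φ) (e₁ - e₂) τ = 0 := by
      rw [NCFlat.map_sub_hom, AddMonoidHom.sub_apply, sub_eq_zero]
      refine hQ.bijective.injective ?_
      refine (hm₁ τ).trans (Eq.trans ?_ (hm₂ τ).symm)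
      rw [hτ]
      exact congrArg (fun k => Hom.ringHom k e) hD
    obtain ⟨σ, hσ⟩ := hφ.exists_of_map_eq_zero (e₁ - e₂) τ h1
    let I := LinearEquiv.ofInjective i hi
    let j := I.symm.toLinearMap ∘ₗ (LinearMap.ker (e₁ - e₂)).subtype.codRestrict (LinearMap.range i)
      (fun x => exists_equalizer_of_eq d₁ d₂ (sub_eq_zero.1 x.2))
    have hj : i ∘ₗ j = (LinearMap.ker (e₁ - e₂)).subtype := LinearMap.ext fun x =>
      congrArg Subtype.val (I.apply_symm_apply ⟨x.1, _⟩)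
    refine ⟨NCFlat.map (Hom.ringHom φ) j σ, hd₂ ?_⟩
    refine (hm _).symm.trans (Eq.trans (congrArg m ?_) hτ)
    rw [← hσ, ← hj]
    exact (DFunLike.congr_fun (NCFlat.map_comp (Hom.ringHom φ) i j) σ).symm

end SAlg

/-! ### Torsors and their fibres -/

namespace KFunctor

open SAlg

variable {K : Type u} [Field K] [NeZero (2 : K)]
variable {X Y Z : KFunctor K} {A B R S : SAlg K}

lemma exists_pi_of_iso (e : X ≅ SSp A) {ι : Type} {T : ι → SAlg K} (x : ∀ i, X.obj (T i)) :
    ∃ y : X.obj (pi T), ∀ i, X.map (piProj T i) y = x i :=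
  ⟨ofCoord e (piLift T fun i => coord e (x i)), fun i => by
    rw [ofCoord_map, piLift_proj, ofCoord_coord]⟩

lemma pi_ext_of_iso (e : X ≅ SSp A) {ι : Type} {T : ι → SAlg K} {x y : X.obj (pi T)}
    (h : ∀ i, X.map (piProj T i) x = X.map (piProj T i) y) : x = y := by
  classical
  refine coord_injective e (SAlg.hom_ext fun a => SAlg.pi_ext T fun i => ?_)
  rw [← ringHom_comp_apply, ← ringHom_comp_apply, ← coord_map, ← coord_map, h]

/-- `π : X ⟶ Y` is a torsor for the topology of faithfully flat morphisms. -/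
structure _root_.RightAction.IsTorsor {G : Supergroup K} (ρ : RightAction X G) (π : X ⟶ Y) :
    Prop where
  act : ∀ (R : SAlg K) (x : X.obj R) (g : G.obj R), π.app R (ρ.act R x g) = π.app R x
  exists_act : ∀ (R : SAlg K) (x x' : X.obj R), π.app R x = π.app R x' →
    ∃ g, ρ.act R x g = x'
  exists_lift : ∀ (R : SAlg K) (y : Y.obj R), ∃ (R' : SAlg K) (φ : R ⟶ R') (x : X.obj R'),
    NCFlat.FaithfullyFlat (Hom.ringHom φ) ∧ π.app R' x = Y.map φ y

lemma _root_.RightAction.IsFree.act_injective {G : Supergroup K} {ρ : RightAction X G}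
    (hρ : ρ.IsFree) {x : X.obj R} {g h : G.obj R} (e : ρ.act R x g = ρ.act R x h) : g = h := by
  have h1 := hρ R x (g * h⁻¹) (by
    rw [ρ.act_mul, e, ← ρ.act_mul, mul_inv_cancel, ρ.act_one])
  exact mul_inv_eq_one.1 h1

lemma quotientMap_act {G : Supergroup K} (ρ : RightAction X G) (x : X.obj R) (g : G.obj R) :
    ρ.quotientMap.app R (ρ.act R x g) = ρ.quotientMap.app R x :=
  congrArg (ρ.naiveQuotient.toSheafification.app R)
    (Quotient.sound ⟨g⁻¹, by rw [← ρ.act_mul, mul_inv_cancel, ρ.act_one]⟩ :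
      ρ.naiveMap.app R (ρ.act R x g) = ρ.naiveMap.app R x)

/-- The quotient morphism of a free action on an affine superscheme is a torsor. -/
theorem isTorsor_quotientMap {G : Supergroup K} {ρ : RightAction X G} (hρ : ρ.IsFree)
    (eX : X ≅ SSp A) (eG : G.toKFunctor ≅ SSp B) (hY : ρ.quotient.IsSuperscheme) :
    ρ.IsTorsor ρ.quotientMap where
  act _ x g := quotientMap_act ρ x g
  exists_act R x x' h := by
    -- Sections of the naive quotient with the same image in the sheafification agree on a covering
    -- sieve. On a finite faithfully flat family this gives group elements carrying x to x', which
    -- assemble into one over the product.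
    have h1 := fppfTopology_le _ (Presheaf.equalizerSieve_mem (fppfTopology K)
      (toSheafify (fppfTopology K) ρ.naiveQuotient.presheaf)
      (X := Opposite.op (Opposite.op R)) (ρ.naiveMap.app R x) (ρ.naiveMap.app R x') h)
    obtain ⟨ι, _, T, φ, hφ, h2⟩ := h1
    have h3 : ∀ i, ∃ g : G.obj (T i), ρ.act _ (X.map (φ i) x) g = X.map (φ i) x' := fun i => by
      have h4 : ρ.naiveQuotient.map (φ i) (ρ.naiveMap.app R x) =
        ρ.naiveQuotient.map (φ i) (ρ.naiveMap.app R x') := h2 i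
      rw [← app_map, ← app_map] at h4
      exact Quotient.exact h4
    choose g hg using h3
    obtain ⟨g', hg'⟩ := exists_pi_of_iso eG (T := T) g
    have hff : NCFlat.FaithfullyFlat (Hom.ringHom (piLift T φ)) := hφ.pi
    have h5 : ρ.act _ (X.map (piLift T φ) x) g' = X.map (piLift T φ) x' := by
      refine pi_ext_of_iso eX fun i => ?_
      rw [ρ.naturality, ← map_comp_apply, ← map_comp_apply, piLift_proj, ← hg i]
      exact congrArg _ (hg' i)
    -- Freeness makes the element carrying x to x' unique, so the two pullbacks of g' coincide and
    -- g' descends to R.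
    obtain ⟨g₀, hg₀, -⟩ := ffDescent_of_iso eG (piLift T φ) hff g' (fun Q u v huv => by
      refine hρ.act_injective (x := X.map (piLift T φ ≫ u) x) ?_
      have e1 : ρ.act Q (X.map (piLift T φ ≫ u) x) (G.map u g') =
          X.map (piLift T φ ≫ u) x' := by
        rw [map_comp_apply, map_comp_apply, ← ρ.naturality, h5]
      have e2 : ρ.act Q (X.map (piLift T φ ≫ v) x) (G.map v g') =
          X.map (piLift T φ ≫ v) x' := by
        rw [map_comp_apply, map_comp_apply, ← ρ.naturality, h5]
      rw [← huv] at e2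
      exact e1.trans e2.symm)
    refine ⟨g₀, (ffDescent_of_iso eX).injective (piLift T φ) hff ?_⟩
    rw [ρ.naturality, ← h5]
    exact congrArg _ hg₀
  exists_lift R y := by
    -- Every section of the sheafification comes locally from the naive quotient, hence from X; the
    -- local lifts are combined over a product.
    have h1 := fppfTopology_le _ (Presheaf.imageSieve_mem (fppfTopology K)
      (toSheafify (fppfTopology K) ρ.naiveQuotient.presheaf)
      (U := Opposite.op (Opposite.op R)) y)
    obtain ⟨ι, _, T, φ, hφ, h2⟩ := h1
    have h3 : ∀ i, ∃ x : X.obj (T i), ρ.quotientMap.app _ x = ρ.quotient.map (φ i) y := fun i => by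
      obtain ⟨t, ht⟩ := h2 i
      obtain ⟨x, rfl⟩ := Quotient.exists_rep t
      exact ⟨x, ht⟩
    choose x hx using h3
    obtain ⟨x', hx'⟩ := exists_pi_of_iso eX x
    refine ⟨pi T, piLift T φ, x', hφ.pi, hY.1.pi_ext fun i => ?_⟩
    rw [← app_map, hx', hx, ← map_comp_apply, piLift_proj]

/-- The fibre of a torsor over a point is affine and faithfully flat. -/
theorem exists_fiber {G : Supergroup K} {ρ : RightAction X G} (hρ : ρ.IsFree)
    (eX : X ≅ SSp A) (eG : G.toKFunctor ≅ SSp B) {π : X ⟶ Y} (hπ : ρ.IsTorsor π)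
    (hY : ∀ {R S : SAlg K} (φ : R ⟶ S), NCFlat.FaithfullyFlat (Hom.ringHom φ) →
      Function.Injective (Y.map φ)) (y : Y.obj R) :
    ∃ (C : SAlg K) (r : R ⟶ C) (x : X.obj C), NCFlat.FaithfullyFlat (Hom.ringHom r) ∧
      π.app C x = Y.map r y ∧ ∀ (S : SAlg K) (h : R ⟶ S) (x' : X.obj S),
        π.app S x' = Y.map h y → ∃! k : C ⟶ S, r ≫ k = h ∧ X.map k x = x' := by
  have hX := ffDescent_of_iso eX
  obtain ⟨R', φ, x₀, hφ, hx₀⟩ := hπ.exists_lift R y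
  obtain ⟨E, s, t, hE⟩ := exists_isPushout (fromField R') (fromField B)
  -- The unit of G(K) is a morphism B → K. Hence B is nonzero and faithfully flat over K, so R' → E
  -- is faithfully flat.
  have hB : Nontrivial B := by
    have f := coord eG (1 : G.obj (ofComm (K := K) K))
    have : Nontrivial (ofComm (K := K) K) := inferInstanceAs (Nontrivial K)
    exact (Hom.ringHom f).domain_nontrivial
  have hs : NCFlat.FaithfullyFlat (Hom.ringHom s) := hE.faithfullyFlat
    (NCFlat.faithfullyFlat_of_field (k := K) (Hom.ringHom (fromField B)))
  -- The universal translate of the local lift x₀. By freeness (`huniq`) and transitivity on fibres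
  -- (`hex`), (E, x₁) represents the fibre over R'.
  let x₁ : X.obj E := ρ.act E (X.map s x₀) (ofCoord eG t)
  have hx₁ : π.app E x₁ = Y.map (φ ≫ s) y := by
    rw [hπ.act, app_map, hx₀, map_comp_apply]
  have hact : ∀ {S : SAlg K} (k : E ⟶ S),
      X.map k x₁ = ρ.act S (X.map (s ≫ k) x₀) (ofCoord eG (t ≫ k)) := fun k => by
    rw [ρ.naturality, ← map_comp_apply]
    exact congrArg _ (ofCoord_map eG k t)
  have huniq : ∀ {S : SAlg K} (k k' : E ⟶ S), s ≫ k = s ≫ k' → X.map k x₁ = X.map k' x₁ →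
      k = k' := by
    intro S k k' h1 h2
    rw [hact, hact, ← h1] at h2
    have h3 := congrArg (coord eG) (hρ.act_injective h2)
    rw [coord_ofCoord, coord_ofCoord] at h3
    exact hE.hom_ext h1 h3
  have hex : ∀ {S : SAlg K} (j : R' ⟶ S) (x' : X.obj S), π.app S x' = Y.map (φ ≫ j) y →
      ∃ k : E ⟶ S, s ≫ k = j ∧ X.map k x₁ = x' := by
    intro S j x' hx'
    obtain ⟨g, hg⟩ := hπ.exists_act S (X.map j x₀) x' (by
      rw [app_map, hx₀, ← map_comp_apply, hx'])
    obtain ⟨k, hk1, hk2⟩ := hE.exists_desc j (coord eG (R := S) g) (by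
      rw [fromField_comp, fromField_comp])
    refine ⟨k, hk1, ?_⟩
    rw [hact, hk1, hk2, ← hg]
    exact congrArg _ (ofCoord_coord eG (R := S) g)
  obtain ⟨E', d₁, w, hE'⟩ := exists_isPushout (φ ≫ s) φ
  -- The descent datum: d₂ classifies the pullback of x₁ along d₁, seen relative to the second copy
  -- of R'. So x₁ has the same image under d₁ and d₂, and the unit and cocycle conditions follow
  -- from `huniq`.
  obtain ⟨d₂, hd₂, hd₂x⟩ := hex w (X.map d₁ x₁) (by
    rw [app_map, hx₁, ← map_comp_apply, hE'.comm])
  obtain ⟨r, hr⟩ := exists_factor (equalizerι d₁ d₂) (equalizerι_injective d₁ d₂) (φ ≫ s)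
    (fun a => exists_equalizer_of_eq d₁ d₂ (by
      have h1 : (φ ≫ s) ≫ d₁ = (φ ≫ s) ≫ d₂ := by rw [hE'.comm, Category.assoc, hd₂]
      exact congrArg (fun k => Hom.ringHom k a) h1))
  have hP : SAlg.IsPushout r φ (equalizerι d₁ d₂) s := by
    refine isPushout_equalizer hφ.1 hE' hd₂ (fun p h1 h2 => ?_) (fun Q D₁ D₂ q h1 h2 h3 => ?_) hr
    · refine huniq _ _ ?_ ?_
      · rw [← Category.assoc, hd₂, h2, Category.comp_id]
      · rw [map_comp_apply, hd₂x, ← map_comp_apply, h1]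
    · refine huniq _ _ ?_ ?_
      · rw [← Category.assoc, ← Category.assoc, hd₂, h1]
      · rw [map_comp_apply, map_comp_apply, hd₂x, ← map_comp_apply, ← map_comp_apply, h2, h3,
          map_comp_apply, map_comp_apply, hd₂x]
  set ι := equalizerι d₁ d₂
  have hι : NCFlat.FaithfullyFlat (Hom.ringHom ι) := hP.faithfullyFlat hφ
  have hιd : ι ≫ d₁ = ι ≫ d₂ := SAlg.hom_ext fun c => equalizer_condition d₁ d₂ c
  have hrι : NCFlat.FaithfullyFlat (Hom.ringHom (r ≫ ι)) := by
    rw [hr]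
    exact hφ.comp hs
  obtain ⟨a, ha⟩ := exists_factor ι (equalizerι_injective d₁ d₂) (coord eX x₁) (fun a =>
    exists_equalizer_of_eq d₁ d₂ (by
      have h1 : coord eX x₁ ≫ d₁ = coord eX x₁ ≫ d₂ := by rw [← coord_map, ← coord_map, hd₂x]
      exact congrArg (fun k => Hom.ringHom k a) h1))
  let x : X.obj (equalizer d₁ d₂) := ofCoord eX a
  have hx : X.map ι x = x₁ := by rw [ofCoord_map, ha, ofCoord_coord]
  -- R → C is faithfully flat because C → E is, as a base change of φ, and R → E is, as a composite.
  refine ⟨equalizer d₁ d₂, r, x, NCFlat.FaithfullyFlat.of_comp hι hrι, ?_, fun S h x' hx' => ?_⟩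
  · refine hY ι hι ?_
    rw [← app_map, hx, hx₁, ← map_comp_apply, hr]
  obtain ⟨S', α, β, hS⟩ := exists_isPushout h φ
  have hα := hS.faithfullyFlat hφ
  have hαinj : ∀ {Q : SAlg K} (k k' : Q ⟶ S), k ≫ α = k' ≫ α → k = k' := fun k k' e =>
    SAlg.hom_ext fun c => hα.injective (congrArg (fun k => Hom.ringHom k c) e)
  -- A point of the fibre over S is first classified over S' = S ⊗_R R', by k' on E. Only the
  -- restriction of k' to C can be expected to descend to S.
  obtain ⟨k', hk', hk'x⟩ := hex β (X.map α x') (by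
    rw [app_map, hx', ← map_comp_apply, hS.comm])
  obtain ⟨P, p, q, hpq⟩ := exists_isPushout α α
  -- The two composites from E have different bases but classify the same point of X, so they are d₁
  -- and d₂ followed by a common l : E' → P. They agree on C, which equalizes d₁ and d₂.
  have hpq' : ι ≫ k' ≫ p = ι ≫ k' ≫ q := by
    obtain ⟨l, hl1, hl2⟩ := hE'.exists_desc (k' ≫ p) (β ≫ q) (by
      rw [Category.assoc, ← Category.assoc s, hk', ← Category.assoc φ, ← hS.comm, Category.assoc,
        hpq.comm, ← Category.assoc, hS.comm, Category.assoc])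
    have h2 : d₂ ≫ l = k' ≫ q := huniq _ _ (by
      rw [← Category.assoc, hd₂, hl2, ← Category.assoc, hk']) (by
      rw [map_comp_apply, hd₂x, ← map_comp_apply, hl1, map_comp_apply, hk'x, ← map_comp_apply,
        hpq.comm, map_comp_apply X k' q, hk'x, map_comp_apply])
    rw [← hl1, ← h2, ← Category.assoc, hιd, Category.assoc]
  obtain ⟨k, hk⟩ := exists_factor α hα.injective (ι ≫ k') (fun c => by
    refine eq_unit_of_isPushout hpq hα ?_
    exact congrArg (fun k => Hom.ringHom k c) hpq')
  have hrk : r ≫ k = h := hαinj _ _ (by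
    rw [Category.assoc, hk, ← Category.assoc, hr, Category.assoc, hk', hS.comm])
  refine ⟨k, ⟨hrk, hX.injective α hα ?_⟩, fun l hl => hαinj _ _ ?_⟩
  · rw [← map_comp_apply, hk, map_comp_apply, hx, hk'x]
  · obtain ⟨m, hm1, hm2⟩ := hP.exists_desc (l ≫ α) β (by rw [← Category.assoc, hl.1, hS.comm])
    have h3 : m = k' := huniq _ _ (by rw [hm2, hk']) (by
      rw [← hx, ← map_comp_apply, hm1, map_comp_apply, hl.2, ← hk'x, ← hx])
    rw [← hm1, h3, hk]

end KFunctor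

/-! ### Open immersions of affine superschemes are flat; odd elements and primes -/

namespace SAlg

open MulOpposite

variable {K : Type u} [Field K] [NeZero (2 : K)] {C A : SAlg K}

/-- Morphisms of coordinate superalgebras dual to open immersions are flat. -/
theorem flat_of_isOpenImmersion (h : C ⟶ A)
    (hepi : ∀ (S : SAlg K) (l l' : A ⟶ S), h ≫ l = h ≫ l' → l = l') (I : Ideal C.even)
    (hI : ∀ (S : SAlg K) (k : C ⟶ S), (∃ l, h ≫ l = k) ↔ I.map (Hom.even k) = ⊤) :
    NCFlat.Flat (Hom.ringHom h) := by
  intro N N' _ _ _ _ g hg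
  refine (injective_iff_map_eq_zero _).2 fun t ht => ?_
  -- The morphism h factors through itself, so the images of the elements of I generate the unit
  -- ideal of A₀, and vanishing of t may be tested locally at them.
  have htop := (hI A h).1 ⟨𝟙 A, Category.comp_id h⟩
  have hspan : Ideal.span (Set.range fun f : I => Hom.even h f) = ⊤ := by
    rw [← htop, Ideal.map]
    congr 1
    exact (Set.image_eq_range _ _).symm
  let _ := evenModule A (NCFlat.Tensor (Hom.ringHom h) N)
  refine eq_zero_of_local hspan (x := t) fun f => ?_
  -- Since f ∈ I becomes a unit in C_f, the map C → C_f factors through l : A → C_f, and l followed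
  -- by C_f → A_f is the localization of A. So t dies in N ⊗ C_f by flatness of C_f, then in N ⊗
  -- A_f, and a power of f kills it.
  obtain ⟨l, hl⟩ := (hI _ (locMap C f)).2 ((map_even_eq_top_iff _ _).2 fun q hq =>
    specMap_mem_basicOpen (isLocalizationAway_locMap C f).isUnit q (hq f.2))
  obtain ⟨m, hm⟩ := (isLocalizationAway_locMap C f).exists_desc
    (h ≫ locMap A (Hom.even h f)) (isLocalizationAway_locMap A (Hom.even h f)).isUnit
  have hlm : l ≫ m = locMap A (Hom.even h f) := hepi _ _ _ (by rw [← Category.assoc, hl, hm])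
  let L : ∀ (M : Type u) [AddCommGroup M] [Module (C : Type u)ᵐᵒᵖ M],
      NCFlat.Tensor (Hom.ringHom h) M →+ NCFlat.Tensor (Hom.ringHom (locMap C f)) M :=
    fun M _ _ => NCFlat.lmap (Hom.ringHom l).toAddMonoidHom (fun a b => by
      rw [← hl]
      exact map_mul (Hom.ringHom l) _ _)
  have h1 : L N t = 0 := by
    refine flat_locMap C f N N' g hg ?_
    rw [map_zero, ← NCFlat.lmap_map, ht, map_zero]
  let M : NCFlat.Tensor (Hom.ringHom (locMap C f)) N →+
      NCFlat.Tensor ((Hom.ringHom (locMap A (Hom.even h f))).comp (Hom.ringHom h)) N :=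
    NCFlat.lmap (Hom.ringHom m).toAddMonoidHom (fun a b => by
      refine (map_mul (Hom.ringHom m) _ _).trans ?_
      rw [← ringHom_comp_apply, hm]
      rfl)
  have h2 : ∀ t, NCFlat.toIterated (Hom.ringHom h) (Hom.ringHom (locMap A (Hom.even h f))) N
      (M (L N t)) = NCFlat.tmul (Hom.ringHom (locMap A (Hom.even h f))) t 1 := by
    intro t
    refine NCFlat.tensor_induction t (by simp) (fun n b => ?_) (fun x y hx hy => ?_)
    · change NCFlat.tmul _ (NCFlat.tmul _ n 1) (Hom.ringHom m (Hom.ringHom l b)) = _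
      rw [← ringHom_comp_apply, hlm, ← mul_one (Hom.ringHom (locMap A (Hom.even h f)) b),
        ← NCFlat.smul_tmul, NCFlat.op_smul_tmul, one_mul]
    · rw [map_add, map_add, map_add, hx, hy, NCFlat.add_tmul]
  have h3 := h2 t
  rw [h1, map_zero, map_zero] at h3
  obtain ⟨k, hk⟩ := exists_smul_eq_zero_of_unit_loc A (Hom.even h f) _ t h3.symm
  exact ⟨k, hk⟩

lemma mem_of_isPrime_of_odd {p : Ideal C} (hp : p.IsPrime) {a : C} (ha : a ∈ C.grading 1) :
    a ∈ p := by
  have h : a * a ∈ p := by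
    rw [odd_mul_self ha]
    exact zero_mem _
  exact (hp.mem_or_mem h).elim id id

lemma mem_iff_proj_mem_of_isPrime {p : Ideal C} (hp : p.IsPrime) {a : C} :
    a ∈ p ↔ C.proj 0 a ∈ p := by
  conv_lhs => rw [← proj_add_proj a]
  exact Ideal.add_mem_iff_left p (mem_of_isPrime_of_odd hp (C.proj_mem 1 a))

lemma isPrime_evenIdeal {p : Ideal C} (hp : p.IsPrime) : (evenIdeal p).IsPrime where
  ne_top' h := hp.ne_top ((Ideal.eq_top_iff_one _).2 ((Ideal.eq_top_iff_one (evenIdeal p)).1 h))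
  mem_or_mem' h := hp.mem_or_mem h

lemma isPrime_ker_resMap (q : PrimeSpectrum C.even) :
    (RingHom.ker (Hom.ringHom (resMap q))).IsPrime where
  ne_top' h := by
    have := (Ideal.eq_top_iff_one _).1 h
    rw [RingHom.mem_ker, map_one] at this
    exact one_ne_zero this
  mem_or_mem' {a b} h := by
    rw [RingHom.mem_ker, map_mul] at h
    exact mul_eq_zero (M₀ := q.asIdeal.ResidueField).1 h

lemma mem_ker_resMap {q : PrimeSpectrum C.even} {a : C} :
    a ∈ RingHom.ker (Hom.ringHom (resMap q)) ↔ C.evenProj a ∈ q.asIdeal := by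
  rw [mem_iff_proj_mem_of_isPrime (isPrime_ker_resMap q), RingHom.mem_ker]
  exact resMap_eq_zero q (C.evenProj a)

end SAlg

/-! ### Affineness, flatness and surjectivity from representable fibres -/

namespace KFunctor

open SAlg

variable {K : Type u} [Field K] [NeZero (2 : K)]
variable {X Y Z : KFunctor K} {A B R S : SAlg K}

/-- Odd elements square to zero, so they lie in every prime, and a prime is determined by its even
part. A prime of S over p is the kernel of the map to the residue field at a point over the even
part of p. -/
lemma comap_surjective {φ : R ⟶ S} (hφ : NCFlat.FaithfullyFlat (Hom.ringHom φ)) :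
    Function.Surjective (SSpec.comap φ) := by
  rintro ⟨p, hp⟩
  obtain ⟨q, hq⟩ := specMap_surjective hφ ⟨evenIdeal p, isPrime_evenIdeal hp⟩
  refine ⟨⟨_, isPrime_ker_resMap q⟩, Subtype.ext (Ideal.ext fun a => ?_)⟩
  change Hom.ringHom φ a ∈ RingHom.ker _ ↔ a ∈ p
  rw [mem_ker_resMap, mem_iff_proj_mem_of_isPrime hp]
  have h1 : S.evenProj (Hom.ringHom φ a) = Hom.even φ (R.evenProj a) :=
    Subtype.ext (ringHom_proj φ 0 a).symm
  rw [h1, ← mem_specMap, hq]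
  rfl

/-- The fibres of `π` are represented by faithfully flat superalgebras. -/
def HasFibers (π : X ⟶ Y) : Prop :=
  ∀ (R : SAlg K) (y : Y.obj R), ∃ (C : SAlg K) (r : R ⟶ C) (x : X.obj C),
    NCFlat.FaithfullyFlat (Hom.ringHom r) ∧ π.app C x = Y.map r y ∧
      ∀ (S : SAlg K) (h : R ⟶ S) (x' : X.obj S),
        π.app S x' = Y.map h y → ∃! k : C ⟶ S, r ≫ k = h ∧ X.map k x = x'

/-- The representing property of C says precisely that SSp C is the fibre product. -/
lemma HasFibers.isAffineMorphism {π : X ⟶ Y} (hπ : HasFibers π) : IsAffineMorphism π := by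
  intro R g
  obtain ⟨C, r, x, -, hx, hC⟩ := hπ R (g.app R (SSp.mk (𝟙 R)))
  refine ⟨C, ⟨?_⟩⟩
  have hg : ∀ {S : SAlg K} (a : (SSp R).obj S),
      g.app S a = Y.map (SSp.hom a) (g.app R (SSp.mk (𝟙 R))) := fun a => by
    conv_lhs => rw [eq_ofPoint g]
    rfl
  have hcomm : ofPoint x ≫ π = SSp.map r ≫ g := by
    ext S a
    change π.app S (X.map (SSp.hom a) x) = g.app S (SSp.mk (r ≫ SSp.hom a))
    rw [app_map, hx, ← map_comp_apply]
    exact (hg _).symm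
  have key : ∀ (s : Limits.PullbackCone π g) (S : SAlg K) (t : s.pt.obj S),
      ∃! k : C ⟶ S, r ≫ k = SSp.hom (s.snd.app S t) ∧ X.map k x = s.fst.app S t := by
    intro s S t
    refine hC S _ _ ?_
    rw [← hg]
    exact congrArg (fun k => k.app S t) s.condition
  choose k hk huniq using key
  have hlim : Limits.IsLimit (Limits.PullbackCone.mk _ _ hcomm) :=
    Limits.PullbackCone.IsLimit.mk hcomm
      (fun s =>
        { app := fun S => ↾fun t => SSp.mk (k s S t)
          naturality := fun S T f => by
            ext t
            refine congrArg SSp.mk (huniq s T (s.pt.map f t) (k s S t ≫ f) ⟨?_, ?_⟩).symm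
            · rw [← Category.assoc, (hk s S t).1, app_map]
              rfl
            · rw [map_comp_apply, (hk s S t).2, app_map] })
      (fun s => by
        ext S t
        exact (hk s S t).2)
      (fun s => by
        ext S t
        exact congrArg SSp.mk (hk s S t).1)
      (fun s m h1 h2 => by
        ext S t
        refine SSp.hom_injective (huniq s S t (SSp.hom (m.app S t)) ⟨?_, ?_⟩)
        · exact congrArg (fun f => SSp.hom (f.app S t)) h2
        · exact congrArg (fun f => f.app S t) h1)
  exact (Limits.limit.isLimit (Limits.cospan π g)).conePointUniqueUpToIso hlim

/-- With SSp C the fibre of π over SSp B, the morphism φ factors as B → C → A. The first arrow is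
faithfully flat, and the second is dual to the inclusion of the open subfunctor SSp A into SSp C. -/
lemma HasFibers.isFlat {π : X ⟶ Y} (hπ : HasFibers π) : IsFlat π := by
  intro A B i j φ hi hj hij
  let y : Y.obj B := j.app B (SSp.mk (𝟙 B))
  let x₁ : X.obj A := i.app A (SSp.mk (𝟙 A))
  have hiA : ∀ {S : SAlg K} (l : A ⟶ S), i.app S (SSp.mk l) = X.map l x₁ := fun l =>
    app_map i l (SSp.mk (𝟙 A)) |>.symm ▸ rfl
  have hjB : ∀ {S : SAlg K} (l : B ⟶ S), j.app S (SSp.mk l) = Y.map l y := fun l =>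
    app_map j l (SSp.mk (𝟙 B)) |>.symm ▸ rfl
  have hx₁ : π.app A x₁ = Y.map φ y := by
    rw [← hjB]
    have h1 := congrArg (fun k => k.app A (SSp.mk (𝟙 A))) hij
    exact h1.symm.trans (congrArg (fun l => j.app A (SSp.mk l)) (Category.comp_id φ))
  obtain ⟨C, r, x, hr, hx, hC⟩ := hπ B y
  obtain ⟨h, ⟨hrh, hhx⟩, -⟩ := hC A φ x₁ hx₁
  have hYinj : ∀ {S : SAlg K} (l l' : B ⟶ S), Y.map l y = Y.map l' y → l = l' := by
    intro S l l' e
    rw [← hjB, ← hjB] at e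
    exact congrArg SSp.hom (hj.1 S e)
  obtain ⟨I, hI⟩ := IsOpen.exists_ideal hi.2 x
  have hflat : NCFlat.Flat (Hom.ringHom h) := by
    refine flat_of_isOpenImmersion h (fun S l l' e => ?_) I (fun S k => ?_)
    · have h1 : i.app S (SSp.mk l) = i.app S (SSp.mk l') := by
        rw [hiA, hiA, ← hhx, ← map_comp_apply, e, map_comp_apply]
      exact congrArg SSp.hom (hi.1 S h1)
    · rw [← hI]
      constructor
      · rintro ⟨l, rfl⟩
        refine ⟨SSp.mk l, ?_⟩
        rw [hiA, map_comp_apply, hhx]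
      · rintro ⟨l, hl⟩
        have hl' : X.map (SSp.hom l) x₁ = X.map k x := by rw [← hiA, ← hl]; rfl
        refine ⟨SSp.hom l, ?_⟩
        -- The points l of A and k of C have the same image in X, hence in Y; as SSp B embeds in Y,
        -- they have the same base, so uniqueness in the fibre identifies h followed by l with k.
        have h2 : r ≫ h ≫ SSp.hom l = r ≫ k := hYinj _ _ (by
          calc Y.map (r ≫ h ≫ SSp.hom l) y = Y.map (φ ≫ SSp.hom l) y := by
                rw [← Category.assoc, hrh]
            _ = Y.map (SSp.hom l) (Y.map φ y) := map_comp_apply _ _ _ _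
            _ = Y.map (SSp.hom l) (π.app A x₁) := congrArg _ hx₁.symm
            _ = π.app S (X.map (SSp.hom l) x₁) := (app_map π _ _).symm
            _ = π.app S (X.map k x) := congrArg _ hl'
            _ = Y.map k (π.app C x) := app_map π _ _
            _ = Y.map k (Y.map r y) := congrArg _ hx
            _ = Y.map (r ≫ k) y := (map_comp_apply _ _ _ _).symm)
        refine (hC S (r ≫ k) (X.map k x) ((app_map π k x).trans
          ((congrArg _ hx).trans (map_comp_apply _ _ _ _).symm))).unique
          ⟨h2, ?_⟩ ⟨rfl, rfl⟩
        rw [map_comp_apply, hhx, hl']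
  rw [← hrh]
  exact hr.1.comp hflat

lemma HasFibers.surjective_points {π : X ⟶ Y} (hπ : HasFibers π) :
    Function.Surjective (Points.map π) := by
  intro z
  obtain ⟨⟨R, y, p⟩, rfl⟩ := Quot.exists_rep z
  obtain ⟨R', φ, x, hφ, hx, -⟩ := hπ R y
  obtain ⟨q, rfl⟩ := comap_surjective hφ p
  refine ⟨Quot.mk _ ⟨R', x, q⟩, ?_⟩
  change Quot.mk _ (⟨R', π.app R' x, q⟩ : PrePoint Y) = _
  rw [hx]
  exact Quot.sound (PrePoint.Rel.glue φ y q)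

lemma hasFibers_quotientMap {G : Supergroup K} {ρ : RightAction X G} (hρ : ρ.IsFree)
    (eX : X ≅ SSp A) (eG : G.toKFunctor ≅ SSp B) (hY : ρ.quotient.IsSuperscheme) :
    HasFibers ρ.quotientMap := fun _ y =>
  exists_fiber hρ eX eG (isTorsor_quotientMap hρ eX eG hY)
    (fun _ hφ => hY.injective_of_faithfullyFlat hφ) y

/-- The quotient morphism of a free action on an affine superscheme is affine and faithfully
flat. -/
theorem isAffineMorphism_and_isFaithfullyFlat {G : Supergroup K} {ρ : RightAction X G}
    (hρ : ρ.IsFree) (eX : X ≅ SSp A) (eG : G.toKFunctor ≅ SSp B) (hY : ρ.quotient.IsSuperscheme) :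
    IsAffineMorphism ρ.quotientMap ∧ IsFaithfullyFlat ρ.quotientMap := by
  have hf := hasFibers_quotientMap hρ eX eG hY
  exact ⟨hf.isAffineMorphism, hf.isFlat, hf.surjective_points⟩

end KFunctor

/-! ### Noetherian superalgebras -/

namespace SAlg

open MulOpposite

variable {K : Type u} [Field K] [NeZero (2 : K)] {A C R : SAlg K}

lemma proj_mul_of_mem {i : ZMod 2} {t : A} (ht : t ∈ A.grading i) (a : A) :
    A.proj i (a * t) = A.proj 0 a * t := by
  have h1 : A.proj i (A.proj 1 a * t) = 0 :=
    proj_of_mem_ne (mul_mem_graded (A.proj_mem 1 a) ht) (by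
      rw [ne_eq, add_eq_right]
      exact one_ne_zero)
  have h0 : A.proj 0 a * t ∈ A.grading i := by
    simpa using mul_mem_graded (A.proj_mem 0 a) ht
  conv_lhs => rw [← A.proj_add_proj a]
  rw [add_mul, map_add, h1, add_zero, proj_of_mem h0]

lemma proj_mul_of_mem' {i : ZMod 2} {t : A} (ht : t ∈ A.grading i) (a : A) :
    A.proj i (t * a) = t * A.proj 0 a := by
  have h1 : A.proj i (t * A.proj 1 a) = 0 :=
    proj_of_mem_ne (mul_mem_graded ht (A.proj_mem 1 a)) (by
      rw [ne_eq, add_eq_left]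
      exact one_ne_zero)
  have h0 : t * A.proj 0 a ∈ A.grading i := by
    simpa using mul_mem_graded ht (A.proj_mem 0 a)
  conv_lhs => rw [← A.proj_add_proj a]
  rw [mul_add, map_add, h1, add_zero, proj_of_mem h0]

lemma proj_even_mul {a : A} (ha : a ∈ A.grading 0) (i : ZMod 2) (b : A) :
    A.proj i (a * b) = a * A.proj i b := by
  have h : ∀ j, a * A.proj j b ∈ A.grading j := fun j => by
    simpa using mul_mem_graded ha (A.proj_mem j b)
  conv_lhs => rw [← A.proj_add_proj b]
  rw [mul_add, map_add]
  rcases zmod_two_cases i with rfl | rfl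
  · rw [proj_of_mem (h 0), proj_of_mem_ne (h 1) (by decide), add_zero]
  · rw [proj_of_mem (h 1), proj_of_mem_ne (h 0) (by decide), zero_add]

/-- The homogeneous component, as a linear map over the even part. -/
def projEven (A : SAlg K) (i : ZMod 2) : A →ₗ[A.even] A where
  toFun := A.proj i
  map_add' := map_add _
  map_smul' a b := proj_even_mul a.2 i b

/-- Faithfully flat descent of the Noetherian property. -/
theorem isNoetherianRing_of_faithfullyFlat {φ : R ⟶ C}
    (hφ : NCFlat.FaithfullyFlat (Hom.ringHom φ)) [IsNoetherianRing C] : IsNoetherianRing R := by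
  -- Ideals of R are R₀-submodules of R₀ ⊕ R₁, so it suffices to treat R₀-submodules of homogeneous
  -- elements of one degree.
  have key : ∀ (i : ZMod 2) (M : Submodule R.even R), (∀ m ∈ M, m ∈ R.grading i) → M.FG := by
    intro i M hM
    obtain ⟨s, hs, ht⟩ := (Submodule.fg_span_iff_fg_span_finset_subset
      (Hom.ringHom φ '' (M : Set R))).1 (IsNoetherian.noetherian (R := C) (Ideal.span _))
    classical
    obtain ⟨t, htM, rfl⟩ := Finset.subset_set_image_iff.1 hs
    refine ⟨t, le_antisymm (Submodule.span_le.2 htM) fun m hm => ?_⟩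
    -- In C, φ(m) is a left combination of the φ(a), a ∈ t. Taking degree i components makes the
    -- coefficients even, so they can be moved to the right; then m dies in (R / J) ⊗_R C and lies
    -- in J by faithful flatness.
    let J : Submodule Rᵐᵒᵖ R := Submodule.span _ (t : Set R)
    have h1 : m ∈ J := by
      have h2 : Hom.ringHom φ m ∈ Submodule.span C ((t.image (Hom.ringHom φ) : Finset C) : Set C) := by
        rw [← ht]
        exact Submodule.subset_span ⟨m, hm, rfl⟩
      obtain ⟨c, -, hc⟩ := Submodule.mem_span_finset.1 h2
      have h3 := congrArg (C.proj i) hc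
      rw [proj_of_mem (ringHom_mem φ (hM m hm)), map_sum] at h3
      rw [← Submodule.Quotient.mk_eq_zero J]
      refine hφ.unit_injective _ (Eq.trans ?_ (map_zero _).symm)
      change NCFlat.tmul (Hom.ringHom φ) (Submodule.Quotient.mk m : R ⧸ J) 1 = 0
      have h4 : ∀ a : R, (Submodule.Quotient.mk a : R ⧸ J) =
          op a • (Submodule.Quotient.mk 1 : R ⧸ J) := fun a => by
        rw [← Submodule.Quotient.mk_smul, op_smul_eq_mul, one_mul]
      rw [h4, NCFlat.smul_tmul, mul_one, ← h3, ← NCFlat.tmulHom_apply, map_sum]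
      refine Finset.sum_eq_zero fun b hb => ?_
      obtain ⟨a, ha, rfl⟩ := Finset.mem_image.1 hb
      have hai := ringHom_mem φ (hM a (htM ha))
      have h5 : C.proj i (c (Hom.ringHom φ a) • Hom.ringHom φ a) =
          Hom.ringHom φ a * C.proj 0 (c (Hom.ringHom φ a)) :=
        (proj_mul_of_mem hai _).trans (C.even_comm _ (C.proj_mem 0 _) _)
      rw [h5, NCFlat.tmulHom_apply, ← NCFlat.smul_tmul, ← h4,
        (Submodule.Quotient.mk_eq_zero J).2 (Submodule.subset_span ha), NCFlat.zero_tmul]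
    obtain ⟨c, -, hc⟩ := Submodule.mem_span_finset.1 h1
    -- The coefficients in R are again replaced by their even components by projecting to degree i,
    -- which places m in the R₀-span of t.
    rw [← proj_of_mem (hM m hm), ← hc, map_sum]
    refine sum_mem fun a ha => ?_
    have h6 : R.proj i (c a • a) = R.evenProj (unop (c a)) • a :=
      (proj_mul_of_mem' (hM a (htM ha)) _).trans (R.even_comm _ (R.proj_mem 0 _) a).symm
    rw [h6]
    exact Submodule.smul_mem _ _ (Submodule.subset_span ha)
  refine isNoetherian_of_tower R.even ⟨fun M => ?_⟩
  refine Submodule.fg_of_fg_map_of_fg_inf_ker (R.projEven 0) (key 0 _ ?_) (key 1 _ ?_)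
  · rintro _ ⟨m, -, rfl⟩
    exact R.proj_mem 0 m
  · rintro m ⟨-, hm⟩
    have h : R.proj 0 m = 0 := hm
    rw [← R.proj_add_proj m, h, zero_add]
    exact R.proj_mem 1 m

/-- Open subfunctors of Noetherian affine superschemes are Noetherian. -/
theorem isNoetherianRing_of_isOpenImmersion (h : C ⟶ A)
    (hepi : ∀ (S : SAlg K) (l l' : A ⟶ S), h ≫ l = h ≫ l' → l = l') (I : Ideal C.even)
    (hI : ∀ (S : SAlg K) (k : C ⟶ S), (∃ l, h ≫ l = k) ↔ I.map (Hom.even k) = ⊤)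
    [IsNoetherianRing C] : IsNoetherianRing A := by
  have htop := (hI A h).1 ⟨𝟙 A, Category.comp_id h⟩
  have hspan : Ideal.span (Set.range fun f : I => Hom.even h f) = ⊤ := by
    rw [← htop, Ideal.map]
    congr 1
    exact (Set.image_eq_range _ _).symm
  refine ⟨fun (J : Ideal A) => ?_⟩
  -- Every left ideal of A is generated by its contraction to C: for a ∈ J, a power of f ∈ I times a
  -- comes from C, and these f generate the unit ideal of A₀.
  suffices hJ : J = (J.comap (Hom.ringHom h)).map (Hom.ringHom h) by
    obtain ⟨s, hs⟩ := (isNoetherianRing_iff_ideal_fg C).1 ‹_› (J.comap (Hom.ringHom h))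
    classical
    refine ⟨s.image (Hom.ringHom h), ?_⟩
    rw [hJ, ← hs, Finset.coe_image]
    exact (Ideal.map_span _ _).symm
  refine le_antisymm (fun a ha => ?_) Ideal.map_comap_le
  refine Submodule.mem_of_span_eq_top_of_smul_pow_mem
    (((J.comap (Hom.ringHom h)).map (Hom.ringHom h)).restrictScalars A.even) _ hspan a ?_
  rintro ⟨_, f, rfl⟩
  obtain ⟨l, hl⟩ := (hI _ (locMap C f)).2 ((map_even_eq_top_iff _ _).2 fun q hq =>
    specMap_mem_basicOpen (isLocalizationAway_locMap C f).isUnit q (hq f.2))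
  obtain ⟨m, hm⟩ := (isLocalizationAway_locMap C f).exists_desc
    (h ≫ locMap A (Hom.even h f)) (isLocalizationAway_locMap A (Hom.even h f)).isUnit
  have hlm : l ≫ m = locMap A (Hom.even h f) := hepi _ _ _ (by rw [← Category.assoc, hl, hm])
  obtain ⟨n, c, hc⟩ := (isLocalizationAway_locMap C f).surj (Hom.ringHom l a)
  have h1 : Hom.ringHom (locMap A (Hom.even h f))
      (Hom.ringHom h f ^ n * a - Hom.ringHom h c) = 0 := by
    have h2 := congrArg (Hom.ringHom m) hc
    rw [← map_pow, map_mul, ← ringHom_comp_apply, ← ringHom_comp_apply, ← ringHom_comp_apply, hm,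
      hlm, ringHom_comp_apply, ringHom_comp_apply] at h2
    rw [map_sub, map_mul, ← map_pow, h2, sub_self]
  obtain ⟨k, hk⟩ := (isLocalizationAway_locMap A (Hom.even h f)).eq_zero _ h1
  have h3 : Hom.ringHom h f ^ (k + n) * a = Hom.ringHom h ((f : C) ^ k * c) := by
    rw [map_mul, map_pow, pow_add, mul_assoc]
    exact sub_eq_zero.1 ((mul_sub _ _ _).symm.trans hk)
  refine ⟨k + n, ?_⟩
  change Hom.ringHom h f ^ (k + n) * a ∈ _
  rw [h3]
  refine Ideal.mem_map_of_mem _ ?_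
  rw [Ideal.mem_comap, ← h3]
  exact J.mul_mem_left _ ha

/-- Finitely generated superalgebras are Noetherian. -/
theorem isNoetherianRing_of_finiteType [hA : Algebra.FiniteType K A] : IsNoetherianRing A := by
  classical
  obtain ⟨s, hs⟩ := hA.out
  -- The even components of the generators span a commutative Noetherian algebra E over which A is
  -- finite: products of distinct odd components of the generators suffice, as odd elements
  -- anticommute and square to zero.
  let E : Subalgebra K A.even := Algebra.adjoin K (s.image A.evenProj : Finset A.even)
  have hE : IsNoetherianRing E := by
    have : Algebra.FiniteType K E := E.fg_iff_finiteType.1 ⟨_, rfl⟩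
    exact Algebra.FiniteType.isNoetherianRing K E
  have key : ∀ t : Finset A, (∀ y ∈ t, y ∈ A.grading 1) → ∃ M : Submodule E A, M.FG ∧ 1 ∈ M ∧
      ∀ y ∈ t, ∀ m ∈ M, y * m ∈ M := by
    intro t
    induction t using Finset.induction_on with
    | empty =>
      exact fun _ => ⟨Submodule.span E {1}, Submodule.fg_span_singleton _,
        Submodule.mem_span_singleton_self _, by simp⟩
    | insert y t _ ih =>
      intro ht
      obtain ⟨M, hM, h1, hMt⟩ := ih fun z hz => ht z (Finset.mem_insert_of_mem hz)
      have hy := ht y (Finset.mem_insert_self _ _)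
      let L : A →ₗ[E] A :=
        { toFun := fun a => y * a
          map_add' := mul_add y
          map_smul' := fun e a => mul_smul_comm (e : A.even) y a }
      -- Adjoining yM gives stability under y because y² = 0, and keeps stability under the earlier
      -- odd elements because they anticommute with y.
      refine ⟨M ⊔ M.map L, hM.sup (hM.map L), Submodule.mem_sup_left h1, fun z hz m hm => ?_⟩
      obtain ⟨a, ha, _, ⟨b, hb, rfl⟩, rfl⟩ := Submodule.mem_sup.1 hm
      change z * (a + y * b) ∈ _
      rw [mul_add, ← mul_assoc]
      rcases Finset.mem_insert.1 hz with rfl | hz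
      · rw [odd_mul_self hy, zero_mul, add_zero]
        exact Submodule.mem_sup_right ⟨a, ha, rfl⟩
      · rw [A.odd_anticomm _ (ht z (Finset.mem_insert_of_mem hz)) _ hy, neg_mul, mul_assoc]
        exact add_mem (Submodule.mem_sup_left (hMt z hz a ha))
          (neg_mem (Submodule.mem_sup_right ⟨z * b, hMt z hz b hb, rfl⟩))
  obtain ⟨M, hM, h1, hMt⟩ := key (s.image (A.proj 1)) (by
    intro y hy
    obtain ⟨a, -, rfl⟩ := Finset.mem_image.1 hy
    exact A.proj_mem 1 a)
  have hmul : ∀ a : A, ∀ m ∈ M, a * m ∈ M := by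
    intro a
    have ha : a ∈ Algebra.adjoin K (s : Set A) := by rw [hs]; trivial
    induction ha using Algebra.adjoin_induction with
    | mem a ha =>
      intro m hm
      rw [← A.proj_add_proj a, add_mul]
      refine add_mem ?_ (hMt _ (Finset.mem_image_of_mem _ ha) m hm)
      exact M.smul_mem (⟨A.evenProj a, Algebra.subset_adjoin
        (Finset.mem_coe.2 (Finset.mem_image_of_mem _ ha))⟩ : E) hm
    | algebraMap k =>
      intro m hm
      exact M.smul_mem (algebraMap K E k) hm
    | add a b _ _ ha hb => exact fun m hm => by rw [add_mul]; exact add_mem (ha m hm) (hb m hm)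
    | mul a b _ _ ha hb => exact fun m hm => by rw [mul_assoc]; exact ha _ (hb m hm)
  have hfin : Module.Finite E A := ⟨by
    rwa [show (⊤ : Submodule E A) = M from
      (eq_top_iff.2 fun a _ => by simpa using hmul a 1 h1).symm]⟩
  exact isNoetherian_of_tower E inferInstance

end SAlg

/-! ### The Noetherian property of the base -/

namespace KFunctor

open SAlg

variable {K : Type u} [Field K] [NeZero (2 : K)]
variable {X Y Z : KFunctor K} {A B R S : SAlg K}

/-- An open affine subfunctor of the base of a morphism with faithfully flat fibres is Noetherian
if the source is affine and Noetherian. -/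
lemma HasFibers.isNoetherianRing {π : X ⟶ Y} (hπ : HasFibers π) (eX : X ≅ SSp A)
    [IsNoetherianRing A] {U : Subfunctor Y} (hU : IsOpen U) (eU : U.toFunctor ≅ SSp B) :
    IsNoetherianRing B := by
  -- The tautological point of U; U(S) is then the set of pullbacks of y along morphisms B → S.
  let y : Y.obj B := Subtype.val (p := (· ∈ U.obj B)) (ofCoord eU (𝟙 B))
  have hyU : y ∈ U.obj B := Subtype.prop (p := (· ∈ U.obj B)) (ofCoord eU (𝟙 B))
  have hmap : ∀ {S : SAlg K} (g : B ⟶ S),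
      Y.map g y = Subtype.val (p := (· ∈ U.obj S)) (ofCoord eU g) := fun {S} g => by
    have h1 := congrArg (Subtype.val (p := (· ∈ U.obj S))) (ofCoord_map eU g (𝟙 B))
    rw [Category.id_comp] at h1
    exact h1
  have hinj : ∀ {S : SAlg K} {g g' : B ⟶ S}, Y.map g y = Y.map g' y → g = g' :=
    fun {S} {g g'} h => by
      rw [hmap, hmap] at h
      rw [← coord_ofCoord eU g, ← coord_ofCoord eU g']
      exact congrArg (coord eU) (Subtype.ext h)
  have hsurj : ∀ {S : SAlg K} (z : Y.obj S), z ∈ U.obj S → ∃ g : B ⟶ S, Y.map g y = z :=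
    fun {S} z hz => ⟨coord eU (⟨z, hz⟩ : U.obj S), (hmap _).trans
      (congrArg (Subtype.val (p := (· ∈ U.obj S))) (ofCoord_coord eU (⟨z, hz⟩ : U.obj S)))⟩
  clear_value y
  obtain ⟨C, r, x, hr, hx, hC⟩ := hπ B y
  obtain ⟨x₀, hx₀⟩ : ∃ x₀ : X.obj A, ∀ {S : SAlg K} (x : X.obj S), X.map (coord eX x) x₀ = x :=
    ⟨ofCoord eX (𝟙 A), fun x => by rw [ofCoord_map, Category.id_comp, ofCoord_coord]⟩
  have hX : ∀ {S : SAlg K} {g g' : A ⟶ S}, X.map g x₀ = X.map g' x₀ → g = g' := by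
    intro S g g' h
    have h1 : coord eX x₀ = 𝟙 A := by
      have h1 := congrArg (coord eX) (hx₀ (ofCoord eX (𝟙 A)))
      rw [coord_map, coord_ofCoord, Category.comp_id] at h1
      exact h1
    have h2 := congrArg (coord eX) h
    rwa [coord_map, coord_map, h1, Category.id_comp, Category.id_comp] at h2
  obtain ⟨I, hI⟩ := hU.exists_ideal (π.app A x₀)
  have hmem : ∀ {S : SAlg K} (l : C ⟶ S), π.app S (X.map l x) = Y.map (r ≫ l) y := fun l => by
    rw [app_map, hx, map_comp_apply]
  -- The coordinates of x form the morphism A → C dual to the inclusion of the preimage of U, an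
  -- open subfunctor of X. So C is Noetherian, and this descends along r : B → C.
  have hnoeth : IsNoetherianRing C := by
    refine isNoetherianRing_of_isOpenImmersion (coord eX x) (fun S l l' e => ?_) I fun S k => ?_
    · have h1 : X.map l x = X.map l' x := by
        rw [← hx₀ x, ← map_comp_apply, ← map_comp_apply, e]
      have h2 : r ≫ l = r ≫ l' := hinj (by rw [← hmem, ← hmem, h1])
      exact (hC S (r ≫ l) (X.map l x) (hmem l)).unique ⟨rfl, rfl⟩ ⟨h2.symm, h1.symm⟩
    · rw [← hI, ← app_map]
      constructor
      · rintro ⟨l, rfl⟩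
        rw [map_comp_apply, hx₀, hmem]
        exact U.map _ hyU
      · intro h
        obtain ⟨g, hg⟩ := hsurj _ h
        obtain ⟨l, ⟨-, hl⟩, -⟩ := hC S g _ hg.symm
        exact ⟨l, hX (by rw [map_comp_apply, hx₀, hl])⟩
  exact isNoetherianRing_of_faithfullyFlat hr

/-- A superscheme is Noetherian if it is the base of a morphism with faithfully flat fibres and
Noetherian affine source. -/
theorem HasFibers.isNoetherianSuperscheme {π : X ⟶ Y} (hπ : HasFibers π) (eX : X ≅ SSp A)
    [IsNoetherianRing A] (hY : Y.IsSuperscheme) : Y.IsNoetherianSuperscheme := by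
  obtain ⟨hloc, 𝒰, h𝒰, haff⟩ := hY
  let x := ofCoord eX (𝟙 A)
  -- Finitely many members of the covering already cover the image of X, by quasi-compactness of the
  -- spectrum of A₀.
  obtain ⟨t, ht⟩ := isCompact_univ.elim_finite_subcover
    (fun U : 𝒰 => locus U.1 (π.app A x)) (fun U => (h𝒰.1 U.1 U.2).isOpen_locus _)
    (fun q _ => by
      obtain ⟨U, hU, hq⟩ := h𝒰.exists_mem_locus (π.app A x) q
      exact Set.mem_iUnion.2 ⟨⟨U, hU⟩, hq⟩)
  refine ⟨hloc, Subtype.val '' (t : Set 𝒰), t.finite_toSet.image _, ⟨?_, fun L hL y => ?_⟩, ?_⟩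
  · rintro _ ⟨U, -, rfl⟩
    exact h𝒰.1 U.1 U.2
  -- A point with values in a field L lifts to X over a nonzero extension C, and a prime of C
  -- selects one of the finitely many U. Since L₀ has only one prime, membership of the lift in U at
  -- that prime gives membership of y.
  · obtain ⟨C, r, x', hr, hx', -⟩ := hπ L y
    have : Nontrivial L := ⟨hL.1.exists_pair_ne⟩
    have : Nontrivial C := nontrivial_of_faithfullyFlat hr
    obtain ⟨q⟩ := C.exists_prime
    obtain ⟨U, hU, hq⟩ : ∃ U ∈ t, specMap (coord eX x') q ∈ locus U.1 (π.app A x) := by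
      simpa using ht (Set.mem_univ (specMap (coord eX x') q))
    have hUo := h𝒰.1 U.1 U.2
    refine ⟨U.1, ⟨U, hU, rfl⟩, (hUo.mem_iff y).2 fun p => ?_⟩
    rw [eq_of_isFieldExtension hL p (specMap r q), ← hUo.mem_locus_map, ← hx']
    have h1 : X.map (coord eX x') x = x' := by
      rw [ofCoord_map, Category.id_comp, ofCoord_coord]
    rwa [← hUo.mem_locus_map, ← app_map, h1] at hq
  · rintro _ ⟨U, -, rfl⟩
    obtain ⟨B, ⟨e⟩⟩ := haff U.1 U.2
    exact ⟨B, hπ.isNoetherianRing eX (h𝒰.1 U.1 U.2) e, ⟨e⟩⟩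

lemma IsNoetherianSuperscheme.isSuperscheme (h : Z.IsNoetherianSuperscheme) :
    Z.IsSuperscheme := by
  obtain ⟨h1, 𝒰, -, h𝒰, h2⟩ := h
  exact ⟨h1, 𝒰, h𝒰, fun Y hY => (h2 Y hY).imp fun _ h => h.2⟩

end KFunctor

/-! ### Universal property of the quotient sheaf among superschemes -/

namespace RightAction

open KFunctor

variable {K : Type u} [Field K] [NeZero (2 : K)] {X Z : KFunctor K} {G : Supergroup K}

/-- Morphisms from the naive quotient to a superscheme extend uniquely to the quotient. -/
theorem existsUnique_quotient_lift (ρ : RightAction X G) (hZ : Z.IsSuperscheme)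
    (q : ρ.naiveQuotient ⟶ Z) :
    ∃! g : ρ.quotient ⟶ Z, ρ.quotientMap ≫ g = ρ.naiveMap ≫ q := by
  -- Since Z is an fppf sheaf, the universal property of sheafification applies; the rest passes
  -- between functors on superalgebras and presheaves on the double opposite.
  have hs : Presheaf.IsSheaf (fppfTopology K) Z.presheaf :=
    (isSheaf_iff_isSheaf_of_type _ _).2 hZ.isSheaf_fppfTopology
  let q' : ρ.naiveQuotient.presheaf ⟶ Z.presheaf := Functor.whiskerLeft _ q
  let L := sheafifyLift (fppfTopology K) q' hs
  have hL : toSheafify (fppfTopology K) ρ.naiveQuotient.presheaf ≫ L = q' :=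
    toSheafify_sheafifyLift _ _ hs
  refine ⟨Functor.whiskerLeft (opOp (SAlg K)) L, ?_, fun g hg => ?_⟩
  · ext R x
    exact congrArg (fun f : ρ.naiveQuotient.presheaf ⟶ Z.presheaf =>
      f.app (Opposite.op (Opposite.op R)) (ρ.naiveMap.app R x)) hL
  · let g' : sheafify (fppfTopology K) ρ.naiveQuotient.presheaf ⟶ Z.presheaf :=
      Functor.whiskerLeft (unopUnop (SAlg K)) g
    have h1 : g' = L := sheafifyLift_unique (fppfTopology K) q' hs g' (by
      ext R x
      obtain ⟨x, rfl⟩ := Quotient.exists_rep x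
      exact congrArg (fun f : X ⟶ Z => f.app R.unop.unop x) hg)
    ext R x
    exact congrArg (fun f : sheafify (fppfTopology K) ρ.naiveQuotient.presheaf ⟶ Z.presheaf =>
      f.app (Opposite.op (Opposite.op R)) x) h1

end RightAction

/-! ### Brundan quotients -/

namespace ClosedSupersubgroup

open KFunctor SAlg

variable {K : Type u} [Field K] [NeZero (2 : K)] {G : Supergroup K}

lemma isFree_rightMul (H : ClosedSupersubgroup G) : H.rightMul.IsFree := fun R x _ h =>
  Subtype.ext (mul_eq_left (M := G.obj R) (a := x).1 h)

/-- A closed supersubgroup of SSp A is some V(I) with I a superideal, hence represented by A / I.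
This makes the torsor argument applicable to the action of H on G. -/
lemma isAffine_toSupergroup (H : ClosedSupersubgroup G) (hG : G.toKFunctor.IsAffine) :
    H.toSupergroup.toKFunctor.IsAffine := by
  obtain ⟨A, ⟨e⟩⟩ := hG
  obtain ⟨I, hI, hV⟩ := H.isClosed A e.inv
  have hV' : ∀ (S : SAlg K) (g : A ⟶ S),
      ofCoord e g ∈ H.toSubgroup S ↔ ∀ a ∈ I, Hom.ringHom g a = 0 := fun S g => hV S (SSp.mk g)
  have hp : ∀ a ∈ I, A.parity a ∈ I := fun a ha => by
    rw [parity_apply]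
    exact sub_mem (hI.proj_mem 0 ha) (hI.proj_mem 1 ha)
  have hq : ∀ {S : SAlg K} (t : quot A I hp ⟶ S), ofCoord e (quotMk A I hp ≫ t) ∈ H.toSubgroup S :=
    fun t => (hV' _ _).2 fun a ha => by
      rw [ringHom_comp_apply, (quotMk_eq_zero A I hp).2 ha, map_zero]
  let f : SSp (quot A I hp) ⟶ H.toSupergroup.toKFunctor :=
    { app := fun S => ↾fun t => (⟨_, hq (SSp.hom t)⟩ : H.toSubgroup S)
      naturality := fun S T k => by
        ext t
        exact Subtype.ext (ofCoord_map e k (quotMk A I hp ≫ SSp.hom t)).symm }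
  have hf : ∀ S, IsIso (f.app S) := fun S => by
    refine (isIso_iff_bijective _).2 ⟨fun t t' h => ?_, fun x => ?_⟩
    · have h1 := congrArg (coord e) (congrArg (Subtype.val (p := (· ∈ H.toSubgroup S))) h)
      exact SSp.hom_injective (epi_of_surjective (quotMk_surjective A I hp)
        ((coord_ofCoord _ _).symm.trans (h1.trans (coord_ofCoord _ _))))
    · obtain ⟨x, hx⟩ : H.toSubgroup S := x
      rw [← ofCoord_coord e x] at hx
      obtain ⟨t, ht⟩ := exists_factor_surjective (quotMk A I hp) (quotMk_surjective A I hp)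
        (coord e x) fun a ha => (hV' _ _).1 hx a ((quotMk_eq_zero A I hp).1 ha)
      refine ⟨SSp.mk t, Subtype.ext ?_⟩
      exact (congrArg (ofCoord e) ht).trans (ofCoord_coord e x)
  have := NatIso.isIso_of_isIso_app f
  exact ⟨_, ⟨(asIso f).symm⟩⟩

/-- G is an affine functor with Noetherian coordinate superalgebra and H acts on it freely, so the
fibres of π give the geometric conditions, and the fppf sheaf property of superschemes gives
universality. -/
theorem isBrundanQuotient_quotientMap (H : ClosedSupersubgroup G) (hG : G.IsAlgebraic)
    (hY : H.rightMul.quotient.IsSuperscheme) :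
    H.IsBrundanQuotient H.rightMul.quotientMap := by
  obtain ⟨A, hA, ⟨eX⟩⟩ := hG
  obtain ⟨B, ⟨eG⟩⟩ := H.isAffine_toSupergroup ⟨A, ⟨eX⟩⟩
  have hρ := H.isFree_rightMul
  have h := isAffineMorphism_and_isFaithfullyFlat hρ eX eG hY
  have := isNoetherianRing_of_finiteType (A := A)
  refine ⟨(hasFibers_quotientMap hρ eX eG hY).isNoetherianSuperscheme eX hY, h.1, h.2,
    ⟨_, rfl⟩, ?_⟩
  rintro Z _ hZ ⟨q, rfl⟩
  exact H.rightMul.existsUnique_quotient_lift hZ q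

/-- Both targets are superschemes with the same universal property. -/
lemma IsBrundanQuotient.existsUnique_iso {H : ClosedSupersubgroup G} {Y Y' : KFunctor K}
    {π : G.toKFunctor ⟶ Y} {π' : G.toKFunctor ⟶ Y'} (h : H.IsBrundanQuotient π)
    (h' : H.IsBrundanQuotient π') : ∃! e : Y ≅ Y', π ≫ e.hom = π' := by
  obtain ⟨f, hf, hf'⟩ := h.universal Y' π' h'.isNoetherianSuperscheme.isSuperscheme h'.factors
  obtain ⟨g, hg, -⟩ := h'.universal Y π h.isNoetherianSuperscheme.isSuperscheme h.factors
  refine ⟨⟨f, g, ?_, ?_⟩, hf, fun e he => Iso.ext (hf' _ he)⟩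
  · refine (h.universal Y π h.isNoetherianSuperscheme.isSuperscheme h.factors).unique ?_
      (Category.comp_id π)
    rw [← Category.assoc, hf, hg]
  · refine (h'.universal Y' π' h'.isNoetherianSuperscheme.isSuperscheme h'.factors).unique ?_
      (Category.comp_id π')
    rw [← Category.assoc, hg, hf]

end ClosedSupersubgroup

end

theorem corollary9 {K : Type u} [Field K] (hK : (2 : K) ≠ 0) :
    (∀ (G : Supergroup K) (X : KFunctor K) (ρ : RightAction X G),
      G.IsAlgebraic → X.IsAffine → ρ.IsFree → ρ.quotient.IsSuperscheme →
        KFunctor.IsAffineMorphism ρ.quotientMap ∧ KFunctor.IsFaithfullyFlat ρ.quotientMap) ∧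
    (∀ (G : Supergroup K) (H : ClosedSupersubgroup G),
      G.IsAlgebraic → H.rightMul.quotient.IsSuperscheme →
        H.IsBrundanQuotient H.rightMul.quotientMap ∧
        ∀ (Y : KFunctor K) (π : G.toKFunctor ⟶ Y), H.IsBrundanQuotient π →
          ∃! e : H.rightMul.quotient ≅ Y, H.rightMul.quotientMap ≫ e.hom = π) := by
  have : NeZero (2 : K) := ⟨hK⟩
  refine ⟨?_, fun G H hG hY => ⟨H.isBrundanQuotient_quotientMap hG hY, fun Y π hπ =>
    (H.isBrundanQuotient_quotientMap hG hY).existsUnique_iso hπ⟩⟩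
  rintro G X ρ ⟨B, -, ⟨eG⟩⟩ ⟨A, ⟨eX⟩⟩ hρ hY
  exact KFunctor.isAffineMorphism_and_isFaithfullyFlat hρ eX eG hY
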